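/- Let $\theta_0,\theta_x,\theta_\infty\in\mathbb C$ with $\theta_0\theta_x\neq0$, and consider the fifth Painlevé equation $$ \text{(V)}\quad y''=\Bigl(\frac1{2y}+\frac1{y-1}\Bigr)(y')^2-\frac{y'}{x}+\frac{(y-1)^2}{8x^2}\Bigl((\theta_0-\theta_x+\theta_\infty)^2y-\frac{(\theta_0-\theta_x-\theta_\infty)^2}{y}\Bigr)+(1-\theta_0-\theta_x)\frac yx-\frac{y(y+1)}{2(y-1)} . $$ Let $\mathcal R$ be the universal covering of $\mathbb C\setminus\{0\}$, on which $\log x$ and $x^{\sigma}=e^{\sigma\log x}$ are single-valued. Put $\mathbb Q_\theta=\mathbb Q[\theta_0,\theta_x,\theta_\infty]\subset\mathbb C$, and for a ring $R\subset\mathbb C$ let $R(\sigma_0)$ be the set of values at $\sigma_0$ of rational functions over $R$ whose denominator does not vanish at $\sigma_0$. Then there is $\varepsilon_0\in(0,1)$, depending only on $(\theta_0,\theta_x,\theta_\infty)$, such that the following holds for every $\sigma_0\in\{\theta_0+\theta_x,\ \theta_0-\theta_x,\ \theta_x-\theta_0\}$ with $\sigma_0\notin\mathbb Z\cup(-\infty,-1]$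 and $\sigma_0^2\neq\theta_\infty^2$. For $\rho\in\mathbb C$ let $$ \Omega^0_\rho=\{x\in\mathcal R:\ |x|<\varepsilon_0,\ |\rho x^{\sigma_0}|<\varepsilon_0\},\qquad \Omega_\rho=\{x\in\mathcal R:\ |x|<\varepsilon_0,\ |x(\rho x^{\sigma_0})|<\varepsilon_0\}, $$ and for $\rho\ne0$ let $$ \Omega^-_\rho=\{x\in\mathcal R:\ |x(\rho x^{\sigma_0})|<\varepsilon_0,\ |(\rho x^{\sigma_0})^{-1}|<\varepsilon_0\}, $$ so that $\Omega^0_\rho,\Omega^-_\rho\subset\Omega_\rho$. Put $\Omega^0=\bigcup_{\rho\in\mathbb C}\{\rho\}\times\Omega^0_\rho$ and $\Omega^-=\bigcup_{\rho\neq0}\{\rho\}\times\Omega^-_\rho$. Then (V) has a one-parameter family of solutions $y_{\sigma_0}(\rho,x)$, $\rho\in\mathbb C$, where each $y_{\sigma_0}(\rho,\cdot)$ is a meromorphic solution of (V) on $\Omega_\rho$ (that is, it is nowhere locally constant equal to $0$ or $1$, and it satisfies (V) wherever it is holomorphic with value different from $0$ and $1$), with the following properties. (i) $y_{\sigma_0}(\rho,x)$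 is holomorphic in $(\rho,x)\in\Omega^0\cup\Omega^-$. (ii) There are a constant $A\in\mathbb C$ and coefficients, independent of $\rho$ and $x$, $c^0_j,\ c^0_{jn}\in\mathbb Q_\theta[\theta_0^{-1},\theta_x^{-1}](\sigma_0)$ and $\tilde c^0_j,\ \tilde c^0_{jn}\in\mathbb Q_\theta(\sigma_0)$ such that, with unconditionally (absolutely) convergent series, $$ y_{\sigma_0}(\rho,x)=A\Bigl(1+\kappa\,\rho x^{\sigma_0}+\sum_{j\ge2}c^0_j(\rho x^{\sigma_0})^j+\sum_{n\ge1}x^n\sum_{j\ge0}c^0_{jn}(\rho x^{\sigma_0})^j\Bigr)\quad\text{in }\Omega^0, $$ $$ y_{\sigma_0}(\rho,x)=1+\tilde\kappa\,(\rho x^{\sigma_0})^{-1}+\sum_{j\ge2}\tilde c^0_j(\rho x^{\sigma_0})^{-j}+\sum_{n\ge1}x^n\sum_{j\ge0}\tilde c^0_{jn}(\rho x^{\sigma_0})^{n-j}\quad\text{in }\Omega^-, $$ where (ii.a) if $\sigma_0=\theta_0+\theta_x$: $A=1$, $\kappa=-\dfrac{\sigma_0^2}{\theta_0\theta_x}$,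 $\tilde\kappa=-\dfrac{4\sigma_0^2}{\sigma_0^2-\theta_\infty^2}$; (ii.b) if $\sigma_0=\theta_0-\theta_x$: $A=-\dfrac{\sigma_0-\theta_\infty}{\sigma_0+\theta_\infty}$, $\kappa=-\dfrac{\sigma_0}{\theta_0}$, $\tilde\kappa=-\dfrac{4\theta_0\sigma_0}{\sigma_0^2-\theta_\infty^2}$; (ii.c) if $\sigma_0=\theta_x-\theta_0$: $A=-\dfrac{\sigma_0+\theta_\infty}{\sigma_0-\theta_\infty}$, $\kappa=-\dfrac{\sigma_0}{\theta_x}$, $\tilde\kappa=-\dfrac{4\theta_x\sigma_0}{\sigma_0^2-\theta_\infty^2}$. (iii) For $\rho=0$ the solution is given by a Taylor series: $y_{\sigma_0}(0,x)=A\bigl(1+\sum_{n\ge1}c^0_{0n}x^n\bigr)$, convergent for $|x|<\varepsilon_0$. -/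

import Mathlib

namespace PainleveV

/-- The derivation `d/dx` on the universal covering of `ℂ \ {0}`. A point of the covering is
given by a value `t` of `log x`, so `x = exp t`, and functions on the covering are functions
of `t : ℂ`. Hence `d/dx = (exp t)⁻¹ d/dt`. -/
noncomputable def ddx (y : ℂ → ℂ) (t : ℂ) : ℂ :=
  deriv y t / Complex.exp t

/-- The power `x ^ σ = exp (σ log x)` on the universal covering, in the coordinate `t = log x`. -/
noncomputable def cpowCov (σ t : ℂ) : ℂ :=
  Complex.exp (σ * t)

/-- The fifth Painlevé equation for `y` at the point `t` of the covering (`x = exp t`). -/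
def EqV (θ₀ θₓ θinf : ℂ) (y : ℂ → ℂ) (t : ℂ) : Prop :=
  ddx (ddx y) t
    = (1 / (2 * y t) + 1 / (y t - 1)) * (ddx y t) ^ 2
      - 1 / Complex.exp t * ddx y t
      + (y t - 1) ^ 2 / (8 * Complex.exp t ^ 2)
          * ((θ₀ - θₓ + θinf) ^ 2 * y t - (θ₀ - θₓ - θinf) ^ 2 / y t)
      + (1 - θ₀ - θₓ) * (y t / Complex.exp t)
      - y t * (y t + 1) / (2 * (y t - 1))

/-- `y` is a meromorphic solution of the fifth Painlevé equation on the subset `U` of the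
covering. The values `0` and `1` (and `∞`) are singular values of the equation: a solution is
nowhere locally constant equal to `0` or `1`, and satisfies the equation at every point where it
is holomorphic and takes neither of these values. -/
def IsSolutionV (θ₀ θₓ θinf : ℂ) (y : ℂ → ℂ) (U : Set ℂ) : Prop :=
  MeromorphicOn y U ∧
  (∀ t ∈ U, ∀ᶠ s in nhdsWithin t {t}ᶜ, y s ≠ 0 ∧ y s ≠ 1) ∧
  (∀ t ∈ U, AnalyticAt ℂ y t → y t ≠ 0 → y t ≠ 1 → EqV θ₀ θₓ θinf y t)

/-- `Σ₊ = ℂ \ ((-∞, -1] ∪ ℤ)`. -/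
def SigmaPlus : Set ℂ :=
  {σ | ¬ (σ.im = 0 ∧ σ.re ≤ -1) ∧ ∀ n : ℤ, σ ≠ (n : ℂ)}

/-- `Ω⁰_ρ(ε)`: `|x| < ε` and `|ρ x^σ| < ε`. -/
def OmegaZero (σ : ℂ) (ε : ℝ) (ρ : ℂ) : Set ℂ :=
  {t | ‖Complex.exp t‖ < ε ∧ ‖ρ * cpowCov σ t‖ < ε}

/-- `Ω⁻_{σ,ρ}(ε)` (used for `ρ ≠ 0` only): `|x (ρ x^σ)| < ε` and `|(ρ x^σ)⁻¹| < ε`. -/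
def OmegaMinus (σ : ℂ) (ε : ℝ) (ρ : ℂ) : Set ℂ :=
  {t | ‖Complex.exp t * (ρ * cpowCov σ t)‖ < ε ∧ ‖(ρ * cpowCov σ t)⁻¹‖ < ε}

/-- `Ω_ρ(ε)`: `|x| < ε` and `|x (ρ x^σ)| < ε`. It is connected (convex in the coordinate `t`),
and for `ε ≤ 1` it contains `Ω⁰_ρ(ε)` and, if `ρ ≠ 0`, also `Ω⁻_{σ,ρ}(ε)`. -/
def OmegaFull (σ : ℂ) (ε : ℝ) (ρ : ℂ) : Set ℂ :=
  {t | ‖Complex.exp t‖ < ε ∧ ‖Complex.exp t * (ρ * cpowCov σ t)‖ < ε}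

/-- `Ω⁰(ε) = ⋃_{ρ ∈ ℂ} {ρ} × Ω⁰_ρ(ε)`. -/
def OmegaZeroTotal (σ : ℂ) (ε : ℝ) : Set (ℂ × ℂ) :=
  {p | p.2 ∈ OmegaZero σ ε p.1}

/-- `Ω⁻(σ, ε) = ⋃_{ρ ∈ ℂ \ {0}} {ρ} × Ω⁻_{σ,ρ}(ε)`. -/
def OmegaMinusTotal (σ : ℂ) (ε : ℝ) : Set (ℂ × ℂ) :=
  {p | p.1 ≠ 0 ∧ p.2 ∈ OmegaMinus σ ε p.1}

/-- The ring `ℚ_θ = ℚ[θ₀, θₓ, θ_∞] ⊆ ℂ`. -/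
noncomputable def QTheta (θ₀ θₓ θinf : ℂ) : Subalgebra ℚ ℂ :=
  Algebra.adjoin ℚ {θ₀, θₓ, θinf}

/-- The ring `ℚ_θ[θ₀⁻¹, θₓ⁻¹] ⊆ ℂ`. -/
noncomputable def QThetaInv (θ₀ θₓ θinf : ℂ) : Subalgebra ℚ ℂ :=
  Algebra.adjoin ℚ {θ₀, θₓ, θinf, θ₀⁻¹, θₓ⁻¹}

/-- `R(σ)`: the values at `σ` of the rational functions over the ring `R ⊆ ℂ` whose
denominator does not vanish at `σ`. -/
def ratValues (R : Subalgebra ℚ ℂ) (σ : ℂ) : Set ℂ :=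
  {z | ∃ P Q : Polynomial R,
    Polynomial.aeval σ Q ≠ 0 ∧ z = Polynomial.aeval σ P / Polynomial.aeval σ Q}

end PainleveV
open PainleveV

open scoped ENNReal NNReal Topology
open Filter
namespace PainleveV

/-! ### Weighted ℓ¹ norms of power series in two variables. -/

section

/-! Equation (V) governs isomonodromic deformations, so its solutions are read off from the
Schlesinger system `x A₀' = [Aₓ, A₀]`, `x Aₓ' = [A₀ + x J/2, Aₓ]`, where `J = diag(1, -1)`, the
matrices `A₀`, `Aₓ` are traceless with eigenvalues `±θ₀/2`, `±θₓ/2`, and the (1,1) entry of `A₀ +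
Aₓ` is `-θ_∞/2`. If `r` and `s` are left eigenvectors of `A₀` and `Aₓ` for `θ₀/2` and `θₓ/2`, then
`y = s₂ r₁ / (s₁ r₂)` and the (1,1) entry of `A₀` satisfy the Hamiltonian system of (V)
(`SchlesingerAt.hasDerivAt_quotient`, `eqV_of_system`).

Work in a frame where `A₀ + Aₓ` tends formally to `diag(σ/2, -σ/2)`, and put `u = ρ x^σ`. When `σ =
±θ₀ ± θₓ`, the leading parts of `A₀` and `Aₓ` can be chosen upper triangular with diagonals `±θ₀/2`
and `±θₓ/2`. No negative power of `u` then occurs: the matrices are built from power series in `Z =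
x` and `W = x u`, with one extra factor `u` in the upper right entries. On `Z^i W^j` the operator `x
d/dx` acts as `i + (1+σ) j`. Since `1+σ ∉ (-∞, 0]`, these numbers grow linearly in `i + j`, so there
are no small divisors, and `σ ∉ ℤ` removes the remaining resonance. A degree-by-degree fixed point
gives convergent solutions with coefficients in the field generated by the parameters
(`exists_fixed_series`, `exists_isSeriesSol`).

Left eigenvectors are rows of `A₀ + θ₀/2` and `Aₓ + θₓ/2`, so they are holomorphic on `Ω_ρ` and `y`
is meromorphic there. Each component has the form `F + u G`. Where `x` and `u` are small it is a
series in `x, u`; where `x u` and `u⁻¹` are small, it is, after division by `u` if needed, a series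
in `x u, u⁻¹`. Inverting leading coefficients yields both expansions (`exists_quotient_series`,
`exists_family`). As `u → 0` the two eigenvectors tend to `(1,0)` or `(0,1)` according to the signs,
which gives `A`; as `u → ∞` both tend to the direction `(0,1)`, so `y → 1`. -/

/-- Formal power series in two variables over `ℂ`. -/
abbrev PS := MvPowerSeries (Fin 2) ℂ

/-- Exponents of monomials in two variables. -/
abbrev Ix := Fin 2 →₀ ℕ

/-- Total degree of an exponent. -/
def deg (n : Ix) : ℕ := n 0 + n 1

theorem deg_add (a b : Ix) : deg (a + b) = deg a + deg b := by
  simp only [deg, Finsupp.add_apply]; omega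

theorem deg_eq_zero {n : Ix} (h : deg n = 0) : n = 0 := by
  ext i; unfold deg at h; fin_cases i <;> simp <;> omega

theorem ix_eq (n : Ix) : n = Finsupp.single 0 (n 0) + Finsupp.single 1 (n 1) := by
  ext i; fin_cases i <;> simp

theorem finite_deg_lt (N : ℕ) : {n : Ix | deg n < N}.Finite := by
  refine Set.Finite.of_finite_image (f := fun n : Ix => (n 0, n 1)) ?_ ?_
  · refine ((Set.finite_Iio N).prod (Set.finite_Iio N)).subset ?_
    rintro _ ⟨n, hn, rfl⟩
    simp only [deg, Set.mem_ofPred_eq] at hn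
    constructor <;> simp <;> omega
  · intro a _ b _ h
    simp only [Prod.mk.injEq] at h
    rw [ix_eq a, ix_eq b, h.1, h.2]

/-- The weighted `ℓ¹` norm of a power series for the polyradius `(r, r)`. -/
noncomputable def wnorm (r : ℝ≥0) (f : PS) : ℝ≥0∞ :=
  ∑' n : Ix, ‖f.coeff n‖ₑ * (r : ℝ≥0∞) ^ deg n

variable {r : ℝ≥0} {f g : PS}

theorem wnorm_add_le : wnorm r (f + g) ≤ wnorm r f + wnorm r g := by
  unfold wnorm
  rw [← ENNReal.tsum_add]
  refine ENNReal.tsum_le_tsum fun n => ?_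
  rw [← add_mul, map_add]
  gcongr
  exact enorm_add_le _ _

theorem wnorm_neg : wnorm r (-f) = wnorm r f := by
  simp [wnorm]

theorem wnorm_sub_le : wnorm r (f - g) ≤ wnorm r f + wnorm r g := by
  rw [sub_eq_add_neg, ← wnorm_neg (f := g)]; exact wnorm_add_le

/-- Degrees add under multiplication, so regrouping the double sum along antidiagonals leaves only
the triangle inequality. -/
theorem wnorm_mul_le : wnorm r (f * g) ≤ wnorm r f * wnorm r g := by
  classical
  unfold wnorm
  calc ∑' n : Ix, ‖(f * g).coeff n‖ₑ * (r : ℝ≥0∞) ^ deg n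
      ≤ ∑' n : Ix, ∑' p : Finset.HasAntidiagonal.antidiagonal n,
          (‖f.coeff p.1.1‖ₑ * (r : ℝ≥0∞) ^ deg p.1.1) *
            (‖g.coeff p.1.2‖ₑ * (r : ℝ≥0∞) ^ deg p.1.2) := by
        refine ENNReal.tsum_le_tsum fun n => ?_
        rw [Finset.tsum_subtype (Finset.HasAntidiagonal.antidiagonal n) (fun p : Ix × Ix =>
          (‖f.coeff p.1‖ₑ * (r : ℝ≥0∞) ^ deg p.1) *
            (‖g.coeff p.2‖ₑ * (r : ℝ≥0∞) ^ deg p.2)), MvPowerSeries.coeff_mul]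
        calc _ ≤ (∑ p ∈ Finset.HasAntidiagonal.antidiagonal n, ‖f.coeff p.1 * g.coeff p.2‖ₑ)
              * (r : ℝ≥0∞) ^ deg n := by
              gcongr
              exact enorm_sum_le _ _
          _ = _ := by
              rw [Finset.sum_mul]
              refine Finset.sum_congr rfl fun p hp => ?_
              rw [← Finset.HasAntidiagonal.mem_antidiagonal.mp hp, deg_add, pow_add, enorm_mul]
              ring
    _ = _ := by
        rw [← ENNReal.tsum_sigma (fun n (p : Finset.HasAntidiagonal.antidiagonal n) =>
          (‖f.coeff p.1.1‖ₑ * (r : ℝ≥0∞) ^ deg p.1.1) *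
            (‖g.coeff p.1.2‖ₑ * (r : ℝ≥0∞) ^ deg p.1.2))]
        refine (Finset.HasAntidiagonal.sigmaAntidiagonalEquivProd.tsum_eq (fun p : Ix × Ix =>
          (‖f.coeff p.1‖ₑ * (r : ℝ≥0∞) ^ deg p.1) *
            (‖g.coeff p.2‖ₑ * (r : ℝ≥0∞) ^ deg p.2))).trans ?_
        rw [ENNReal.tsum_prod']
        simp_rw [ENNReal.tsum_mul_left, ENNReal.tsum_mul_right]

theorem wnorm_C (a : ℂ) : wnorm r (MvPowerSeries.C a) = ‖a‖ₑ := by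
  classical
  unfold wnorm
  rw [tsum_eq_single 0]
  · simp [deg]
  · intro n hn
    rw [MvPowerSeries.coeff_C_of_ne_zero hn]; simp

theorem wnorm_X (i : Fin 2) : wnorm r (MvPowerSeries.X i) = r := by
  classical
  unfold wnorm
  rw [tsum_eq_single (Finsupp.single i 1)]
  · fin_cases i <;> simp [deg, MvPowerSeries.coeff_index_single_self_X]
  · intro n hn
    rw [MvPowerSeries.coeff_X, if_neg hn]; simp

theorem wnorm_mono {r' : ℝ≥0} (h : r' ≤ r) : wnorm r' f ≤ wnorm r f := by
  unfold wnorm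
  gcongr

/-- Power series of finite weighted norm. -/
def Conv (r : ℝ≥0) (f : PS) : Prop := wnorm r f < ∞

theorem Conv.add (hf : Conv r f) (hg : Conv r g) : Conv r (f + g) :=
  wnorm_add_le.trans_lt (ENNReal.add_lt_top.2 ⟨hf, hg⟩)

theorem Conv.sub (hf : Conv r f) (hg : Conv r g) : Conv r (f - g) :=
  wnorm_sub_le.trans_lt (ENNReal.add_lt_top.2 ⟨hf, hg⟩)

theorem Conv.mul (hf : Conv r f) (hg : Conv r g) : Conv r (f * g) :=
  wnorm_mul_le.trans_lt (ENNReal.mul_lt_top hf hg)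

theorem Conv.neg (hf : Conv r f) : Conv r (-f) := by
  unfold Conv; rwa [wnorm_neg]

theorem Conv.C (a : ℂ) : Conv r (MvPowerSeries.C a) := by
  unfold Conv; rw [wnorm_C]; exact enorm_lt_top

theorem Conv.X (i : Fin 2) : Conv r (MvPowerSeries.X i) := by
  unfold Conv; rw [wnorm_X]; exact ENNReal.coe_lt_top

theorem Conv.mono {r' : ℝ≥0} (hf : Conv r f) (h : r' ≤ r) : Conv r' f :=
  (wnorm_mono h).trans_lt hf

/-- The monomial `z ^ n₀ * w ^ n₁`. -/
def monom (z w : ℂ) (n : Ix) : ℂ := z ^ n 0 * w ^ n 1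

theorem monom_add (z w : ℂ) (a b : Ix) : monom z w (a + b) = monom z w a * monom z w b := by
  simp only [monom, Finsupp.add_apply]; ring

theorem norm_monom_le {z w : ℂ} (hz : ‖z‖ ≤ r) (hw : ‖w‖ ≤ r) (n : Ix) :
    ‖monom z w n‖ ≤ (r : ℝ) ^ deg n := by
  rw [monom, deg, norm_mul, norm_pow, norm_pow, pow_add]
  gcongr

theorem Conv.summable (hf : Conv r f) : Summable fun n : Ix => ‖f.coeff n‖ * (r : ℝ) ^ deg n := by
  have : Summable fun n : Ix => ‖f.coeff n‖₊ * r ^ deg n := by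
    rw [← ENNReal.tsum_coe_ne_top_iff_summable]
    have h := hf.ne
    unfold wnorm at h
    convert h using 3
    push_cast
    rfl
  have h2 := NNReal.summable_coe.2 this
  push_cast at h2
  exact h2

theorem norm_term_le {z w : ℂ} (hz : ‖z‖ ≤ r) (hw : ‖w‖ ≤ r) (n : Ix) :
    ‖f.coeff n * monom z w n‖ ≤ ‖f.coeff n‖ * (r : ℝ) ^ deg n := by
  rw [norm_mul]
  gcongr
  exact norm_monom_le hz hw n

theorem Conv.summable_norm {z w : ℂ} (hf : Conv r f) (hz : ‖z‖ ≤ r) (hw : ‖w‖ ≤ r) :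
    Summable fun n : Ix => ‖f.coeff n * monom z w n‖ :=
  hf.summable.of_nonneg_of_le (fun _ => norm_nonneg _) fun n => norm_term_le hz hw n

/-- The sum of a power series. -/
noncomputable def ev (f : PS) (z w : ℂ) : ℂ := ∑' n : Ix, f.coeff n * monom z w n

theorem Conv.hasSum {z w : ℂ} (hf : Conv r f) (hz : ‖z‖ ≤ r) (hw : ‖w‖ ≤ r) :
    HasSum (fun n : Ix => f.coeff n * monom z w n) (ev f z w) :=
  (hf.summable_norm hz hw).of_norm.hasSum

section
variable {z w : ℂ}

theorem ev_add (hf : Conv r f) (hg : Conv r g) (hz : ‖z‖ ≤ r) (hw : ‖w‖ ≤ r) :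
    ev (f + g) z w = ev f z w + ev g z w := by
  rw [← ((hf.hasSum hz hw).add (hg.hasSum hz hw)).tsum_eq]
  simp only [ev, map_add, add_mul]

theorem ev_sub (hf : Conv r f) (hg : Conv r g) (hz : ‖z‖ ≤ r) (hw : ‖w‖ ≤ r) :
    ev (f - g) z w = ev f z w - ev g z w := by
  rw [← ((hf.hasSum hz hw).sub (hg.hasSum hz hw)).tsum_eq]
  simp only [ev, map_sub, sub_mul]

theorem ev_neg : ev (-f) z w = - ev f z w := by
  simp only [ev, map_neg, neg_mul, tsum_neg]

theorem ev_C (a : ℂ) : ev (MvPowerSeries.C a) z w = a := by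
  unfold ev
  rw [tsum_eq_single 0]
  · simp [monom]
  · intro n hn
    rw [MvPowerSeries.coeff_C_of_ne_zero hn, zero_mul]

theorem ev_X (i : Fin 2) : ev (MvPowerSeries.X i) z w = ![z, w] i := by
  classical
  unfold ev
  rw [tsum_eq_single (Finsupp.single i 1)]
  · fin_cases i <;> simp [monom, MvPowerSeries.coeff_index_single_self_X]
  · intro n hn
    rw [MvPowerSeries.coeff_X, if_neg hn, zero_mul]

theorem ev_X_zero : ev (MvPowerSeries.X 0) z w = z := ev_X 0

theorem ev_X_one : ev (MvPowerSeries.X 1) z w = w := ev_X 1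

theorem coeff_mul_mul_monom (f g : PS) (z w : ℂ) (n : Ix) : (f * g).coeff n * monom z w n =
   ∑ kl ∈ Finset.HasAntidiagonal.antidiagonal n,
    f.coeff kl.1 * monom z w kl.1 * (g.coeff kl.2 * monom z w kl.2) := by
  rw [MvPowerSeries.coeff_mul, Finset.sum_mul]
  refine Finset.sum_congr rfl fun p hp => ?_
  rw [← Finset.HasAntidiagonal.mem_antidiagonal.mp hp, monom_add]
  ring

theorem tsum_mul_tsum_monom (hf : Conv r f) (hg : Conv r g) (hz : ‖z‖ ≤ r) (hw : ‖w‖ ≤ r) :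
   (∑' n : Ix, f.coeff n * monom z w n) * (∑' n : Ix, g.coeff n * monom z w n) =
   ∑' n : Ix, ∑ kl ∈ Finset.HasAntidiagonal.antidiagonal n,
    f.coeff kl.1 * monom z w kl.1 * (g.coeff kl.2 * monom z w kl.2) := by
  have h1 := hf.summable_norm hz hw
  have h2 := hg.summable_norm hz hw
  have h3 := (summable_mul_of_summable_norm h1 h2)
  exact h1.of_norm.tsum_mul_tsum_eq_tsum_sum_antidiagonal h2.of_norm h3

theorem ev_mul (hf : Conv r f) (hg : Conv r g) (hz : ‖z‖ ≤ r) (hw : ‖w‖ ≤ r) :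
    ev (f * g) z w = ev f z w * ev g z w := by
  unfold ev
  rw [tsum_mul_tsum_monom hf hg hz hw]
  exact tsum_congr fun n => coeff_mul_mul_monom f g z w n

end

/-- The derivative of a two-variable monomial. -/
noncomputable def monomDeriv (q : ℂ × ℂ) (n : Ix) : ℂ × ℂ →L[ℂ] ℂ :=
  (q.1 ^ n 0) • ((n 1 * q.2 ^ (n 1 - 1)) • ContinuousLinearMap.snd ℂ ℂ ℂ) +
    (q.2 ^ n 1) • ((n 0 * q.1 ^ (n 0 - 1)) • ContinuousLinearMap.fst ℂ ℂ ℂ)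

theorem hasFDerivAt_monom (q : ℂ × ℂ) (n : Ix) :
    HasFDerivAt (fun q : ℂ × ℂ => monom q.1 q.2 n) (monomDeriv q n) q := by
  have h1 : HasFDerivAt (fun q : ℂ × ℂ => q.1 ^ n 0) _ q := (hasFDerivAt_fst (𝕜 := ℂ)).pow (n 0)
  have h2 : HasFDerivAt (fun q : ℂ × ℂ => q.2 ^ n 1) _ q := (hasFDerivAt_snd (𝕜 := ℂ)).pow (n 1)
  refine (h1.mul h2).congr_fderiv ?_
  simp only [monomDeriv, nsmul_eq_mul]

theorem norm_monomDeriv_le {ρ s C : ℝ} (hρ : 0 ≤ ρ) (hρs : ρ ≤ s)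
    (hC : ∀ k : ℕ, k * ρ ^ (k - 1) ≤ C * s ^ k) {q : ℂ × ℂ} (h1 : ‖q.1‖ ≤ ρ) (h2 : ‖q.2‖ ≤ ρ)
    (n : Ix) : ‖monomDeriv q n‖ ≤ 2 * C * s ^ deg n := by
  have hC0 : 0 ≤ C := by simpa using hC 0
  have hs : 0 ≤ s := hρ.trans hρs
  have aux : ∀ (L : ℂ × ℂ →L[ℂ] ℂ) (a b : ℂ) (i j : ℕ), ‖L‖ ≤ 1 → ‖a‖ ≤ ρ → ‖b‖ ≤ ρ →
      ‖(a ^ i) • ((j * b ^ (j - 1)) • L)‖ ≤ C * s ^ (i + j) := by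
    intro L a b i j hL ha hb
    rw [norm_smul, norm_smul, norm_pow, norm_mul, norm_pow, Complex.norm_natCast, pow_add]
    have e1 : ‖a‖ ^ i ≤ s ^ i := pow_le_pow_left₀ (norm_nonneg _) (ha.trans hρs) i
    have e2 : ‖b‖ ^ (j - 1) ≤ ρ ^ (j - 1) := pow_le_pow_left₀ (norm_nonneg _) hb _
    have e3 : (j : ℝ) * ‖b‖ ^ (j - 1) ≤ C * s ^ j :=
      (mul_le_mul_of_nonneg_left e2 (by positivity)).trans (hC j)
    calc ‖a‖ ^ i * (j * ‖b‖ ^ (j - 1) * ‖L‖) ≤ s ^ i * (C * s ^ j * 1) :=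
          mul_le_mul e1 (mul_le_mul e3 hL (norm_nonneg _) (by positivity)) (by positivity)
            (by positivity)
      _ = _ := by ring
  refine (norm_add_le _ _).trans ?_
  have b1 := aux (ContinuousLinearMap.snd ℂ ℂ ℂ) q.1 q.2 (n 0) (n 1)
    (ContinuousLinearMap.norm_snd_le _ _ _) h1 h2
  have b2 := aux (ContinuousLinearMap.fst ℂ ℂ ℂ) q.2 q.1 (n 1) (n 0)
    (ContinuousLinearMap.norm_fst_le _ _ _) h2 h1
  rw [add_comm (n 1)] at b2
  refine (add_le_add b1 b2).trans (le_of_eq ?_)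
  rw [deg]; ring

/-- The factor `k` produced by differentiating a monomial is absorbed by the geometric gain `(ρ / s)
^ k`. -/
theorem exists_mul_pow_pred_le {ρ s : ℝ} (hρ : 0 < ρ) (hρs : ρ < s) :
    ∃ C : ℝ, ∀ k : ℕ, k * ρ ^ (k - 1) ≤ C * s ^ k := by
  have hs : 0 < s := hρ.trans hρs
  have h1 : |ρ / s| < 1 := by
    rw [abs_of_pos (div_pos hρ hs), div_lt_one hs]; exact hρs
  obtain ⟨C, hC⟩ := (tendsto_self_mul_const_pow_of_abs_lt_one h1).bddAbove_range
  refine ⟨C / ρ, fun k => ?_⟩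
  have h3 := hC ⟨k, rfl⟩
  simp only [div_pow] at h3
  rcases k with _ | k
  · have : 0 ≤ C := by simpa using h3
    simp; positivity
  · rw [Nat.add_sub_cancel]
    rw [← mul_div_assoc, div_le_iff₀ (by positivity)] at h3
    rw [div_mul_eq_mul_div, le_div_iff₀ hρ]
    rw [pow_succ ρ, ← mul_assoc] at h3
    exact h3

theorem Conv.differentiableAt (hf : Conv r f) {p : ℂ × ℂ} (hz : ‖p.1‖ < r) (hw : ‖p.2‖ < r) :
    DifferentiableAt ℂ (fun p : ℂ × ℂ => ev f p.1 p.2) p := by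
  obtain ⟨ρ, hρ, hρr⟩ : ∃ ρ, max ‖p.1‖ ‖p.2‖ < ρ ∧ ρ < r := exists_between (max_lt hz hw)
  have hρ0 : 0 < ρ := (le_max_of_le_left (norm_nonneg _)).trans_lt hρ
  obtain ⟨C, hC⟩ := exists_mul_pow_pred_le hρ0 hρr
  have hmem : ∀ q ∈ Metric.ball (0 : ℂ × ℂ) ρ, ‖q.1‖ < ρ ∧ ‖q.2‖ < ρ := by
    intro q hq
    rw [mem_ball_zero_iff, Prod.norm_def] at hq
    exact max_lt_iff.1 hq
  have h1 : ∀ (n : Ix) (x : ℂ × ℂ), x ∈ Metric.ball (0 : ℂ × ℂ) ρ →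
      HasFDerivAt (fun q : ℂ × ℂ => f.coeff n * monom q.1 q.2 n) (f.coeff n • monomDeriv x n) x :=
    fun n x _ => (hasFDerivAt_monom x n).const_mul _
  have h2 : ∀ (n : Ix) (x : ℂ × ℂ), x ∈ Metric.ball (0 : ℂ × ℂ) ρ →
      ‖f.coeff n • monomDeriv x n‖ ≤ 2 * C * (‖f.coeff n‖ * (r : ℝ) ^ deg n) := by
    intro n x hx
    rw [norm_smul]
    calc _ ≤ ‖f.coeff n‖ * (2 * C * (r : ℝ) ^ deg n) := by
          gcongr
          exact norm_monomDeriv_le hρ0.le hρr.le hC (hmem x hx).1.le (hmem x hx).2.le n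
      _ = _ := by ring
  have h3 : Summable fun n : Ix => f.coeff n * monom (0 : ℂ × ℂ).1 (0 : ℂ × ℂ).2 n :=
    (hf.summable_norm (by simp) (by simp)).of_norm
  exact (hasFDerivAt_tsum_of_isPreconnected (hf.summable.mul_left (2 * C)) Metric.isOpen_ball
    (convex_ball 0 ρ).isPreconnected h1 h2 (Metric.mem_ball_self hρ0) h3
    (by rw [mem_ball_zero_iff, Prod.norm_def]; exact hρ)).differentiableAt

end

/-! ### Coefficient fields, degree-contracting fixed points and inverses. -/

section

variable {r : ℝ≥0} {f g : PS}

/-- Power series with coefficients in the subfield `K`. -/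
def Rat (K : Subfield ℂ) (f : PS) : Prop := ∀ n : Ix, f.coeff n ∈ K

section
variable {K : Subfield ℂ}

theorem Rat.add (hf : Rat K f) (hg : Rat K g) : Rat K (f + g) := fun n => by
  rw [map_add]; exact K.add_mem (hf n) (hg n)

theorem Rat.sub (hf : Rat K f) (hg : Rat K g) : Rat K (f - g) := fun n => by
  rw [map_sub]; exact K.sub_mem (hf n) (hg n)

theorem Rat.neg (hf : Rat K f) : Rat K (-f) := fun n => by
  rw [map_neg]; exact K.neg_mem (hf n)

theorem Rat.mul (hf : Rat K f) (hg : Rat K g) : Rat K (f * g) := fun n => by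
  classical
  rw [MvPowerSeries.coeff_mul]
  exact K.sum_mem fun p _ => K.mul_mem (hf _) (hg _)

theorem Rat.C {a : ℂ} (ha : a ∈ K) : Rat K (MvPowerSeries.C a) := fun n => by
  classical
  rw [MvPowerSeries.coeff_C]
  split_ifs
  exacts [ha, K.zero_mem]

theorem Rat.X (i : Fin 2) : Rat K (MvPowerSeries.X i) := fun n => by
  classical
  rw [MvPowerSeries.coeff_X]
  split_ifs
  exacts [K.one_mem, K.zero_mem]

theorem Rat.zero : Rat K 0 := fun n => by
  rw [map_zero]; exact K.zero_mem

end

/-- Congruence of power series up to terms of degree at least `d`. -/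
def Cong (d : ℕ) (f g : PS) : Prop := ∀ n : Ix, deg n < d → f.coeff n = g.coeff n

section
variable {d : ℕ} {f' g' : PS}

theorem Cong.refl (d : ℕ) (f : PS) : Cong d f f := fun _ _ => rfl

theorem Cong.of_le {e : ℕ} (h : Cong d f f') (hed : e ≤ d) : Cong e f f' :=
  fun n hn => h n (hn.trans_le hed)

theorem Cong.add (h : Cong d f f') (h' : Cong d g g') : Cong d (f + g) (f' + g') := fun n hn => by
  rw [map_add, map_add, h n hn, h' n hn]

theorem Cong.sub (h : Cong d f f') (h' : Cong d g g') : Cong d (f - g) (f' - g') := fun n hn => by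
  rw [map_sub, map_sub, h n hn, h' n hn]

theorem Cong.mul (h : Cong d f f') (h' : Cong d g g') : Cong d (f * g) (f' * g') := fun n hn => by
  classical
  rw [MvPowerSeries.coeff_mul, MvPowerSeries.coeff_mul]
  refine Finset.sum_congr rfl fun p hp => ?_
  have := deg_add p.1 p.2
  rw [Finset.HasAntidiagonal.mem_antidiagonal.mp hp] at this
  rw [h p.1 (by omega), h' p.2 (by omega)]

theorem Cong.mul_succ (h : Cong (d + 1) f f') (h0 : f.coeff 0 = 0) (h' : Cong d g g') :
    Cong (d + 1) (f * g) (f' * g') := fun n hn => by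
  classical
  rw [MvPowerSeries.coeff_mul, MvPowerSeries.coeff_mul]
  refine Finset.sum_congr rfl fun p hp => ?_
  have := deg_add p.1 p.2
  rw [Finset.HasAntidiagonal.mem_antidiagonal.mp hp] at this
  by_cases h1 : p.1 = 0
  · have h2 := h 0 (by simp [deg])
    rw [h1, ← h2, h0]; simp
  · have h2 : deg p.1 ≠ 0 := fun h => h1 (deg_eq_zero h)
    rw [h p.1 (by omega), h' p.2 (by omega)]

theorem Cong.X_mul (i : Fin 2) (h : Cong d g g') :
    Cong (d + 1) (MvPowerSeries.X i * g) (MvPowerSeries.X i * g') :=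
  (Cong.refl _ _).mul_succ (MvPowerSeries.coeff_zero_X i) h

theorem Cong.C_mul (a : ℂ) (h : Cong d g g') :
    Cong d (MvPowerSeries.C a * g) (MvPowerSeries.C a * g') :=
  (Cong.refl _ _).mul h

end

/-- A degree-contracting self-map of tuples of power series which preserves coefficient field and
norm bounds has a fixed point with these coefficient field and norm bounds. -/
theorem exists_fixed_series {ι : Type*} (K : Subfield ℂ) (R : ι → ℝ≥0∞)
    (Φ : (ι → PS) → ι → PS)
    (hΦ : ∀ v, (∀ i, Rat K (v i)) → (∀ i, wnorm r (v i) ≤ R i) →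
      (∀ i, Rat K (Φ v i)) ∧ ∀ i, wnorm r (Φ v i) ≤ R i)
    (hc : ∀ d v v', (∀ i, Cong d (v i) (v' i)) → ∀ i, Cong (d + 1) (Φ v i) (Φ v' i)) :
    ∃ v, Φ v = v ∧ (∀ i, Rat K (v i)) ∧ ∀ i, wnorm r (v i) ≤ R i := by
  let u : ℕ → ι → PS := fun k => Φ^[k] 0
  have hu : ∀ k, u (k + 1) = Φ (u k) := fun k => Function.iterate_succ_apply' Φ k 0
  have hS : ∀ k, (∀ i, Rat K (u k i)) ∧ ∀ i, wnorm r (u k i) ≤ R i := by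
    intro k
    induction k with
    | zero => exact ⟨fun i => Rat.zero, fun i => by simp [u, wnorm]⟩
    | succ k ih => rw [hu]; exact hΦ _ ih.1 ih.2
  have h1 : ∀ k i, Cong k (u k i) (u (k + 1) i) := by
    intro k
    induction k with
    | zero => intro i n hn; omega
    | succ k ih => rw [hu, hu (k + 1)]; exact hc k _ _ ih
  have h2 : ∀ k j i, Cong k (u k i) (u (k + j) i) := by
    intro k j
    induction j with
    | zero => exact fun i => Cong.refl _ _
    | succ j ih =>
      intro i n hn
      rw [ih i n hn]
      exact h1 (k + j) i n (by omega)
  -- The `k`-th iterate is final in degrees below `k`, so a coefficient of degree `d` is read off at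
  -- step `d + 1`; this also keeps it in `K`.
  let v : ι → PS := fun i n => (u (deg n + 1) i).coeff n
  have hv : ∀ i n, (v i).coeff n = (u (deg n + 1) i).coeff n := fun i n => rfl
  have h3 : ∀ k i, Cong k (v i) (u k i) := by
    intro k i n hn
    obtain ⟨j, rfl⟩ := Nat.exists_eq_add_of_le (Nat.succ_le_of_lt hn)
    rw [hv]
    exact h2 (deg n + 1) j i n (by omega)
  refine ⟨v, ?_, fun i n => (hS _).1 i n, fun i => ?_⟩
  · funext i
    ext n
    rw [hc (deg n) v (u (deg n)) (h3 _) i n (by omega), ← hu]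
    exact (h3 (deg n + 1) i n (by omega)).symm
  -- No convergence in norm is needed: a finite partial sum of the limit is a partial sum of a
  -- single iterate, which obeys the bound.
  · unfold wnorm
    rw [ENNReal.tsum_eq_iSup_sum]
    refine iSup_le fun s => ?_
    have h4 : ∀ n ∈ s, deg n < s.sup deg + 1 := fun n hn => Nat.lt_succ_of_le (Finset.le_sup hn)
    calc _ = ∑ n ∈ s, ‖(u (s.sup deg + 1) i).coeff n‖ₑ * (r : ℝ≥0∞) ^ deg n :=
          Finset.sum_congr rfl fun n hn => by rw [h3 _ i n (h4 n hn)]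
      _ ≤ wnorm r (u (s.sup deg + 1) i) := ENNReal.sum_le_tsum s
      _ ≤ R i := (hS _).2 i

/-- Every surviving term has degree at least one and so gains at least one factor `t`. -/
theorem wnorm_mul_le_of_coeff_zero {t : ℝ≥0} (ht : t ≤ 1) (h0 : f.coeff 0 = 0) :
    wnorm (t * r) f ≤ t * wnorm r f := by
  unfold wnorm
  rw [← ENNReal.tsum_mul_left]
  refine ENNReal.tsum_le_tsum fun n => ?_
  by_cases hn : n = 0
  · simp [hn, h0]
  · have h1 : 1 ≤ deg n := Nat.one_le_iff_ne_zero.2 fun h => hn (deg_eq_zero h)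
    have h2 : (t : ℝ≥0∞) ^ deg n ≤ t := by
      refine (pow_le_pow_right_of_le_one' (by exact_mod_cast ht) h1).trans_eq (pow_one _)
    calc _ = (t : ℝ≥0∞) ^ deg n * (‖f.coeff n‖ₑ * (r : ℝ≥0∞) ^ deg n) := by
          push_cast; ring
      _ ≤ _ := by gcongr

theorem Conv.exists_small {h : PS} (hh : Conv r h) (hr : 0 < r) (h0 : h.coeff 0 = 0) {δ : ℝ≥0}
    (hδ : 0 < δ) : ∃ r' : ℝ≥0, 0 < r' ∧ r' ≤ r ∧ wnorm r' h ≤ δ := by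
  obtain ⟨W, hW⟩ : ∃ W : ℝ≥0, (W : ℝ≥0∞) = wnorm r h := ⟨_, ENNReal.coe_toNNReal hh.ne⟩
  refine ⟨min 1 (δ / (W + 1)) * r, by positivity, mul_le_of_le_one_left' (min_le_left _ _), ?_⟩
  refine (wnorm_mul_le_of_coeff_zero (min_le_left _ _) h0).trans ?_
  rw [← hW]
  norm_cast
  calc min 1 (δ / (W + 1)) * W ≤ δ / (W + 1) * (W + 1) := by
        gcongr
        · exact min_le_right _ _
        · exact le_self_add
    _ = δ := div_mul_cancel₀ _ (by positivity)

/-- A convergent power series with nonzero constant term is invertible. -/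
theorem Conv.exists_inv {K : Subfield ℂ} (hf : Conv r f) (hr : 0 < r) (hK : Rat K f)
    (h0 : f.coeff 0 ≠ 0) :
    ∃ (r' : ℝ≥0) (g : PS), 0 < r' ∧ r' ≤ r ∧ Conv r' g ∧ Rat K g ∧ f * g = 1 := by
  set a := f.coeff 0 with ha
  have haK : a⁻¹ ∈ K := K.inv_mem (hK 0)
  set h : PS := 1 - MvPowerSeries.C a⁻¹ * f with hh
  have hh0 : h.coeff 0 = 0 := by
    rw [hh, map_sub, MvPowerSeries.coeff_zero_one, MvPowerSeries.coeff_C_mul, ← ha,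
      inv_mul_cancel₀ h0, sub_self]
  have h1 : (1 : PS) = MvPowerSeries.C 1 := (map_one _).symm
  have hhK : Rat K h := by
    rw [hh, h1]; exact (Rat.C K.one_mem).sub ((Rat.C haK).mul hK)
  have hhr : Conv r h := by
    rw [hh, h1]; exact (Conv.C _).sub ((Conv.C _).mul hf)
  obtain ⟨r', hr', hr'r, hsmall⟩ := hhr.exists_small hr hh0 (δ := 1 / 2) (by norm_num)
  -- Neumann series for `f = a (1 - h)`: the inverse solves `v = a⁻¹ + h v`. With `wnorm r' h ≤ 1/2`
  -- the ball of radius `2 ‖a⁻¹‖` is preserved, and `h` raises the degree because its constant term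
  -- vanishes.
  obtain ⟨v, hv, hvK, hvR⟩ := exists_fixed_series (r := r') (ι := Unit) K
    (fun _ => ((2 * ‖a⁻¹‖₊ : ℝ≥0) : ℝ≥0∞)) (fun v _ => MvPowerSeries.C a⁻¹ + h * v ())
    (by
      intro v hv1 hv2
      refine ⟨fun _ => (Rat.C haK).add (hhK.mul (hv1 ())), fun _ => ?_⟩
      refine wnorm_add_le.trans ((add_le_add (wnorm_C _).le
        (wnorm_mul_le.trans (mul_le_mul' hsmall (hv2 ())))).trans (le_of_eq ?_))
      rw [enorm_eq_nnnorm, ← ENNReal.coe_mul, ← ENNReal.coe_add]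
      congr 1
      ring_nf)
    (by
      intro d v v' hvv' _
      exact (Cong.refl _ _).add ((Cong.refl _ _).mul_succ hh0 (hvv' ())))
  refine ⟨r', v (), hr', hr'r, (hvR ()).trans_lt ENNReal.coe_lt_top, hvK (), ?_⟩
  have h2 : MvPowerSeries.C a⁻¹ + h * v () = v () := congrFun hv ()
  have h3 : MvPowerSeries.C a⁻¹ * (f * v ()) = MvPowerSeries.C a⁻¹ := by
    have : h * v () = v () - MvPowerSeries.C a⁻¹ * (f * v ()) := by rw [hh]; ring
    rw [this] at h2
    linear_combination -h2
  have h4 : (MvPowerSeries.C a * MvPowerSeries.C a⁻¹ : PS) = 1 := by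
    rw [← map_mul, mul_inv_cancel₀ h0, map_one]
  calc f * v () = MvPowerSeries.C a * (MvPowerSeries.C a⁻¹ * (f * v ())) := by
        rw [← mul_assoc, h4, one_mul]
    _ = 1 := by rw [h3, h4]

/-! ### The Euler operator `x d/dx` on series and the absence of small divisors. -/

/-- The eigenvalue `i + τ j` of the Euler operator on the monomial `Z ^ i * W ^ j`. -/
def lam (τ : ℂ) (n : Ix) : ℂ := n 0 + τ * n 1

theorem lam_add (τ : ℂ) (a b : Ix) : lam τ (a + b) = lam τ a + lam τ b := by
  simp only [lam, Finsupp.add_apply]; push_cast; ring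

/-- The Euler operator `Z ∂_Z + τ W ∂_W`. -/
noncomputable def euler (τ : ℂ) (f : PS) : PS := fun n => lam τ n * f.coeff n

/-- The inverse of `euler τ - μ` off the resonances. -/
noncomputable def eulerInv (τ μ : ℂ) (f : PS) : PS := fun n => (lam τ n - μ)⁻¹ * f.coeff n

section
variable {τ μ : ℂ}

theorem coeff_euler (n : Ix) : (euler τ f).coeff n = lam τ n * f.coeff n := rfl

theorem coeff_eulerInv (n : Ix) : (eulerInv τ μ f).coeff n = (lam τ n - μ)⁻¹ * f.coeff n := rfl

theorem euler_add : euler τ (f + g) = euler τ f + euler τ g := by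
  ext n; simp only [coeff_euler, map_add]; ring

theorem euler_sub : euler τ (f - g) = euler τ f - euler τ g := by
  ext n; simp only [coeff_euler, map_sub]; ring

theorem euler_mul : euler τ (f * g) = euler τ f * g + f * euler τ g := by
  classical
  ext n
  simp only [coeff_euler, map_add, MvPowerSeries.coeff_mul]
  rw [Finset.mul_sum, ← Finset.sum_add_distrib]
  refine Finset.sum_congr rfl fun p hp => ?_
  rw [← Finset.HasAntidiagonal.mem_antidiagonal.mp hp, lam_add]
  ring

theorem euler_C (a : ℂ) : euler τ (MvPowerSeries.C a) = 0 := by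
  classical
  ext n
  rw [coeff_euler, MvPowerSeries.coeff_C]
  split_ifs with h
  · simp [h, lam]
  · simp

theorem euler_X_zero : euler τ (MvPowerSeries.X 0) = MvPowerSeries.X 0 := by
  classical
  ext n
  rw [coeff_euler, MvPowerSeries.coeff_X]
  split_ifs with h
  · simp [h, lam]
  · simp

theorem euler_X_one : euler τ (MvPowerSeries.X 1) = MvPowerSeries.C τ * MvPowerSeries.X 1 := by
  classical
  ext n
  rw [coeff_euler, MvPowerSeries.coeff_C_mul, MvPowerSeries.coeff_X]
  split_ifs with h
  · simp [h, lam]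
  · simp

/-- At a resonant exponent `eulerInv` returns `0`, because `0⁻¹ = 0`; solvability there forces the
coefficient of `f` to vanish. -/
theorem euler_eulerInv (h : ∀ n, lam τ n = μ → f.coeff n = 0) :
    euler τ (eulerInv τ μ f) = f + MvPowerSeries.C μ * eulerInv τ μ f := by
  ext n
  rw [map_add, MvPowerSeries.coeff_C_mul, coeff_euler, coeff_eulerInv]
  by_cases h1 : lam τ n = μ
  · rw [h n h1]; simp
  · have : lam τ n - μ ≠ 0 := sub_ne_zero.2 h1
    field_simp
    ring

theorem Rat.eulerInv {K : Subfield ℂ} (hf : Rat K f) (hτ : τ ∈ K) (hμ : μ ∈ K) :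
    Rat K (eulerInv τ μ f) := fun n => by
  rw [coeff_eulerInv]
  refine K.mul_mem (K.inv_mem (K.sub_mem (K.add_mem ?_ (K.mul_mem hτ ?_)) hμ)) (hf n) <;>
  exact natCast_mem K _

theorem Cong.eulerInv {d : ℕ} (h : Cong d f g) : Cong d (eulerInv τ μ f) (eulerInv τ μ g) :=
  fun n hn => by rw [coeff_eulerInv, coeff_eulerInv, h n hn]

end

/-- Numbers outside of the closed negative real half-line. -/
theorem exists_norm_lam_ge {τ : ℂ} (hτ : ¬ (τ.im = 0 ∧ τ.re ≤ 0)) :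
    ∃ δ : ℝ, 0 < δ ∧ ∀ n : Ix, δ * deg n ≤ ‖lam τ n‖ := by
  have hre : ∀ n, (lam τ n).re = n 0 + τ.re * n 1 := fun n => by simp [lam]
  have him : ∀ n, (lam τ n).im = τ.im * n 1 := fun n => by simp [lam]
  by_cases h : τ.im = 0
  · have h1 : 0 < τ.re := by
      by_contra h2; exact hτ ⟨h, not_lt.1 h2⟩
    refine ⟨min 1 τ.re, by positivity, fun n => ?_⟩
    refine le_trans ?_ (Complex.re_le_norm _)
    rw [hre, deg]
    push_cast
    have := min_le_left 1 τ.re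
    have := min_le_right 1 τ.re
    have h3 : (0 : ℝ) ≤ n 0 := Nat.cast_nonneg _
    have h4 : (0 : ℝ) ≤ n 1 := Nat.cast_nonneg _
    nlinarith
  · have hi : 0 < |τ.im| := abs_pos.2 h
    -- The imaginary part gives `n 1 ≤ ‖λ‖ / |τ.im|`, and then `n 0 ≤ ‖λ‖ + ‖τ‖ n 1`; the constant
    -- is the inverse of the sum of the two bounds.
    refine ⟨(1 + (‖τ‖ + 1) / |τ.im|)⁻¹, by positivity, fun n => ?_⟩
    rw [inv_mul_le_iff₀ (by positivity)]
    have h1 : |τ.im| * n 1 ≤ ‖lam τ n‖ := by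
      refine le_trans (le_of_eq ?_) (Complex.abs_im_le_norm _)
      rw [him, abs_mul, Nat.abs_cast]
    have h2 : (n 0 : ℝ) ≤ ‖lam τ n‖ + ‖τ‖ * n 1 := by
      have : ((n 0 : ℕ) : ℂ) = lam τ n - τ * n 1 := by rw [lam]; ring
      calc (n 0 : ℝ) = ‖((n 0 : ℕ) : ℂ)‖ := (Complex.norm_natCast _).symm
        _ ≤ ‖lam τ n‖ + ‖τ * n 1‖ := by rw [this]; exact norm_sub_le _ _
        _ = _ := by rw [norm_mul, Complex.norm_natCast]
    have h3 : (n 1 : ℝ) ≤ ‖lam τ n‖ / |τ.im| := by rw [le_div_iff₀ hi]; linarith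
    have h4 : (‖τ‖ + 1) * n 1 ≤ (‖τ‖ + 1) * (‖lam τ n‖ / |τ.im|) := by gcongr
    rw [deg]
    push_cast
    calc (n 0 : ℝ) + n 1 ≤ ‖lam τ n‖ + (‖τ‖ + 1) * n 1 := by linarith
      _ ≤ _ := by
        refine (add_le_add_right h4 _).trans (le_of_eq ?_)
        ring

theorem lam_ne_zero {τ : ℂ} (hτ : ¬ (τ.im = 0 ∧ τ.re ≤ 0)) {n : Ix} (hn : n ≠ 0) :
    lam τ n ≠ 0 := by
  obtain ⟨δ, hδ, h⟩ := exists_norm_lam_ge hτ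
  have h1 : (1 : ℝ) ≤ deg n := by
    exact_mod_cast Nat.one_le_iff_ne_zero.2 fun h => hn (deg_eq_zero h)
  have := h n
  rw [← norm_pos_iff]
  nlinarith

/-- Linear growth of the eigenvalues makes the inverse at most `1` outside finitely many exponents.
A resonance among these is harmless, since `0⁻¹ = 0`. -/
theorem exists_norm_inv_le {τ : ℂ} (hτ : ¬ (τ.im = 0 ∧ τ.re ≤ 0)) (μ : ℂ) :
    ∃ C : ℝ≥0, ∀ n : Ix, ‖(lam τ n - μ)⁻¹‖₊ ≤ C := by
  obtain ⟨δ, hδ, h⟩ := exists_norm_lam_ge hτ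
  obtain ⟨N, hN⟩ := exists_nat_ge ((‖μ‖ + 1) / δ)
  rw [div_le_iff₀ hδ] at hN
  set S := (finite_deg_lt N).toFinset with hS
  refine ⟨1 + ∑ n ∈ S, ‖(lam τ n - μ)⁻¹‖₊, fun n => ?_⟩
  by_cases hn : deg n < N
  · refine le_trans ?_ le_add_self
    exact Finset.single_le_sum (f := fun n => ‖(lam τ n - μ)⁻¹‖₊) (fun _ _ => zero_le) (by simpa [hS] using hn)
  · refine le_trans ?_ le_self_add
    have h1 : (N : ℝ) ≤ deg n := by exact_mod_cast not_lt.1 hn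
    have h2 := h n
    have h3 : ‖lam τ n‖ - ‖μ‖ ≤ ‖lam τ n - μ‖ := norm_sub_norm_le _ _
    have h4 : 1 ≤ ‖lam τ n - μ‖ := by nlinarith
    rw [nnnorm_inv]
    exact inv_le_one_of_one_le₀ h4

/-- A bound for the weighted norm. -/
def Bd (r : ℝ≥0) (f : PS) (a : ℝ≥0) : Prop := wnorm r f ≤ a

section
variable {a b : ℝ≥0}

theorem Bd.add (hf : Bd r f a) (hg : Bd r g b) : Bd r (f + g) (a + b) := by
  unfold Bd
  push_cast
  exact wnorm_add_le.trans (add_le_add hf hg)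

theorem Bd.sub (hf : Bd r f a) (hg : Bd r g b) : Bd r (f - g) (a + b) := by
  unfold Bd
  push_cast
  exact wnorm_sub_le.trans (add_le_add hf hg)

theorem Bd.mul (hf : Bd r f a) (hg : Bd r g b) : Bd r (f * g) (a * b) := by
  unfold Bd
  push_cast
  exact wnorm_mul_le.trans (mul_le_mul' hf hg)

theorem Bd.C {x : ℂ} (h : ‖x‖₊ ≤ a) : Bd r (MvPowerSeries.C x) a := by
  unfold Bd
  rw [wnorm_C]
  exact_mod_cast h

theorem Bd.X (i : Fin 2) : Bd r (MvPowerSeries.X i) r := (wnorm_X i).le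

theorem Bd.eulerInv {τ μ : ℂ} {C : ℝ≥0} (hf : Bd r f a) (h : ∀ n : Ix, ‖(lam τ n - μ)⁻¹‖₊ ≤ C) :
    Bd r (eulerInv τ μ f) (C * a) := by
  unfold Bd
  push_cast
  refine le_trans ?_ (mul_le_mul' le_rfl hf)
  unfold wnorm
  rw [← ENNReal.tsum_mul_left]
  refine ENNReal.tsum_le_tsum fun n => ?_
  rw [coeff_eulerInv, enorm_mul, mul_assoc]
  gcongr
  exact_mod_cast h n

theorem Bd.le (hf : Bd r f a) (h : (a : ℝ) ≤ b) : Bd r f b :=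
  hf.trans (by exact_mod_cast h)

end

end

/-! ### Convergent series solutions of the Schlesinger system. -/

section

open MvPowerSeries (C X)

/-- Formal solutions of the Schlesinger system in the variables `Z = x` and `W = x · ρ x^σ`. -/
structure IsSeriesSol (σ k₁ k₂ k₃ m₀ β : ℂ) (al pi m q c b₁ b₂ : PS) : Prop where
  al_eq : euler (1 + σ) al = X 0 * (C k₂ * (X 0 * (q - c)) - C k₃ * (pi - b₁)) + C k₃ * (X 1 * b₂)
  pi_eq : euler (1 + σ) pi =
    X 0 * (C (2 * k₁) * (pi - b₁) - C (2 * k₂) * (C (σ / 2) + al - m)) - C (2 * k₁) * (X 1 * b₂)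
  m_eq : euler (1 + σ) m = X 0 * (pi * c - q * b₁) - X 1 * (q * b₂)
  q_eq : euler (1 + σ) q =
    C (2 * k₃) * (C (σ / 2) + al - m) - C (2 * k₁) * (X 0 * (q - c)) + C (-1) * q
  c_eq : euler (1 + σ) c = C 2 * (q * m - al * c) + C (-(1 + σ)) * c
  b₁_eq : euler (1 + σ) b₁ = C 2 * (al * b₁ - pi * m) + C σ * b₁
  b₂_eq : euler (1 + σ) b₂ = C 2 * (al * b₂)
  al_zero : al.coeff 0 = 0
  pi_zero : pi.coeff 0 = 0
  m_zero : m.coeff 0 = m₀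
  b₁_zero : b₁.coeff 0 = 0
  b₂_zero : b₂.coeff 0 = β

/-- The right-hand side of the integrated Schlesinger system. -/
noncomputable def sysMap (σ k₁ k₂ k₃ m₀ β : ℂ) (v : Fin 7 → PS) : Fin 7 → PS :=
  let al := eulerInv (1 + σ) 0
    (X 0 * (C k₂ * (X 0 * (v 3 - v 4)) - C k₃ * (v 1 - v 5)) + C k₃ * (X 1 * v 6))
  let pi := eulerInv (1 + σ) 0
    (X 0 * (C (2 * k₁) * (v 1 - v 5) - C (2 * k₂) * (C (σ / 2) + v 0 - v 2))
      - C (2 * k₁) * (X 1 * v 6))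
  let m := C m₀ + eulerInv (1 + σ) 0 (X 0 * (v 1 * v 4 - v 3 * v 5) - X 1 * (v 3 * v 6))
  let q := eulerInv (1 + σ) (-1)
    (C (2 * k₃) * (C (σ / 2) + al - m) - C (2 * k₁) * (X 0 * (v 3 - v 4)))
  ![al, pi, m, q, eulerInv (1 + σ) (-(1 + σ)) (C 2 * (q * m - al * v 4)),
    eulerInv (1 + σ) σ (C 2 * (al * v 5 - pi * m)),
    C β + eulerInv (1 + σ) 0 (C 2 * (al * v 6))]

theorem coeff_eulerInv_zero_eq_zero (τ μ : ℂ) {f : PS} (h : f.coeff 0 = 0) :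
    (eulerInv τ μ f).coeff 0 = 0 := by
  rw [coeff_eulerInv, h, mul_zero]

theorem forall_fin_seven {P : Fin 7 → Prop} (h0 : P 0) (h1 : P 1) (h2 : P 2) (h3 : P 3) (h4 : P 4)
    (h5 : P 5) (h6 : P 6) : ∀ i, P i := by
  intro i; fin_cases i <;> assumption

/-- Arithmetic of the invariant polydisc: `c` dominates the data, `η` bounds `al` and `pi`, and `x`
bounds the other five series. The sharper bounds `2 c` for `m` and `5 c ^ 3` for `q` give `10 c ^ 6
+ c ^ 2 / 4` for the series `c`, hence the factor `11`. The choice of `η` makes `η x = 1/4`, and `r`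
is small enough that every term carrying `X 0` or `X 1` is negligible. -/
theorem sysMap_bd_aux {c x η r : ℝ} (c2 : 2 ≤ c) (ex : x = 11 * c ^ 6) (hη0 : 0 ≤ η)
    (hr0 : 0 ≤ r) (eη : η * (4 * x) = 1) (er : r * (20 * c ^ 2 * x ^ 2) = η) :
    c * (r * (c * (r * (x + x)) + c * (η + x)) + c * (r * x)) ≤ η ∧
    c * (r * (c * (η + x) + c * (c + η + x)) + c * (r * x)) ≤ η ∧
    c + c * (r * (η * x + x * x) + r * (x * x)) ≤ 2 * c ∧
    c * (c * (c + η + 2 * c) + c * (r * (x + x))) ≤ 5 * c ^ 3 ∧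
    c * (c * (5 * c ^ 3 * (2 * c) + η * x)) ≤ x ∧
    c * (c * (η * x + η * (2 * c))) ≤ x ∧
    c + c * (c * (η * x)) ≤ x ∧ 2 * c ≤ x ∧ 5 * c ^ 3 ≤ x := by
  have p1 : (1 : ℝ) ≤ c ^ 5 := one_le_pow₀ (by linarith)
  have hcx : 11 * c ≤ x := by
    rw [ex]
    nlinarith
  have hx1 : (1 : ℝ) ≤ x := by linarith
  have hx0 : 0 ≤ x := by linarith
  have hηx : η * x = 1 / 4 := by linarith
  have hη1 : η ≤ 1 := by nlinarith
  have hcx2 : 1 ≤ c * x := by nlinarith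
  have hr1 : r ≤ 1 := by
    have : 1 ≤ 20 * c ^ 2 * x ^ 2 := by nlinarith
    nlinarith
  have hrx : r * (c ^ 2 * x) ≤ η / 20 := by
    have : r * (c ^ 2 * x) * 1 ≤ r * (c ^ 2 * x) * x :=
      mul_le_mul_of_nonneg_left hx1 (by positivity)
    linarith
  have e0 : (1 : ℝ) ≤ c ^ 2 := one_le_pow₀ (by linarith)
  have e4 : (1 : ℝ) ≤ c ^ 4 := one_le_pow₀ (by linarith)
  have e5 : c ^ 2 ≤ c ^ 6 := pow_le_pow_right₀ (by linarith) (by norm_num)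
  have e6 : c ^ 3 ≤ c ^ 6 := pow_le_pow_right₀ (by linarith) (by norm_num)
  have e7 : c ≤ c ^ 6 := le_self_pow₀ (by linarith) (by norm_num)
  refine ⟨?_, ?_, ?_, ?_, ?_, ?_, ?_, by linarith, by linarith⟩
  · have e1 : r * (x + x) ≤ x + x := mul_le_of_le_one_left (by linarith) hr1
    calc c * (r * (c * (r * (x + x)) + c * (η + x)) + c * (r * x))
        ≤ c * (r * (c * (x + x) + c * (x + x)) + c * (r * x)) := by
          gcongr
          linarith
      _ = 5 * (r * (c ^ 2 * x)) := by ring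
      _ ≤ η := by linarith
  · calc c * (r * (c * (η + x) + c * (c + η + x)) + c * (r * x))
        ≤ c * (r * (c * (x + x) + c * (x + x + x)) + c * (r * x)) := by
          gcongr
          · linarith
          · linarith
          · linarith
      _ = 6 * (r * (c ^ 2 * x)) := by ring
      _ ≤ η := by linarith
  · have e1 : η * x ≤ x * x := mul_le_mul_of_nonneg_right (by linarith) hx0
    have e2 : r * c * x ^ 2 * 1 ≤ r * c * x ^ 2 * c :=
      mul_le_mul_of_nonneg_left (by linarith) (by positivity)
    calc c + c * (r * (η * x + x * x) + r * (x * x))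
        ≤ c + c * (r * (x * x + x * x) + r * (x * x)) := by gcongr
      _ = c + 3 * (r * c * x ^ 2 * 1) := by ring
      _ ≤ c + 3 * (r * c * x ^ 2 * c) := by linarith
      _ = c + 3 * (r * (20 * c ^ 2 * x ^ 2)) / 20 := by ring
      _ ≤ 2 * c := by rw [er]; linarith
  · calc c * (c * (c + η + 2 * c) + c * (r * (x + x)))
        = c ^ 2 * (c + η + 2 * c) + 2 * (r * (c ^ 2 * x)) := by ring
      _ ≤ c ^ 2 * (c + c + 2 * c) + c ^ 2 * c := by
          gcongr
          · linarith
          · nlinarith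
          · linarith
      _ = 5 * c ^ 3 := by ring
  · rw [hηx, ex]
    calc c * (c * (5 * c ^ 3 * (2 * c) + 1 / 4)) = 10 * c ^ 6 + c ^ 2 / 4 := by ring
      _ ≤ 11 * c ^ 6 := by linarith
  · have e8 : η * (2 * c) ≤ 1 := by
      calc η * (2 * c) ≤ η * x := by gcongr; linarith
        _ ≤ 1 := by linarith
    calc c * (c * (η * x + η * (2 * c))) ≤ c * (c * (1 / 4 + 1)) := by rw [hηx]; gcongr
      _ = c ^ 2 * (5 / 4) := by ring
      _ ≤ x := by rw [ex]; linarith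
  · rw [hηx, ex]
    calc c + c * (c * (1 / 4)) = c + c ^ 2 / 4 := by ring
      _ ≤ 11 * c ^ 6 := by linarith

section
variable (σ k₁ k₂ k₃ m₀ β : ℂ)

/-- One degree is gained because `al`, `pi`, `m` depend on the old values only through `X 0` or `X
1`. The other four equations contain terms without such a factor, so in those terms the updated
`al`, `pi`, `m`, `q` are used; a product of the new `al` with an old value also gains a degree,
since `al` has no constant term. -/
theorem sysMap_cong {d : ℕ} {v v' : Fin 7 → PS} (h : ∀ i, Cong d (v i) (v' i)) (i : Fin 7) :
    Cong (d + 1) (sysMap σ k₁ k₂ k₃ m₀ β v i) (sysMap σ k₁ k₂ k₃ m₀ β v' i) := by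
  have hC : ∀ e a, Cong e (C a : PS) (C a) := fun e a => Cong.refl _ _
  have hal : Cong (d + 1) (sysMap σ k₁ k₂ k₃ m₀ β v 0) (sysMap σ k₁ k₂ k₃ m₀ β v' 0) :=
    ((Cong.X_mul 0 (((((h 3).sub (h 4)).X_mul 0).of_le (by omega)).C_mul _ |>.sub
      (((h 1).sub (h 5)).C_mul _))).add (((h 6).X_mul 1).C_mul _)).eulerInv
  have hal0 : (sysMap σ k₁ k₂ k₃ m₀ β v 0).coeff 0 = 0 :=
    coeff_eulerInv_zero_eq_zero _ _ (by simp)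
  have hpi : Cong (d + 1) (sysMap σ k₁ k₂ k₃ m₀ β v 1) (sysMap σ k₁ k₂ k₃ m₀ β v' 1) :=
    ((Cong.X_mul 0 ((((h 1).sub (h 5)).C_mul _).sub ((((hC _ _).add (h 0)).sub (h 2)).C_mul _))).sub
      (((h 6).X_mul 1).C_mul _)).eulerInv
  have hm : Cong (d + 1) (sysMap σ k₁ k₂ k₃ m₀ β v 2) (sysMap σ k₁ k₂ k₃ m₀ β v' 2) :=
    (hC _ _).add ((Cong.X_mul 0 (((h 1).mul (h 4)).sub ((h 3).mul (h 5)))).sub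
      (Cong.X_mul 1 ((h 3).mul (h 6)))).eulerInv
  have hq : Cong (d + 1) (sysMap σ k₁ k₂ k₃ m₀ β v 3) (sysMap σ k₁ k₂ k₃ m₀ β v' 3) :=
    (((((hC _ _).add hal).sub hm).C_mul _).sub ((((h 3).sub (h 4)).X_mul 0).C_mul _)).eulerInv
  exact forall_fin_seven (P := fun i => Cong (d + 1) (sysMap σ k₁ k₂ k₃ m₀ β v i)
    (sysMap σ k₁ k₂ k₃ m₀ β v' i)) hal hpi hm hq
    (((hq.mul hm).sub (hal.mul_succ hal0 (h 4))).C_mul _).eulerInv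
    (((hal.mul_succ hal0 (h 5)).sub (hpi.mul hm)).C_mul _).eulerInv
    ((hC _ _).add (((hal.mul_succ hal0 (h 6)).C_mul _).eulerInv)) i

variable {σ k₁ k₂ k₃ m₀ β} in
theorem sysMap_rat {K : Subfield ℂ} (hσ : σ ∈ K) (h1 : k₁ ∈ K) (h2 : k₂ ∈ K) (h3 : k₃ ∈ K)
    (hm₀ : m₀ ∈ K) (hβ : β ∈ K) {v : Fin 7 → PS} (h : ∀ i, Rat K (v i)) (i : Fin 7) :
    Rat K (sysMap σ k₁ k₂ k₃ m₀ β v i) := by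
  have two : (2 : ℂ) ∈ K := ofNat_mem K 2
  have hτ : 1 + σ ∈ K := K.add_mem K.one_mem hσ
  have hσ2 : Rat K (C (σ / 2)) := Rat.C (K.div_mem hσ two)
  have h1' : Rat K (C (2 * k₁)) := Rat.C (K.mul_mem two h1)
  have h2' : Rat K (C (2 * k₂)) := Rat.C (K.mul_mem two h2)
  have h3' : Rat K (C (2 * k₃)) := Rat.C (K.mul_mem two h3)
  have hX := fun i => Rat.X (K := K) i
  have hal : Rat K (sysMap σ k₁ k₂ k₃ m₀ β v 0) :=
    (((hX 0).mul (((Rat.C h2).mul ((hX 0).mul ((h 3).sub (h 4)))).sub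
      ((Rat.C h3).mul ((h 1).sub (h 5))))).add
      ((Rat.C h3).mul ((hX 1).mul (h 6)))).eulerInv hτ K.zero_mem
  have hpi : Rat K (sysMap σ k₁ k₂ k₃ m₀ β v 1) :=
    (((hX 0).mul ((h1'.mul ((h 1).sub (h 5))).sub (h2'.mul ((hσ2.add (h 0)).sub (h 2))))).sub
      (h1'.mul ((hX 1).mul (h 6)))).eulerInv hτ K.zero_mem
  have hm : Rat K (sysMap σ k₁ k₂ k₃ m₀ β v 2) :=
    (Rat.C hm₀).add ((((hX 0).mul (((h 1).mul (h 4)).sub ((h 3).mul (h 5)))).sub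
      ((hX 1).mul ((h 3).mul (h 6)))).eulerInv hτ K.zero_mem)
  have hq : Rat K (sysMap σ k₁ k₂ k₃ m₀ β v 3) :=
    ((h3'.mul ((hσ2.add hal).sub hm)).sub
      (h1'.mul ((hX 0).mul ((h 3).sub (h 4))))).eulerInv hτ (K.neg_mem K.one_mem)
  exact forall_fin_seven (P := fun i => Rat K (sysMap σ k₁ k₂ k₃ m₀ β v i)) hal hpi hm hq
    (((Rat.C two).mul ((hq.mul hm).sub (hal.mul (h 4)))).eulerInv hτ (K.neg_mem hτ))
    (((Rat.C two).mul ((hal.mul (h 5)).sub (hpi.mul hm))).eulerInv hτ hσ)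
    ((Rat.C hβ).add (((Rat.C two).mul (hal.mul (h 6))).eulerInv hτ K.zero_mem)) i

variable {σ k₁ k₂ k₃ m₀ β} in
theorem sysMap_bd {c x η r : ℝ≥0} (hc2 : 2 ≤ c) (hx : x = 11 * c ^ 6) (hη : η * (4 * x) = 1)
    (hr : r * (20 * c ^ 2 * x ^ 2) = η)
    (hσ2 : ‖σ / 2‖₊ ≤ c) (h2 : ‖k₂‖₊ ≤ c) (h3 : ‖k₃‖₊ ≤ c)
    (h1' : ‖2 * k₁‖₊ ≤ c) (h2' : ‖2 * k₂‖₊ ≤ c) (h3' : ‖2 * k₃‖₊ ≤ c)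
    (hm₀ : ‖m₀‖₊ ≤ c) (hβ : ‖β‖₊ ≤ c) (hl0 : ∀ n : Ix, ‖(lam (1 + σ) n - 0)⁻¹‖₊ ≤ c)
    (hl1 : ∀ n : Ix, ‖(lam (1 + σ) n - (-1))⁻¹‖₊ ≤ c)
    (hl2 : ∀ n : Ix, ‖(lam (1 + σ) n - (-(1 + σ)))⁻¹‖₊ ≤ c)
    (hl3 : ∀ n : Ix, ‖(lam (1 + σ) n - σ)⁻¹‖₊ ≤ c)
    {v : Fin 7 → PS} (h : ∀ i, Bd r (v i) (![η, η, x, x, x, x, x] i)) (i : Fin 7) :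
    Bd r (sysMap σ k₁ k₂ k₃ m₀ β v i) (![η, η, x, x, x, x, x] i) := by
  have g0 : Bd r (v 0) η := h 0
  have g1 : Bd r (v 1) η := h 1
  have g2 : Bd r (v 2) x := h 2
  have g3 : Bd r (v 3) x := h 3
  have g4 : Bd r (v 4) x := h 4
  have g5 : Bd r (v 5) x := h 5
  have g6 : Bd r (v 6) x := h 6
  have two : ‖(2 : ℂ)‖₊ ≤ c := by
    refine le_trans (le_of_eq ?_) hc2
    ext; simp
  obtain ⟨n1, n2, n3, n4, n5, n6, n7, n8, n9⟩ := sysMap_bd_aux (c := c) (x := x) (η := η) (r := r)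
    (by exact_mod_cast hc2) (by rw [hx]; push_cast; ring) η.2 r.2 (by exact_mod_cast hη)
    (by exact_mod_cast hr)
  have hal : Bd r (sysMap σ k₁ k₂ k₃ m₀ β v 0) η :=
    ((((Bd.X 0).mul (((Bd.C h2).mul ((Bd.X 0).mul (g3.sub g4))).sub
      ((Bd.C h3).mul (g1.sub g5)))).add
      ((Bd.C h3).mul ((Bd.X 1).mul g6))).eulerInv hl0).le (by exact_mod_cast n1)
  have hpi : Bd r (sysMap σ k₁ k₂ k₃ m₀ β v 1) η :=
    ((((Bd.X 0).mul (((Bd.C h1').mul (g1.sub g5)).sub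
      ((Bd.C h2').mul (((Bd.C hσ2).add g0).sub g2)))).sub
      ((Bd.C h1').mul ((Bd.X 1).mul g6))).eulerInv hl0).le (by exact_mod_cast n2)
  have hm : Bd r (sysMap σ k₁ k₂ k₃ m₀ β v 2) (2 * c) :=
    ((Bd.C hm₀).add ((((Bd.X 0).mul ((g1.mul g4).sub (g3.mul g5))).sub
      ((Bd.X 1).mul (g3.mul g6))).eulerInv hl0)).le (by exact_mod_cast n3)
  have hq : Bd r (sysMap σ k₁ k₂ k₃ m₀ β v 3) (5 * c ^ 3) :=
    ((((Bd.C h3').mul (((Bd.C hσ2).add hal).sub hm)).sub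
      ((Bd.C h1').mul ((Bd.X 0).mul (g3.sub g4)))).eulerInv hl1).le (by exact_mod_cast n4)
  have hcc : Bd r (sysMap σ k₁ k₂ k₃ m₀ β v 4) x :=
    (((Bd.C two).mul ((hq.mul hm).sub (hal.mul g4))).eulerInv hl2).le (by exact_mod_cast n5)
  have hb₁ : Bd r (sysMap σ k₁ k₂ k₃ m₀ β v 5) x :=
    (((Bd.C two).mul ((hal.mul g5).sub (hpi.mul hm))).eulerInv hl3).le (by exact_mod_cast n6)
  have hb₂ : Bd r (sysMap σ k₁ k₂ k₃ m₀ β v 6) x :=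
    ((Bd.C hβ).add (((Bd.C two).mul (hal.mul g6)).eulerInv hl0)).le (by exact_mod_cast n7)
  exact forall_fin_seven
    (P := fun i => Bd r (sysMap σ k₁ k₂ k₃ m₀ β v i) (![η, η, x, x, x, x, x] i)) hal hpi
    (hm.le (by exact_mod_cast n8)) (hq.le (by exact_mod_cast n9)) hcc hb₁ hb₂ i

end

section
variable {σ : ℂ}

theorem SigmaPlus.one_add (hσ : σ ∈ SigmaPlus) : ¬ ((1 + σ).im = 0 ∧ (1 + σ).re ≤ 0) := by
  rintro ⟨h1, h2⟩
  refine hσ.1 ⟨by simpa using h1, ?_⟩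
  simp at h2
  linarith

theorem SigmaPlus.ne_zero (hσ : σ ∈ SigmaPlus) : σ ≠ 0 := by
  have := hσ.2 0; simpa using this

/-- Adding `1` to the eigenvalue shifts the exponent by one in the first variable, so a resonance
would be a vanishing eigenvalue at a nonzero exponent. -/
theorem SigmaPlus.lam_ne_neg_one (hσ : σ ∈ SigmaPlus) (n : Ix) : lam (1 + σ) n ≠ -1 := by
  intro h
  have h1 := lam_ne_zero (SigmaPlus.one_add hσ) (n := n + Finsupp.single 0 1)
    (by intro h; simpa using DFunLike.congr_fun h 0)
  rw [lam_add, h] at h1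
  simp [lam] at h1

theorem SigmaPlus.lam_ne_neg (hσ : σ ∈ SigmaPlus) (n : Ix) : lam (1 + σ) n ≠ -(1 + σ) := by
  intro h
  have h1 := lam_ne_zero (SigmaPlus.one_add hσ) (n := n + Finsupp.single 1 1)
    (by intro h; simpa using DFunLike.congr_fun h 1)
  rw [lam_add, h] at h1
  simp [lam] at h1

/-- This is where `σ ∉ ℤ` is needed: it settles `n 1 = 0`. Otherwise one factor `W` is traded for a
factor `Z`, which changes the eigenvalue by `-σ` and would make it zero. -/
theorem SigmaPlus.lam_ne_self (hσ : σ ∈ SigmaPlus) (n : Ix) : lam (1 + σ) n ≠ σ := by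
  intro h
  rw [lam] at h
  rcases hn : n 1 with _ | j
  · rw [hn] at h
    exact hσ.2 (n 0) (by rw [← h]; push_cast; ring)
  · rw [hn] at h
    push_cast at h
    have h1 : lam (1 + σ) (Finsupp.single 0 (n 0 + 1) + Finsupp.single 1 j) = 0 := by
      simp [lam]
      linear_combination h
    refine lam_ne_zero (SigmaPlus.one_add hσ) ?_ h1
    intro h; simpa using DFunLike.congr_fun h 0

theorem SigmaPlus.lam_eq_zero (hσ : σ ∈ SigmaPlus) {n : Ix} (h : lam (1 + σ) n = 0) : n = 0 := by
  by_contra hn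
  exact lam_ne_zero (SigmaPlus.one_add hσ) hn h

/-- Existence of convergent solutions of the Schlesinger system. -/
theorem exists_isSeriesSol (hσ : σ ∈ SigmaPlus) {K : Subfield ℂ} {k₁ k₂ k₃ m₀ β : ℂ} (hσK : σ ∈ K)
    (h1 : k₁ ∈ K) (h2 : k₂ ∈ K) (h3 : k₃ ∈ K) (hm₀ : m₀ ∈ K) (hβ : β ∈ K) :
    ∃ (r : ℝ≥0) (v : Fin 7 → PS), 0 < r ∧ (∀ i, Conv r (v i)) ∧ (∀ i, Rat K (v i)) ∧
      IsSeriesSol σ k₁ k₂ k₃ m₀ β (v 0) (v 1) (v 2) (v 3) (v 4) (v 5) (v 6) := by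
  have hτ := SigmaPlus.one_add hσ
  obtain ⟨l0, hl0⟩ := exists_norm_inv_le hτ 0
  obtain ⟨l1, hl1⟩ := exists_norm_inv_le hτ (-1)
  obtain ⟨l2, hl2⟩ := exists_norm_inv_le hτ (-(1 + σ))
  obtain ⟨l3, hl3⟩ := exists_norm_inv_le hτ σ
  obtain ⟨c, hc⟩ := Finset.exists_le (α := ℝ≥0) {2, ‖σ / 2‖₊, ‖k₂‖₊, ‖k₃‖₊, ‖2 * k₁‖₊, ‖2 * k₂‖₊,
    ‖2 * k₃‖₊, ‖m₀‖₊, ‖β‖₊, l0, l1, l2, l3}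
  have hc2 : 2 ≤ c := hc _ (by simp)
  have hc0 : 0 < c := lt_of_lt_of_le (by norm_num) hc2
  set x : ℝ≥0 := 11 * c ^ 6 with hx
  have hx0 : 0 < x := by positivity
  set η : ℝ≥0 := (4 * x)⁻¹ with hη
  set r : ℝ≥0 := η / (20 * c ^ 2 * x ^ 2) with hr
  have hr0 : 0 < r := by positivity
  obtain ⟨v, hv, hvK, hvR⟩ := exists_fixed_series (r := r) K
    (fun i => ((![η, η, x, x, x, x, x] i : ℝ≥0) : ℝ≥0∞)) (sysMap σ k₁ k₂ k₃ m₀ β)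
    (fun v hv1 hv2 => ⟨sysMap_rat hσK h1 h2 h3 hm₀ hβ hv1,
      sysMap_bd hc2 hx (inv_mul_cancel₀ (by positivity)) (div_mul_cancel₀ _ (by positivity))
        (hc _ (by simp)) (hc _ (by simp)) (hc _ (by simp)) (hc _ (by simp)) (hc _ (by simp))
        (hc _ (by simp)) (hc _ (by simp)) (hc _ (by simp))
        (fun n => (hl0 n).trans (hc _ (by simp))) (fun n => (hl1 n).trans (hc _ (by simp)))
        (fun n => (hl2 n).trans (hc _ (by simp))) (fun n => (hl3 n).trans (hc _ (by simp)))
        hv2⟩)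
    (fun d v v' h => sysMap_cong σ k₁ k₂ k₃ m₀ β h)
  refine ⟨r, v, hr0, fun i => (hvR i).trans_lt ENNReal.coe_lt_top, hvK, ?_⟩
  have e0 : eulerInv (1 + σ) 0
    (X 0 * (C k₂ * (X 0 * (v 3 - v 4)) - C k₃ * (v 1 - v 5)) + C k₃ * (X 1 * v 6)) = v 0 :=
    congrFun hv 0
  have e1 : eulerInv (1 + σ) 0
    (X 0 * (C (2 * k₁) * (v 1 - v 5) - C (2 * k₂) * (C (σ / 2) + v 0 - v 2))
      - C (2 * k₁) * (X 1 * v 6)) = v 1 := congrFun hv 1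
  have e2 : C m₀ + eulerInv (1 + σ) 0
    (X 0 * (v 1 * v 4 - v 3 * v 5) - X 1 * (v 3 * v 6)) = v 2 := congrFun hv 2
  have s0 : sysMap σ k₁ k₂ k₃ m₀ β v 0 = v 0 := congrFun hv 0
  have s1 : sysMap σ k₁ k₂ k₃ m₀ β v 1 = v 1 := congrFun hv 1
  have s2 : sysMap σ k₁ k₂ k₃ m₀ β v 2 = v 2 := congrFun hv 2
  have s3 : sysMap σ k₁ k₂ k₃ m₀ β v 3 = v 3 := congrFun hv 3
  have e3 : eulerInv (1 + σ) (-1) (C (2 * k₃) * (C (σ / 2) + sysMap σ k₁ k₂ k₃ m₀ β v 0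
      - sysMap σ k₁ k₂ k₃ m₀ β v 2) - C (2 * k₁) * (X 0 * (v 3 - v 4))) = v 3 := congrFun hv 3
  have e4 : eulerInv (1 + σ) (-(1 + σ)) (C 2 * (sysMap σ k₁ k₂ k₃ m₀ β v 3
      * sysMap σ k₁ k₂ k₃ m₀ β v 2 - sysMap σ k₁ k₂ k₃ m₀ β v 0 * v 4)) = v 4 := congrFun hv 4
  have e5 : eulerInv (1 + σ) σ (C 2 * (sysMap σ k₁ k₂ k₃ m₀ β v 0 * v 5
      - sysMap σ k₁ k₂ k₃ m₀ β v 1 * sysMap σ k₁ k₂ k₃ m₀ β v 2)) = v 5 := congrFun hv 5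
  have e6 : C β + eulerInv (1 + σ) 0 (C 2 * (sysMap σ k₁ k₂ k₃ m₀ β v 0 * v 6)) = v 6 :=
    congrFun hv 6
  rw [s0, s2] at e3
  rw [s0, s2, s3] at e4
  rw [s0, s1, s2] at e5
  rw [s0] at e6
  have z0 : (v 0).coeff 0 = 0 := by
    rw [← e0]
    exact coeff_eulerInv_zero_eq_zero _ _ (by simp)
  have z1 : (v 1).coeff 0 = 0 := by
    rw [← e1]
    exact coeff_eulerInv_zero_eq_zero _ _ (by simp)
  have zc0 : MvPowerSeries.constantCoeff (v 0) = 0 := z0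
  have zc1 : MvPowerSeries.constantCoeff (v 1) = 0 := z1
  have key : ∀ F : PS, F.coeff 0 = 0 → euler (1 + σ) (eulerInv (1 + σ) 0 F) = F := by
    intro F hF
    rw [euler_eulerInv fun n hn => by rw [SigmaPlus.lam_eq_zero hσ hn, hF], map_zero, zero_mul,
      add_zero]
  constructor
  · nth_rw 1 [← e0]
    exact key _ (by simp)
  · nth_rw 1 [← e1]
    exact key _ (by simp)
  · nth_rw 1 [← e2]
    rw [euler_add, euler_C, zero_add]
    exact key _ (by simp)
  · nth_rw 1 [← e3]
    rw [euler_eulerInv fun n hn => absurd hn (SigmaPlus.lam_ne_neg_one hσ n), e3]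
  · nth_rw 1 [← e4]
    rw [euler_eulerInv fun n hn => absurd hn (SigmaPlus.lam_ne_neg hσ n), e4]
  · nth_rw 1 [← e5]
    rw [euler_eulerInv fun n hn => absurd hn (SigmaPlus.lam_ne_self hσ n), e5]
  · nth_rw 1 [← e6]
    rw [euler_add, euler_C, zero_add]
    exact key _ (by simp [zc0])
  · exact z0
  · exact z1
  · rw [← e2, map_add, MvPowerSeries.coeff_zero_C, coeff_eulerInv_zero_eq_zero, add_zero]
    simp
  · rw [← e5]
    exact coeff_eulerInv_zero_eq_zero _ _ (by simp [zc0, zc1])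
  · rw [← e6, map_add, MvPowerSeries.coeff_zero_C, coeff_eulerInv_zero_eq_zero, add_zero]
    simp [zc0]

end

end

/-! ### From the Schlesinger system to the fifth Painlevé equation. -/

section

section
variable (θ₀ θₓ θinf : ℂ)

/-- The vector field `x y'` of the Hamiltonian form of the fifth Painlevé equation. -/
noncomputable def fieldY (x y a : ℂ) : ℂ :=
  y * (x + 4 * a + θinf) + y ^ 2 * ((θ₀ + θₓ - θinf) / 2 - 2 * a)
    - (2 * a + (θ₀ - θₓ + θinf) / 2 + θₓ)

/-- The vector field `x a'` of the Hamiltonian form of the fifth Painlevé equation. -/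
noncomputable def fieldA (y a : ℂ) : ℂ :=
  y * ((θₓ - θinf) / 2 - a) * (θ₀ / 2 - a) - (a + θ₀ / 2) * ((θₓ + θinf) / 2 + a) / y

/-- Differentiating the equation for `y` and inserting `a'` turns (V) into a rational identity in
`x, y, a`. The equation for `y` is needed near `t` because it is differentiated once more. -/
theorem eqV_of_system {y a : ℂ → ℂ} {t : ℂ}
    (hy : ∀ᶠ s in 𝓝 t, HasDerivAt y (fieldY θ₀ θₓ θinf (Complex.exp s) (y s) (a s)) s)
    (ha : HasDerivAt a (fieldA θ₀ θₓ θinf (y t) (a t)) t) (h0 : y t ≠ 0) (h1 : y t ≠ 1) :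
    EqV θ₀ θₓ θinf y t := by
  have hx := Complex.exp_ne_zero t
  have e1 : ddx y =ᶠ[𝓝 t]
      fun s => fieldY θ₀ θₓ θinf (Complex.exp s) (y s) (a s) / Complex.exp s := by
    filter_upwards [hy] with s hs
    rw [ddx, hs.deriv]
  have hy' := hy.self_of_nhds
  have hE := Complex.hasDerivAt_exp t
  have h2 : y t - 1 ≠ 0 := sub_ne_zero.2 h1
  set x := Complex.exp t with hxdef
  set Y' := fieldY θ₀ θₓ θinf x (y t) (a t) with hY'
  set A' := fieldA θ₀ θₓ θinf (y t) (a t) with hA'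
  have hF : HasDerivAt (fun s => fieldY θ₀ θₓ θinf (Complex.exp s) (y s) (a s))
      (Y' * (x + 4 * a t + θinf) + y t * (x + 4 * A') +
        2 * y t * Y' * ((θ₀ + θₓ - θinf) / 2 - 2 * a t) - 2 * y t ^ 2 * A' - 2 * A') t := by
    have h3 := ((hy'.mul ((hE.add (ha.const_mul 4)).add_const θinf)).add
      ((hy'.pow 2).mul ((ha.const_mul 2).const_sub ((θ₀ + θₓ - θinf) / 2)))).sub
      (((ha.const_mul 2).add_const ((θ₀ - θₓ + θinf) / 2)).add_const θₓ)
    refine h3.congr_deriv ?_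
    simp only [Pi.add_apply, Pi.pow_apply, ← hxdef]
    ring
  have e2 := (hF.div hE hx).deriv
  have e3 : ddx (ddx y) t
      = deriv ((fun s => fieldY θ₀ θₓ θinf (Complex.exp s) (y s) (a s)) / Complex.exp) t / x := by
    rw [ddx, e1.deriv_eq]; rfl
  unfold EqV
  rw [e3, e2, e1.self_of_nhds, hY', hA']
  simp only [← hxdef]
  clear_value x
  clear e1 e2 e3 hF hE hy hy' ha
  clear hY' hA' Y' A'
  generalize y t = Y at *
  generalize a t = A at *
  simp only [fieldY, fieldA]
  field_simp
  ring

/-- A solution of the Schlesinger system of the fifth Painlevé equation at the point `t`, with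
`A₀ = (a, b; c, -a)` and `Aₓ = (d, e; f, -d)`. -/
structure SchlesingerAt (a b c d e f : ℂ → ℂ) (t : ℂ) : Prop where
  ha : HasDerivAt a (e t * c t - b t * f t) t
  hb : HasDerivAt b (2 * (d t * b t - a t * e t)) t
  hc : HasDerivAt c (2 * (f t * a t - d t * c t)) t
  hd : HasDerivAt d (b t * f t - e t * c t) t
  he : HasDerivAt e (2 * (a t * e t - d t * b t) + Complex.exp t * e t) t
  hf : HasDerivAt f (2 * (d t * c t - f t * a t) - Complex.exp t * f t) t
  trace : a t + d t = -θinf / 2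

/-- `(r₁, r₂)` is a left eigenvector of `(a, b; c, -a)` for the eigenvalue `θ / 2`. -/
def IsLeftEigen (θ a b c r₁ r₂ : ℂ) : Prop :=
  r₁ * b = r₂ * (a + θ / 2) ∧ r₂ * c = r₁ * (θ / 2 - a)

/-- Riccati equation for the slope of a left eigenvector of a matrix function `A` with
`A' = [B, A]`. -/
theorem hasDerivAt_slope {θ : ℂ} (hθ : θ ≠ 0) {a b c k : ℂ → ℂ} {d e f t : ℂ}
    (ha : HasDerivAt a (e * c t - b t * f) t)
    (hb : HasDerivAt b (2 * (d * b t - a t * e)) t)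
    (hc : HasDerivAt c (2 * (f * a t - d * c t)) t)
    (hk : DifferentiableAt ℂ k t)
    (h : ∀ᶠ s in 𝓝 t, b s = k s * (a s + θ / 2) ∧ k s * c s = θ / 2 - a s) :
    HasDerivAt k (-e + 2 * k t * d + k t ^ 2 * f) t := by
  have hk' := hk.hasDerivAt
  have h1 : b =ᶠ[𝓝 t] fun s => k s * (a s + θ / 2) := h.mono fun s hs => hs.1
  have h2 : (fun s => k s * c s) =ᶠ[𝓝 t] fun s => θ / 2 - a s := h.mono fun s hs => hs.2
  have d1 := (hb.congr_of_eventuallyEq h1.symm).unique (hk'.mul (ha.add_const (θ / 2)))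
  have d2 := ((hk'.mul hc).congr_of_eventuallyEq h2.symm).unique (ha.const_sub (θ / 2))
  obtain ⟨q1, q2⟩ := h.self_of_nhds
  have key : deriv k t = -e + 2 * k t * d + k t ^ 2 * f := by
    -- Adding the derivatives of the two eigenvector relations, the second weighted by `k`, gives
    -- `k'` the coefficient `(a + θ/2) + k c = θ`; this is why `θ ≠ 0` is required.
    apply mul_left_cancel₀ hθ
    generalize deriv k t = k' at *
    generalize k t = K at *
    generalize a t = A at *
    generalize b t = B at *
    generalize c t = C at *
    subst q1
    linear_combination (-1 : ℂ) * d1 + K * d2 + (-k' + 2 * d * K - 2 * e) * q2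
  rwa [key] at hk'

variable {θ₀ θₓ θinf}

/-- The quotient of the slopes of left eigenvectors satisfies the Hamiltonian system. -/
theorem SchlesingerAt.hasDerivAt_quotient (h₀ : θ₀ ≠ 0) (hₓ : θₓ ≠ 0)
    {a b c d e f r₁ r₂ s₁ s₂ : ℂ → ℂ} {t : ℂ} (H : SchlesingerAt θinf a b c d e f t)
    (hr : ∀ᶠ s in 𝓝 t, IsLeftEigen θ₀ (a s) (b s) (c s) (r₁ s) (r₂ s))
    (hs : ∀ᶠ s in 𝓝 t, IsLeftEigen θₓ (d s) (e s) (f s) (s₁ s) (s₂ s))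
    (hr₁ : DifferentiableAt ℂ r₁ t) (hr₂ : DifferentiableAt ℂ r₂ t)
    (hs₁ : DifferentiableAt ℂ s₁ t) (hs₂ : DifferentiableAt ℂ s₂ t)
    (nr₁ : r₁ t ≠ 0) (nr₂ : r₂ t ≠ 0) (ns₁ : s₁ t ≠ 0) (ns₂ : s₂ t ≠ 0) :
    HasDerivAt (fun t => s₂ t * r₁ t / (s₁ t * r₂ t))
      (fieldY θ₀ θₓ θinf (Complex.exp t) (s₂ t * r₁ t / (s₁ t * r₂ t)) (a t)) t ∧
    HasDerivAt a (fieldA θ₀ θₓ θinf (s₂ t * r₁ t / (s₁ t * r₂ t)) (a t)) t := by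
  have aux : ∀ {θ : ℂ} {u v w p q : ℂ → ℂ}, DifferentiableAt ℂ p t → p t ≠ 0 →
      (∀ᶠ s in 𝓝 t, IsLeftEigen θ (u s) (v s) (w s) (p s) (q s)) →
      ∀ᶠ s in 𝓝 t, v s = q s / p s * (u s + θ / 2) ∧ q s / p s * w s = θ / 2 - u s := by
    intro θ u v w p q hp np h
    filter_upwards [h, hp.continuousAt.eventually_ne np] with s ⟨h1, h2⟩ h3
    refine ⟨?_, ?_⟩
    · field_simp
      linear_combination 2 * h1
    · field_simp
      linear_combination 2 * h2
  have kr := aux hr₁ nr₁ hr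
  have ks := aux hs₁ ns₁ hs
  have dk := hasDerivAt_slope h₀ (d := d t) (e := e t) (f := f t) H.ha H.hb H.hc
    (hr₂.div hr₁ nr₁) kr
  have ha' : HasDerivAt d (b t * f t - e t * c t) t := H.hd
  -- For `Aₓ` the commutator is with `A₀ + x J/2`, whose (1,1) entry is `a + x/2`.
  have dl := hasDerivAt_slope hₓ (a := d) (b := e) (c := f)
    (d := a t + Complex.exp t / 2) (e := b t) (f := c t) H.hd
    (H.he.congr_deriv (by ring)) (H.hf.congr_deriv (by ring)) (hs₂.div hs₁ ns₁) ks
  obtain ⟨q1, q2⟩ := kr.self_of_nhds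
  obtain ⟨q3, q4⟩ := ks.self_of_nhds
  have q5 := H.trace
  have ha := H.ha
  have nk : r₂ t / r₁ t ≠ 0 := div_ne_zero nr₂ nr₁
  have nl : s₂ t / s₁ t ≠ 0 := div_ne_zero ns₂ ns₁
  have ey : ∀ s, s₂ s * r₁ s / (s₁ s * r₂ s) = (s₂ s / s₁ s) / (r₂ s / r₁ s) := fun s => by
    rw [div_div_div_eq]
  have dy := dl.div dk nk
  have ed : d t = -θinf / 2 - a t := by linear_combination q5
  simp only [ey]
  have hk : (r₂ / r₁) t = r₂ t / r₁ t := rfl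
  have hl : (s₂ / s₁) t = s₂ t / s₁ t := rfl
  rw [hk, hl] at dy
  generalize r₂ t / r₁ t = k at *
  generalize s₂ t / s₁ t = l at *
  have ec : c t = (θ₀ / 2 - a t) / k := by rw [eq_div_iff nk, ← q2]; ring
  have ef : f t = (θₓ / 2 - d t) / l := by rw [eq_div_iff nl, ← q4]; ring
  constructor
  · refine HasDerivAt.congr_deriv (f' := _) dy ?_
    rw [ec, ef, q1, q3, ed, fieldY]
    field_simp
    ring
  · refine ha.congr_deriv ?_
    rw [ec, ef, q1, q3, ed, fieldA]
    field_simp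
    ring

theorem SchlesingerAt.eqV (h₀ : θ₀ ≠ 0) (hₓ : θₓ ≠ 0)
    {a b c d e f r₁ r₂ s₁ s₂ : ℂ → ℂ} {U : Set ℂ} (hU : IsOpen U)
    (H : ∀ t ∈ U, SchlesingerAt θinf a b c d e f t)
    (hr : ∀ t ∈ U, IsLeftEigen θ₀ (a t) (b t) (c t) (r₁ t) (r₂ t))
    (hs : ∀ t ∈ U, IsLeftEigen θₓ (d t) (e t) (f t) (s₁ t) (s₂ t))
    (hr₁ : DifferentiableOn ℂ r₁ U) (hr₂ : DifferentiableOn ℂ r₂ U)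
    (hs₁ : DifferentiableOn ℂ s₁ U) (hs₂ : DifferentiableOn ℂ s₂ U) {t : ℂ} (ht : t ∈ U)
    (h0 : s₂ t * r₁ t / (s₁ t * r₂ t) ≠ 0) (h1 : s₂ t * r₁ t / (s₁ t * r₂ t) ≠ 1) :
    EqV θ₀ θₓ θinf (fun t => s₂ t * r₁ t / (s₁ t * r₂ t)) t := by
  have key : ∀ s ∈ U, s₂ s * r₁ s / (s₁ s * r₂ s) ≠ 0 →
      HasDerivAt (fun t => s₂ t * r₁ t / (s₁ t * r₂ t))
        (fieldY θ₀ θₓ θinf (Complex.exp s) (s₂ s * r₁ s / (s₁ s * r₂ s)) (a s)) s ∧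
      HasDerivAt a (fieldA θ₀ θₓ θinf (s₂ s * r₁ s / (s₁ s * r₂ s)) (a s)) s := by
    intro s hsU hne
    have hUs := hU.mem_nhds hsU
    -- Division by zero has value `0`, so a nonzero quotient rules out zeros of the denominators
    -- along with those of the numerators.
    simp only [ne_eq, div_eq_zero_iff, mul_eq_zero, not_or] at hne
    exact (H s hsU).hasDerivAt_quotient h₀ hₓ (Filter.mem_of_superset hUs hr)
      (Filter.mem_of_superset hUs hs) (hr₁.differentiableAt hUs) (hr₂.differentiableAt hUs)
      (hs₁.differentiableAt hUs) (hs₂.differentiableAt hUs) hne.1.2 hne.2.2 hne.2.1 hne.1.1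
  have hy := key t ht h0
  refine eqV_of_system θ₀ θₓ θinf ?_ hy.2 h0 h1
  filter_upwards [hU.mem_nhds ht, hy.1.continuousAt.eventually_ne h0] with s h2 h3
  exact (key s h2 h3).1

end

end

/-! ### First integrals of the series system. -/

section

open MvPowerSeries (C X)

section
variable {σ k₁ k₂ k₃ m₀ β : ℂ} {al pi m q c b₁ b₂ : PS}

/-- The kernel of the Euler operator consists of constants, so a first integral is determined by its
constant term. -/
theorem eq_C_of_euler_eq_zero (hσ : σ ∈ SigmaPlus) {f : PS} (h : euler (1 + σ) f = 0) :
    f = C (f.coeff 0) := by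
  classical
  ext n
  rw [MvPowerSeries.coeff_C]
  split_ifs with hn
  · rw [hn]
  · have h1 : (euler (1 + σ) f).coeff n = 0 := by rw [h, map_zero]
    rw [coeff_euler] at h1
    exact (mul_eq_zero.1 h1).resolve_left (lam_ne_zero (SigmaPlus.one_add hσ) hn)

/-- This is `-det A₀`, conserved because `A₀` evolves by a commutator: with `u Z = W`, the upper
right entry `b₁ + u b₂` times the lower left entry `Z c` is `(Z b₁ + W b₂) c`. It keeps the
eigenvalues at `±m₀`. -/
theorem IsSeriesSol.det_zero (hσ : σ ∈ SigmaPlus)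
    (h : IsSeriesSol σ k₁ k₂ k₃ m₀ β al pi m q c b₁ b₂) :
    m * m + (X 0 * b₁ + X 1 * b₂) * c = C (m₀ ^ 2) := by
  have h1 : euler (1 + σ) (m * m + (X 0 * b₁ + X 1 * b₂) * c) = 0 := by
    simp only [euler_add, euler_mul, euler_X_zero, euler_X_one, h.m_eq, h.c_eq, h.b₁_eq, h.b₂_eq]
    simp only [map_add, map_neg, map_one, map_ofNat]
    ring
  rw [eq_C_of_euler_eq_zero hσ h1]
  have h2 : MvPowerSeries.constantCoeff m = m₀ := h.m_zero
  congr 1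
  simp [h2]
  ring

theorem IsSeriesSol.det_x (hσ : σ ∈ SigmaPlus)
    (h : IsSeriesSol σ k₁ k₂ k₃ m₀ β al pi m q c b₁ b₂) :
    (C (σ / 2) + al - m) * (C (σ / 2) + al - m)
      + (X 0 * pi - (X 0 * b₁ + X 1 * b₂)) * (q - c) = C ((σ / 2 - m₀) ^ 2) := by
  have h1 : euler (1 + σ) ((C (σ / 2) + al - m) * (C (σ / 2) + al - m)
      + (X 0 * pi - (X 0 * b₁ + X 1 * b₂)) * (q - c)) = 0 := by
    have e : (C σ : PS) = 2 * C (σ / 2) := by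
      rw [← map_ofNat (C (σ := Fin 2) (R := ℂ)) 2, ← map_mul]; congr 1; ring
    simp only [euler_add, euler_sub, euler_mul, euler_X_zero, euler_X_one, euler_C, h.m_eq, h.c_eq,
      h.b₁_eq, h.b₂_eq, h.al_eq, h.pi_eq, h.q_eq]
    simp only [map_add, map_neg, map_one, map_ofNat, map_mul, e]
    ring
  rw [eq_C_of_euler_eq_zero hσ h1]
  have h2 : MvPowerSeries.constantCoeff m = m₀ := h.m_zero
  have h3 : MvPowerSeries.constantCoeff al = 0 := h.al_zero
  congr 1
  simp [h2, h3]
  ring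

/-- With `M = (k₁, k₂; k₃, -k₁)` and `S = A₀ + Aₓ` this is `tr (M (S - diag(σ/2, -σ/2)))`. It is
conserved because `x S' = x [M, Aₓ]` and `tr (M [M, Aₓ]) = 0`. In the original frame it fixes the
diagonal of `A₀ + Aₓ`. -/
theorem IsSeriesSol.trace (hσ : σ ∈ SigmaPlus)
    (h : IsSeriesSol σ k₁ k₂ k₃ m₀ β al pi m q c b₁ b₂) :
    C (2 * k₁) * al + C k₂ * (X 0 * q) + C k₃ * pi = 0 := by
  have h1 : euler (1 + σ) (C (2 * k₁) * al + C k₂ * (X 0 * q) + C k₃ * pi) = 0 := by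
    simp only [euler_add, euler_mul, euler_X_zero, euler_C, h.al_eq, h.pi_eq, h.q_eq]
    simp only [map_neg, map_one, map_ofNat, map_mul]
    ring
  rw [eq_C_of_euler_eq_zero hσ h1]
  have h2 : MvPowerSeries.constantCoeff pi = 0 := h.pi_zero
  have h3 : MvPowerSeries.constantCoeff al = 0 := h.al_zero
  simp [h2, h3]

end

/-! ### Series evaluated along the covering. -/

section
variable {σ ρ : ℂ} {ε : ℝ}

theorem hasDerivAt_cpowCov (σ t : ℂ) : HasDerivAt (cpowCov σ) (σ * cpowCov σ t) t := by
  have := ((hasDerivAt_id t).const_mul σ).cexp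
  unfold cpowCov
  simpa [mul_comm] using this

theorem continuous_cpowCov (σ : ℂ) : Continuous (cpowCov σ) := by
  unfold cpowCov; fun_prop

theorem isOpen_omegaFull : IsOpen (OmegaFull σ ε ρ) := by
  have h := continuous_cpowCov σ
  have h1 : Continuous fun t => ‖Complex.exp t‖ := by fun_prop
  have h2 : Continuous fun t => ‖Complex.exp t * (ρ * cpowCov σ t)‖ := by fun_prop
  exact (isOpen_lt h1 continuous_const).inter (isOpen_lt h2 continuous_const)

/-- The value of a power series in `Z` and `W` at `Z = x` and `W = x · ρ x^σ`. -/
noncomputable def evC (σ ρ : ℂ) (f : PS) (t : ℂ) : ℂ :=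
  ev f (Complex.exp t) (Complex.exp t * (ρ * cpowCov σ t))

theorem hasDerivAt_monom_cov (σ ρ t : ℂ) (n : Ix) :
    HasDerivAt (fun t => monom (Complex.exp t) (Complex.exp t * (ρ * cpowCov σ t)) n)
      (lam (1 + σ) n * monom (Complex.exp t) (Complex.exp t * (ρ * cpowCov σ t)) n) t := by
  have hE := Complex.hasDerivAt_exp t
  have hW := hE.mul ((hasDerivAt_cpowCov σ t).const_mul ρ)
  refine ((hE.fun_pow (n 0)).mul (hW.fun_pow (n 1))).congr_deriv ?_
  have aux : ∀ (k : ℕ) (w v : ℂ), k * w ^ (k - 1) * (v * w) = k * v * w ^ k := by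
    intro k w v
    rcases k with _ | k
    · simp
    · rw [Nat.add_sub_cancel, pow_succ]; ring
  have a1 := aux (n 0) (Complex.exp t) 1
  have a2 := aux (n 1) (Complex.exp t * (ρ * cpowCov σ t)) (1 + σ)
  simp only [monom, lam, Pi.mul_apply]
  rw [one_mul] at a1
  rw [a1]
  have a3 : Complex.exp t * (ρ * cpowCov σ t) + Complex.exp t * (ρ * (σ * cpowCov σ t))
    = (1 + σ) * (Complex.exp t * (ρ * cpowCov σ t)) := by ring
  rw [a3, a2]
  ring

/-- Each monomial is an eigenfunction of `d/dt = x d/dx`. Convergence of the differentiated series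
comes from Weierstrass' theorem, so no norm bound on `euler (1 + σ) f` is required. -/
theorem Conv.hasDerivAt_evC {r : ℝ≥0} {f : PS} (hf : Conv r f) {t : ℂ}
    (ht : t ∈ OmegaFull σ r ρ) : HasDerivAt (evC σ ρ f) (evC σ ρ (euler (1 + σ) f) t) t := by
  let F : Ix → ℂ → ℂ := fun n t =>
    f.coeff n * monom (Complex.exp t) (Complex.exp t * (ρ * cpowCov σ t)) n
  have hF : ∀ n t, HasDerivAt (F n) (f.coeff n * (lam (1 + σ) n *
      monom (Complex.exp t) (Complex.exp t * (ρ * cpowCov σ t)) n)) t :=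
    fun n t => (hasDerivAt_monom_cov σ ρ t n).const_mul _
  have hb : ∀ n, ∀ w ∈ OmegaFull σ r ρ, ‖F n w‖ ≤ ‖f.coeff n‖ * (r : ℝ) ^ deg n :=
    fun n w hw => norm_term_le hw.1.le hw.2.le n
  have hd : ∀ n, DifferentiableOn ℂ (F n) (OmegaFull σ r ρ) :=
    fun n t _ => (hF n t).differentiableAt.differentiableWithinAt
  have h1 := Complex.differentiableOn_tsum_of_summable_norm hf.summable hd isOpen_omegaFull hb
  have h2 := Complex.hasSum_deriv_of_summable_norm hf.summable hd isOpen_omegaFull hb ht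
  have h3 := (h1.differentiableAt (isOpen_omegaFull.mem_nhds ht)).hasDerivAt
  have h4 : deriv (fun w => ∑' n, F n w) t = evC σ ρ (euler (1 + σ) f) t := by
    rw [← h2.tsum_eq]
    refine tsum_congr fun n => ?_
    rw [(hF n t).deriv, coeff_euler]
    ring
  rw [h4] at h3
  exact h3

theorem Conv.differentiableOn_evC {r : ℝ≥0} {f : PS} (hf : Conv r f) :
    DifferentiableOn ℂ (evC σ ρ f) (OmegaFull σ r ρ) :=
  fun _ ht => (hf.hasDerivAt_evC ht).differentiableAt.differentiableWithinAt

end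

/-! ### Change of frame. -/

section
variable (σ h : ℂ)

/-- Upper left entry of the matrix `(m, b; c, -m)` after the change of frame. -/
noncomputable def frameA (m b c : ℂ) : ℂ :=
  (-2 * h * m - (σ + h) * b - (σ - h) * c) / (2 * σ)

/-- Upper right entry of the matrix `(m, b; c, -m)` after the change of frame. -/
noncomputable def frameB (m b c : ℂ) : ℂ := (2 * m + b - c) / σ

/-- Lower left entry of the matrix `(m, b; c, -m)` after the change of frame. -/
noncomputable def frameC (m b c : ℂ) : ℂ :=
  (2 * (σ - h) * (σ + h) * m - (σ + h) ^ 2 * b + (σ - h) ^ 2 * c) / (4 * σ)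

variable {σ h}

/-- With `P = (σ - h, 2; -(σ + h), 2)`, of determinant `4 σ`, the frame entries are those of `P⁻¹ A
P`, and a row eigenvector `r` becomes `r P`. -/
theorem IsLeftEigen.frame (hσ : σ ≠ 0) {θ m b c r₁ r₂ : ℂ} (H : IsLeftEigen θ m b c r₁ r₂) :
    IsLeftEigen θ (frameA σ h m b c) (frameB σ m b c) (frameC σ h m b c)
      ((σ - h) * r₁ - (σ + h) * r₂) (2 * (r₁ + r₂)) := by
  obtain ⟨h1, h2⟩ := H
  unfold frameA frameB frameC
  constructor
  · field_simp
    linear_combination (2 * σ) * h1 + (2 * σ) * h2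
  · field_simp
    linear_combination (-8 * σ * (σ + h)) * h1 + (8 * σ * (σ - h)) * h2

/-- Schlesinger system in a frame diagonalizing `A₀ + Aₓ` at `x = 0`. -/
theorem SchlesingerAt.of_frame (hσ : σ ≠ 0) {m b c mx bx cx : ℂ → ℂ} {t : ℂ}
    (hm : HasDerivAt m (bx t * c t - b t * cx t) t)
    (hb : HasDerivAt b (2 * (mx t * b t - m t * bx t)) t)
    (hc : HasDerivAt c (2 * (cx t * m t - mx t * c t)) t)
    (hmx : HasDerivAt mx (b t * cx t - bx t * c t
      + Complex.exp t * (-((σ - h) / (2 * σ)) * cx t + bx t * ((σ + h) / (2 * σ)))) t)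
    (hbx : HasDerivAt bx (2 * (m t * bx t - mx t * b t)
      + 2 * Complex.exp t * (-(h / (2 * σ)) * bx t + (σ - h) / (2 * σ) * mx t)) t)
    (hcx : HasDerivAt cx (2 * (mx t * c t - cx t * m t)
      + 2 * Complex.exp t * (-((σ + h) / (2 * σ)) * mx t + h / (2 * σ) * cx t)) t)
    (trace : 2 * h * (m t + mx t) + (σ - h) * (c t + cx t) + (σ + h) * (b t + bx t) = h * σ) :
    SchlesingerAt h (fun t => frameA σ h (m t) (b t) (c t)) (fun t => frameB σ (m t) (b t) (c t))
      (fun t => frameC σ h (m t) (b t) (c t)) (fun t => frameA σ h (mx t) (bx t) (cx t))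
      (fun t => frameB σ (mx t) (bx t) (cx t)) (fun t => frameC σ h (mx t) (bx t) (cx t)) t := by
  have dA : ∀ {m b c : ℂ → ℂ} {m' b' c' : ℂ}, HasDerivAt m m' t → HasDerivAt b b' t →
      HasDerivAt c c' t → HasDerivAt (fun t => frameA σ h (m t) (b t) (c t))
        (frameA σ h m' b' c') t := fun hm hb hc =>
    (((hm.const_mul (-2 * h)).sub (hb.const_mul (σ + h))).sub (hc.const_mul (σ - h))).div_const _
  have dB : ∀ {m b c : ℂ → ℂ} {m' b' c' : ℂ}, HasDerivAt m m' t → HasDerivAt b b' t →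
      HasDerivAt c c' t → HasDerivAt (fun t => frameB σ (m t) (b t) (c t))
        (frameB σ m' b' c') t := fun hm hb hc =>
    (((hm.const_mul 2).add hb).sub hc).div_const _
  have dC : ∀ {m b c : ℂ → ℂ} {m' b' c' : ℂ}, HasDerivAt m m' t → HasDerivAt b b' t →
      HasDerivAt c c' t → HasDerivAt (fun t => frameC σ h (m t) (b t) (c t))
        (frameC σ h m' b' c') t := fun hm hb hc =>
    (((hm.const_mul (2 * (σ - h) * (σ + h))).sub (hb.const_mul ((σ + h) ^ 2))).add
      (hc.const_mul ((σ - h) ^ 2))).div_const _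
  constructor
  · refine (dA hm hb hc).congr_deriv ?_
    simp only [frameA, frameB, frameC]; field_simp; ring
  · refine (dB hm hb hc).congr_deriv ?_
    simp only [frameA, frameB]; field_simp; ring
  · refine (dC hm hb hc).congr_deriv ?_
    simp only [frameA, frameC]; field_simp; ring
  · refine (dA hmx hbx hcx).congr_deriv ?_
    simp only [frameA, frameB, frameC]; field_simp; ring
  · refine (dB hmx hbx hcx).congr_deriv ?_
    simp only [frameA, frameB]; field_simp; ring
  · refine (dC hmx hbx hcx).congr_deriv ?_
    simp only [frameA, frameC]; field_simp; ring
  · simp only [frameA]; field_simp; linear_combination (-1 : ℂ) * trace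

end

end

/-! ### Re-expansion near `u = 0` and `u = ∞`. -/

section

open MvPowerSeries (C X)

section
variable {r : ℝ≥0} {f : PS} {K : Subfield ℂ}

/-- Transport of coefficients along an injection of exponents. -/
noncomputable def reindex (φ : Ix → Ix) (f : PS) : PS := Function.extend φ (fun n => f.coeff n) 0

theorem coeff_reindex {φ : Ix → Ix} (hφ : φ.Injective) (n : Ix) :
    (reindex φ f).coeff (φ n) = f.coeff n := hφ.extend_apply _ _ n

theorem coeff_reindex_of_notMem {φ : Ix → Ix} {n : Ix} (hn : n ∉ Set.range φ) :
    (reindex φ f).coeff n = 0 := Function.extend_apply' _ _ n hn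

theorem Rat.reindex {φ : Ix → Ix} (hφ : φ.Injective) (hf : Rat K f) : Rat K (reindex φ f) := by
  intro n
  by_cases hn : n ∈ Set.range φ
  · obtain ⟨n, rfl⟩ := hn
    rw [coeff_reindex hφ]; exact hf n
  · rw [coeff_reindex_of_notMem hn]; exact K.zero_mem

/-- For `r ≤ 1` raising degrees only lowers the weights. -/
theorem Conv.reindex {φ : Ix → Ix} (hφ : φ.Injective) (hd : ∀ n, deg n ≤ deg (φ n)) (hr : r ≤ 1)
    (hf : Conv r f) : Conv r (reindex φ f) := by
  refine lt_of_le_of_lt ?_ hf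
  unfold wnorm
  rw [← hφ.tsum_eq]
  · refine ENNReal.tsum_le_tsum fun n => ?_
    rw [coeff_reindex hφ]
    exact mul_le_mul' le_rfl (pow_le_pow_right_of_le_one' (by exact_mod_cast hr) (hd n))
  · intro n hn
    by_contra h
    rw [Function.mem_support, coeff_reindex_of_notMem h] at hn
    simp at hn

theorem ev_reindex {φ : Ix → Ix} (hφ : φ.Injective) {z w z' w' : ℂ}
    (h : ∀ n, monom z w (φ n) = monom z' w' n) : ev (reindex φ f) z w = ev f z' w' := by
  unfold ev
  rw [← hφ.tsum_eq]
  · exact tsum_congr fun n => by rw [coeff_reindex hφ, h]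
  · intro n hn
    by_contra h
    rw [Function.mem_support, coeff_reindex_of_notMem h, zero_mul] at hn
    exact hn rfl

/-- The exponent of `Z ^ n₀ * (Z u) ^ n₁`. -/
noncomputable def expZero (n : Ix) : Ix := Finsupp.single 0 (n 0 + n 1) + Finsupp.single 1 (n 1)

/-- The exponent of `(W s) ^ n₀ * W ^ n₁`. -/
noncomputable def expMinus (n : Ix) : Ix := Finsupp.single 0 (n 0 + n 1) + Finsupp.single 1 (n 0)

theorem expZero_injective : Function.Injective expZero := by
  intro a b h
  have h0 := DFunLike.congr_fun h 0
  have h1 := DFunLike.congr_fun h 1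
  simp [expZero] at h0 h1
  rw [ix_eq a, ix_eq b, show a 0 = b 0 by omega, h1]

theorem expMinus_injective : Function.Injective expMinus := by
  intro a b h
  have h0 := DFunLike.congr_fun h 0
  have h1 := DFunLike.congr_fun h 1
  simp [expMinus] at h0 h1
  rw [ix_eq a, ix_eq b, show a 1 = b 1 by omega, h1]

theorem deg_le_deg_expZero (n : Ix) : deg n ≤ deg (expZero n) := by
  simp [deg, expZero]

theorem deg_le_deg_expMinus (n : Ix) : deg n ≤ deg (expMinus n) := by
  simp [deg, expMinus]

theorem ev_reindex_expZero (z u : ℂ) : ev (reindex expZero f) z u = ev f z (z * u) := by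
  refine ev_reindex expZero_injective fun n => ?_
  simp [monom, expZero]
  ring

theorem ev_reindex_expMinus (w s : ℂ) : ev (reindex expMinus f) w s = ev f (w * s) w := by
  refine ev_reindex expMinus_injective fun n => ?_
  simp [monom, expMinus]
  ring

/-- The exponent of the second variable. -/
noncomputable abbrev e₁ : Ix := Finsupp.single 1 1

theorem coeff_zero_reindex_expZero : (reindex expZero f).coeff 0 = f.coeff 0 := by
  rw [← coeff_reindex (f := f) expZero_injective 0]
  congr 1
  simp [expZero]

theorem coeff_zero_reindex_expMinus : (reindex expMinus f).coeff 0 = f.coeff 0 := by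
  rw [← coeff_reindex (f := f) expMinus_injective 0]
  congr 1
  simp [expMinus]

/-- In `f(x, x u)` every `u` is accompanied by an `x`, so the term linear in `u` alone comes only
from the explicit factor in `LinSeries.atZero`. The same holds at `u = ∞`. -/
theorem coeff_e₁_reindex_expZero : (reindex expZero f).coeff e₁ = 0 := by
  refine coeff_reindex_of_notMem ?_
  rintro ⟨n, hn⟩
  have h0 := DFunLike.congr_fun hn 0
  have h1 := DFunLike.congr_fun hn 1
  simp [expZero] at h0 h1
  omega

theorem coeff_e₁_reindex_expMinus : (reindex expMinus f).coeff e₁ = 0 := by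
  refine coeff_reindex_of_notMem ?_
  rintro ⟨n, hn⟩
  have h0 := DFunLike.congr_fun hn 0
  have h1 := DFunLike.congr_fun hn 1
  simp [expMinus] at h0 h1
  omega

theorem coeff_zero_mul (f g : PS) : (f * g).coeff 0 = f.coeff 0 * g.coeff 0 := by
  simp only [MvPowerSeries.coeff_zero_eq_constantCoeff_apply, map_mul]

theorem coeff_e₁_mul (f g : PS) :
    (f * g).coeff e₁ = f.coeff 0 * g.coeff e₁ + f.coeff e₁ * g.coeff 0 := by
  classical
  rw [MvPowerSeries.coeff_mul]
  have : (Finset.HasAntidiagonal.antidiagonal e₁ : Finset (Ix × Ix)) = {(0, e₁), (e₁, 0)} := by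
    rw [Finsupp.antidiagonal_single]
    ext p
    simp [Finset.Nat.antidiagonal_succ]
  rw [this, Finset.sum_pair]
  simp [Finsupp.single_eq_zero]

theorem coeff_e₁_X_mul (f : PS) : (X 1 * f).coeff e₁ = f.coeff 0 := by
  rw [coeff_e₁_mul, MvPowerSeries.coeff_zero_X, MvPowerSeries.coeff_index_single_self_X]
  simp

end

/-- A quotient of products of convergent power series with nonzero constant terms. -/
theorem exists_quotient_series {K : Subfield ℂ} {r : ℝ≥0} (hr : 0 < r) {f₁ f₂ g₁ g₂ : PS}
    (cf₁ : Conv r f₁) (cf₂ : Conv r f₂) (cg₁ : Conv r g₁) (cg₂ : Conv r g₂)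
    (rf₁ : Rat K f₁) (rf₂ : Rat K f₂) (rg₁ : Rat K g₁) (rg₂ : Rat K g₂)
    (nf₁ : f₁.coeff 0 ≠ 0) (nf₂ : f₂.coeff 0 ≠ 0) (ng₁ : g₁.coeff 0 ≠ 0) (ng₂ : g₂.coeff 0 ≠ 0) :
    ∃ (r' : ℝ≥0) (G : PS), 0 < r' ∧ r' ≤ r ∧ Conv r' G ∧ Rat K G ∧
      (∀ z w : ℂ, ‖z‖ ≤ r' → ‖w‖ ≤ r' →
        ev f₁ z w ≠ 0 ∧ ev f₂ z w ≠ 0 ∧ ev g₁ z w ≠ 0 ∧ ev g₂ z w ≠ 0 ∧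
        ev G z w = ev f₁ z w * ev f₂ z w / (ev g₁ z w * ev g₂ z w)) ∧
      G.coeff 0 = f₁.coeff 0 * f₂.coeff 0 / (g₁.coeff 0 * g₂.coeff 0) ∧
      G.coeff e₁ = G.coeff 0 * (f₁.coeff e₁ / f₁.coeff 0 + f₂.coeff e₁ / f₂.coeff 0
        - g₁.coeff e₁ / g₁.coeff 0 - g₂.coeff e₁ / g₂.coeff 0) := by
  -- The inverses of the numerators serve only to show that the numerators do not vanish on the
  -- polydisc.
  obtain ⟨r1, f₁', p1, l1, cf₁', -, i1⟩ := cf₁.exists_inv hr rf₁ nf₁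
  obtain ⟨r2, f₂', p2, l2, cf₂', -, i2⟩ := cf₂.exists_inv hr rf₂ nf₂
  obtain ⟨r3, g₁', p3, l3, cg₁', rg₁', i3⟩ := cg₁.exists_inv hr rg₁ ng₁
  obtain ⟨r4, g₂', p4, l4, cg₂', rg₂', i4⟩ := cg₂.exists_inv hr rg₂ ng₂
  set ε : ℝ≥0 := min (min r1 r2) (min r3 r4) with hε
  have e1 : ε ≤ r1 := (min_le_left _ _).trans (min_le_left _ _)
  have e2 : ε ≤ r2 := (min_le_left _ _).trans (min_le_right _ _)
  have e3 : ε ≤ r3 := (min_le_right _ _).trans (min_le_left _ _)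
  have e4 : ε ≤ r4 := (min_le_right _ _).trans (min_le_right _ _)
  have er : ε ≤ r := e1.trans l1
  have hf₁ := cf₁.mono er
  have hf₂ := cf₂.mono er
  have hg₁ := cg₁.mono er
  have hg₂ := cg₂.mono er
  have hf₁' := cf₁'.mono e1
  have hf₂' := cf₂'.mono e2
  have hg₁' := cg₁'.mono e3
  have hg₂' := cg₂'.mono e4
  have hinv : ∀ {f g : PS} {z w : ℂ}, Conv ε f → Conv ε g → f * g = 1 → ‖z‖ ≤ ε → ‖w‖ ≤ ε →
      ev f z w * ev g z w = 1 := by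
    intro f g z w hf hg hfg hz hw
    rw [← ev_mul hf hg hz hw, hfg, ← map_one (C (σ := Fin 2) (R := ℂ)), ev_C]
  have hG : f₁ * f₂ * (g₁' * g₂') * (g₁ * g₂) = f₁ * f₂ := by
    calc _ = f₁ * f₂ * ((g₁ * g₁') * (g₂ * g₂')) := by ring
      _ = _ := by rw [i3, i4]; ring
  -- The two leading coefficients follow by comparison in `G g₁ g₂ = f₁ f₂`; the second one is a
  -- logarithmic derivative.
  have h0 := congrArg (fun p : PS => p.coeff 0) hG
  have h1 := congrArg (fun p : PS => p.coeff e₁) hG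
  refine ⟨ε, f₁ * f₂ * (g₁' * g₂'), lt_min (lt_min p1 p2) (lt_min p3 p4), er,
    (hf₁.mul hf₂).mul (hg₁'.mul hg₂'), (rf₁.mul rf₂).mul (rg₁'.mul rg₂'), ?_, ?_, ?_⟩
  · intro z w hz hw
    have j1 := hinv hf₁ hf₁' i1 hz hw
    have j2 := hinv hf₂ hf₂' i2 hz hw
    have j3 := hinv hg₁ hg₁' i3 hz hw
    have j4 := hinv hg₂ hg₂' i4 hz hw
    refine ⟨left_ne_zero_of_mul_eq_one j1, left_ne_zero_of_mul_eq_one j2,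
      left_ne_zero_of_mul_eq_one j3, left_ne_zero_of_mul_eq_one j4, ?_⟩
    rw [ev_mul (hf₁.mul hf₂) (hg₁'.mul hg₂') hz hw, ev_mul hf₁ hf₂ hz hw, ev_mul hg₁' hg₂' hz hw,
      eq_div_iff (mul_ne_zero (left_ne_zero_of_mul_eq_one j3) (left_ne_zero_of_mul_eq_one j4))]
    linear_combination (ev f₁ z w * ev f₂ z w) * (ev g₂ z w * ev g₂' z w * j3 + j4)
  · generalize f₁ * f₂ * (g₁' * g₂') = G at *
    simp only [coeff_zero_mul] at h0
    rw [eq_div_iff (mul_ne_zero ng₁ ng₂), h0]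
  · generalize f₁ * f₂ * (g₁' * g₂') = G at *
    simp only [coeff_zero_mul] at h0
    simp only [coeff_zero_mul, coeff_e₁_mul] at h1
    have hG0 : G.coeff 0 = f₁.coeff 0 * f₂.coeff 0 / (g₁.coeff 0 * g₂.coeff 0) := by
      rw [eq_div_iff (mul_ne_zero ng₁ ng₂), h0]
    have hG1 : G.coeff e₁ = (f₁.coeff 0 * f₂.coeff e₁ + f₁.coeff e₁ * f₂.coeff 0 - G.coeff 0 *
        (g₁.coeff 0 * g₂.coeff e₁ + g₁.coeff e₁ * g₂.coeff 0)) / (g₁.coeff 0 * g₂.coeff 0) := by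
      rw [eq_div_iff (mul_ne_zero ng₁ ng₂), ← h1]; ring
    rw [hG1, hG0]
    field_simp
    ring

/-- A pair of power series `(F, G)` in `Z` and `W` representing the function `F + u G`, where
`u = ρ x^σ`. -/
structure LinSeries where
  /-- The constant part. -/
  F : PS
  /-- The coefficient of `u`. -/
  G : PS

/-- The function represented by a pair of power series. -/
noncomputable def LinSeries.eval (L : LinSeries) (σ ρ t : ℂ) : ℂ :=
  evC σ ρ L.F t + ρ * cpowCov σ t * evC σ ρ L.G t

/-- The power series in `x` and `u` of the represented function. -/
noncomputable def LinSeries.atZero (L : LinSeries) : PS :=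
  reindex expZero L.F + X 1 * reindex expZero L.G

/-- The power series in `x u` and `s = u⁻¹` of the represented function multiplied by `s`. -/
noncomputable def LinSeries.atMinus (L : LinSeries) : PS :=
  reindex expMinus L.G + X 1 * reindex expMinus L.F

/-- Convergence with coefficients in `K`. -/
structure LinSeries.Good (K : Subfield ℂ) (r : ℝ≥0) (L : LinSeries) : Prop where
  cF : Conv r L.F
  cG : Conv r L.G
  rF : Rat K L.F
  rG : Rat K L.G
  nF : L.F.coeff 0 ≠ 0

/-- `L.atMinus` for `e = true` and the power series of `L.F` for `e = false`. -/
noncomputable def LinSeries.minus (L : LinSeries) (e : Bool) : PS :=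
  if e then L.atMinus else reindex expMinus L.F

/-- The scaling of the second kind of coordinates is admissible. -/
def LinSeries.Adm (L : LinSeries) (e : Bool) : Prop :=
  if e then L.G.coeff 0 ≠ 0 else L.G = 0

/-- The leading coefficient at `u = ∞`. -/
noncomputable def LinSeries.lead (L : LinSeries) (e : Bool) : ℂ :=
  if e then L.G.coeff 0 else L.F.coeff 0

/-- The subleading coefficient at `u = ∞`. -/
noncomputable def LinSeries.sub (L : LinSeries) (e : Bool) : ℂ :=
  if e then L.F.coeff 0 else 0

section
variable {L : LinSeries} {K : Subfield ℂ} {r : ℝ≥0} {σ ρ t : ℂ} {e : Bool}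

theorem LinSeries.coeff_zero_atZero : L.atZero.coeff 0 = L.F.coeff 0 := by
  rw [LinSeries.atZero, map_add, coeff_zero_reindex_expZero, MvPowerSeries.coeff_zero_X_mul,
    add_zero]

theorem LinSeries.coeff_e₁_atZero : L.atZero.coeff e₁ = L.G.coeff 0 := by
  rw [LinSeries.atZero, map_add, coeff_e₁_reindex_expZero, coeff_e₁_X_mul,
    coeff_zero_reindex_expZero, zero_add]

theorem LinSeries.coeff_zero_minus : (L.minus e).coeff 0 = L.lead e := by
  unfold LinSeries.minus LinSeries.lead
  split_ifs
  · rw [LinSeries.atMinus, map_add, coeff_zero_reindex_expMinus, MvPowerSeries.coeff_zero_X_mul,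
      add_zero]
  · exact coeff_zero_reindex_expMinus

theorem LinSeries.coeff_e₁_minus : (L.minus e).coeff e₁ = L.sub e := by
  unfold LinSeries.minus LinSeries.sub
  split_ifs
  · rw [LinSeries.atMinus, map_add, coeff_e₁_reindex_expMinus, coeff_e₁_X_mul,
      coeff_zero_reindex_expMinus, zero_add]
  · exact coeff_e₁_reindex_expMinus

theorem LinSeries.Good.rat_atZero (h : L.Good K r) : Rat K L.atZero :=
  (h.rF.reindex expZero_injective).add ((Rat.X 1).mul (h.rG.reindex expZero_injective))

theorem LinSeries.Good.rat_minus (h : L.Good K r) : Rat K (L.minus e) := by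
  unfold LinSeries.minus
  split_ifs
  · exact (h.rG.reindex expMinus_injective).add ((Rat.X 1).mul (h.rF.reindex expMinus_injective))
  · exact h.rF.reindex expMinus_injective

theorem LinSeries.Good.conv_atZero (h : L.Good K r) (hr : r ≤ 1) : Conv r L.atZero :=
  (h.cF.reindex expZero_injective deg_le_deg_expZero hr).add
    ((Conv.X 1).mul (h.cG.reindex expZero_injective deg_le_deg_expZero hr))

theorem LinSeries.Good.conv_minus (h : L.Good K r) (hr : r ≤ 1) : Conv r (L.minus e) := by
  unfold LinSeries.minus
  split_ifs
  · exact (h.cG.reindex expMinus_injective deg_le_deg_expMinus hr).add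
      ((Conv.X 1).mul (h.cF.reindex expMinus_injective deg_le_deg_expMinus hr))
  · exact h.cF.reindex expMinus_injective deg_le_deg_expMinus hr

theorem LinSeries.Good.ev_atZero (h : L.Good K r) (hr : r ≤ 1) (hx : ‖Complex.exp t‖ ≤ r)
    (hu : ‖ρ * cpowCov σ t‖ ≤ r) :
    ev L.atZero (Complex.exp t) (ρ * cpowCov σ t) = L.eval σ ρ t := by
  have hG := h.cG.reindex expZero_injective deg_le_deg_expZero hr
  rw [LinSeries.atZero, ev_add (h.cF.reindex expZero_injective deg_le_deg_expZero hr)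
    ((Conv.X 1).mul hG) hx hu, ev_mul (Conv.X 1) hG hx hu, ev_X_one, ev_reindex_expZero,
    ev_reindex_expZero]
  rfl

/-- With `w = x u` and `s = u⁻¹` one has `x = w s`, and `s (F + u G) = G + s F`. The factor `s`
depends only on the chosen row, so it cancels in the quotient defining `y`. -/
theorem LinSeries.Good.ev_minus (h : L.Good K r) (ha : L.Adm e) (hr : r ≤ 1)
    (hu0 : ρ * cpowCov σ t ≠ 0) (hw : ‖Complex.exp t * (ρ * cpowCov σ t)‖ ≤ r)
    (hs : ‖(ρ * cpowCov σ t)⁻¹‖ ≤ r) :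
    ev (L.minus e) (Complex.exp t * (ρ * cpowCov σ t)) (ρ * cpowCov σ t)⁻¹
      = (if e then (ρ * cpowCov σ t)⁻¹ else 1) * L.eval σ ρ t := by
  have hz : Complex.exp t * (ρ * cpowCov σ t) * (ρ * cpowCov σ t)⁻¹ = Complex.exp t :=
    mul_inv_cancel_right₀ hu0 _
  cases e
  · have hG : L.G = 0 := by simpa [LinSeries.Adm] using ha
    simp only [LinSeries.minus, Bool.false_eq_true, if_false, ev_reindex_expMinus, hz, one_mul,
      LinSeries.eval, hG]
    simp [evC, ev]
  · have hF := h.cF.reindex expMinus_injective deg_le_deg_expMinus hr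
    simp only [LinSeries.minus, if_true, LinSeries.atMinus]
    rw [ev_add (h.cG.reindex expMinus_injective deg_le_deg_expMinus hr) ((Conv.X 1).mul hF) hw hs,
      ev_mul (Conv.X 1) hF hw hs, ev_X_one, ev_reindex_expMinus, ev_reindex_expMinus, hz,
      LinSeries.eval, mul_add, inv_mul_cancel_left₀ hu0]
    exact add_comm _ _

theorem LinSeries.lead_ne_zero (h : L.Good K r) (ha : L.Adm e) : L.lead e ≠ 0 := by
  cases e
  · simpa [LinSeries.lead] using h.nF
  · simpa [LinSeries.lead, LinSeries.Adm] using ha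

theorem LinSeries.Good.differentiableOn_eval (h : L.Good K r) :
    DifferentiableOn ℂ (L.eval σ ρ) (OmegaFull σ r ρ) := by
  have h1 : Differentiable ℂ fun t => ρ * cpowCov σ t := fun t =>
    ((hasDerivAt_cpowCov σ t).const_mul ρ).differentiableAt
  exact (h.cF.differentiableOn_evC).add
    (h1.differentiableOn.mul h.cG.differentiableOn_evC)

end

end

/-! ### Eigenvector rows and the analytic Schlesinger solution. -/

section

open MvPowerSeries (C X)

section
variable {σ ρ t : ℂ} {r : ℝ≥0} {f g : PS}

theorem evC_add (hf : Conv r f) (hg : Conv r g) (ht : t ∈ OmegaFull σ r ρ) :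
    evC σ ρ (f + g) t = evC σ ρ f t + evC σ ρ g t := ev_add hf hg ht.1.le ht.2.le

theorem evC_sub (hf : Conv r f) (hg : Conv r g) (ht : t ∈ OmegaFull σ r ρ) :
    evC σ ρ (f - g) t = evC σ ρ f t - evC σ ρ g t := ev_sub hf hg ht.1.le ht.2.le

theorem evC_mul (hf : Conv r f) (hg : Conv r g) (ht : t ∈ OmegaFull σ r ρ) :
    evC σ ρ (f * g) t = evC σ ρ f t * evC σ ρ g t := ev_mul hf hg ht.1.le ht.2.le

theorem evC_neg : evC σ ρ (-f) t = -evC σ ρ f t := ev_neg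

theorem evC_C (a : ℂ) : evC σ ρ (C a) t = a := ev_C a

theorem evC_X_zero : evC σ ρ (X 0) t = Complex.exp t := ev_X_zero

theorem evC_X_one : evC σ ρ (X 1) t = Complex.exp t * (ρ * cpowCov σ t) := ev_X_one

theorem evC_zero : evC σ ρ 0 t = 0 := by simp [evC, ev]

end

/-- First component of a left eigenvector in the original frame, from the first row
(`i = true`) or from the second row (`i = false`) of `(m, b₁ + u b₂; c, -m) + θ / 2`. -/
noncomputable def rowFst (σ h : ℂ) (i : Bool) (θ : ℂ) (m b₁ b₂ c : PS) : LinSeries :=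
  if i then ⟨C (σ - h) * (m + C (θ / 2)) - C (σ + h) * b₁, C (-(σ + h)) * b₂⟩
  else ⟨C (σ - h) * c - C (σ + h) * (C (θ / 2) - m), 0⟩

/-- Second component of a left eigenvector in the original frame. -/
noncomputable def rowSnd (i : Bool) (θ : ℂ) (m b₁ b₂ c : PS) : LinSeries :=
  if i then ⟨C 2 * (m + C (θ / 2) + b₁), C 2 * b₂⟩
  else ⟨C 2 * (c + (C (θ / 2) - m)), 0⟩

/-- Sign attached to a choice of row. -/
noncomputable def sgn (i : Bool) : ℂ := if i then 1 else -1

/-- Leading coefficient of `rowFst` at `u = 0`. -/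
noncomputable def fstF (σ h : ℂ) (i : Bool) (θ : ℂ) : ℂ :=
  if i then (σ - h) * θ else -((σ + h) * θ)

/-- Leading coefficient of the `u`-part of `rowFst`. -/
noncomputable def fstG (σ h : ℂ) (i : Bool) (β : ℂ) : ℂ := if i then -(σ + h) * β else 0

/-- Leading coefficient of the `u`-part of `rowSnd`. -/
noncomputable def sndG (i : Bool) (β : ℂ) : ℂ := if i then 2 * β else 0

section
variable {σ h : ℂ} {i : Bool} {θ β : ℂ} {m b₁ b₂ c : PS}

theorem coeff_rowFst_F (hm : m.coeff 0 = sgn i * θ / 2) (hb₁ : b₁.coeff 0 = 0)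
    (hc : c.coeff 0 = 0) : (rowFst σ h i θ m b₁ b₂ c).F.coeff 0 = fstF σ h i θ := by
  rw [MvPowerSeries.coeff_zero_eq_constantCoeff_apply] at hm hb₁ hc
  cases i
  · simp [rowFst, fstF, hm, hc, sgn]
    left; ring
  · simp [rowFst, fstF, hm, hb₁, sgn]

theorem coeff_rowFst_G (hb₂ : b₂.coeff 0 = β) :
    (rowFst σ h i θ m b₁ b₂ c).G.coeff 0 = fstG σ h i β := by
  rw [MvPowerSeries.coeff_zero_eq_constantCoeff_apply] at hb₂
  cases i <;> simp [rowFst, fstG, hb₂]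

theorem coeff_rowSnd_F (hm : m.coeff 0 = sgn i * θ / 2) (hb₁ : b₁.coeff 0 = 0)
    (hc : c.coeff 0 = 0) : (rowSnd i θ m b₁ b₂ c).F.coeff 0 = 2 * θ := by
  rw [MvPowerSeries.coeff_zero_eq_constantCoeff_apply] at hm hb₁ hc
  cases i
  · simp [rowSnd, hm, hc, sgn]
    ring
  · simp [rowSnd, hm, hb₁, sgn]

theorem coeff_rowSnd_G (hb₂ : b₂.coeff 0 = β) :
    (rowSnd i θ m b₁ b₂ c).G.coeff 0 = sndG i β := by
  rw [MvPowerSeries.coeff_zero_eq_constantCoeff_apply] at hb₂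
  cases i <;> simp [rowSnd, sndG, hb₂]

theorem rowFst_adm (hb₂ : b₂.coeff 0 ≠ 0) (hp : σ + h ≠ 0) :
    (rowFst σ h i θ m b₁ b₂ c).Adm i := by
  have h1 := coeff_rowFst_G (σ := σ) (h := h) (i := i) (θ := θ) (m := m) (b₁ := b₁) (c := c)
    (b₂ := b₂) rfl
  cases i
  · simp [rowFst, LinSeries.Adm]
  · simp only [LinSeries.Adm, if_true, h1, fstG]
    exact mul_ne_zero (neg_ne_zero.2 hp) hb₂

theorem rowSnd_adm (hb₂ : b₂.coeff 0 ≠ 0) : (rowSnd i θ m b₁ b₂ c).Adm i := by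
  have h1 := coeff_rowSnd_G (i := i) (θ := θ) (m := m) (b₁ := b₁) (c := c) (b₂ := b₂) rfl
  cases i
  · simp [rowSnd, LinSeries.Adm]
  · simp only [LinSeries.Adm, if_true, h1, sndG]
    exact mul_ne_zero two_ne_zero hb₂

variable {K : Subfield ℂ} {r : ℝ≥0}

theorem Conv.zero : Conv r 0 := by simp [Conv, wnorm]

theorem rowFst_good (cm : Conv r m) (cb₁ : Conv r b₁) (cb₂ : Conv r b₂) (cc : Conv r c)
    (rm : Rat K m) (rb₁ : Rat K b₁) (rb₂ : Rat K b₂) (rc : Rat K c)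
    (hσ : σ ∈ K) (hh : h ∈ K) (hθ : θ ∈ K) (hm : m.coeff 0 = sgn i * θ / 2)
    (hb₁ : b₁.coeff 0 = 0) (hc : c.coeff 0 = 0) (nθ : θ ≠ 0) (hp : σ + h ≠ 0) (hn : σ - h ≠ 0) :
    (rowFst σ h i θ m b₁ b₂ c).Good K r := by
  have two : (2 : ℂ) ∈ K := ofNat_mem K 2
  have r2 : Rat K (C (θ / 2)) := Rat.C (K.div_mem hθ two)
  have rn : Rat K (C (σ - h)) := Rat.C (K.sub_mem hσ hh)
  have rp : Rat K (C (σ + h)) := Rat.C (K.add_mem hσ hh)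
  have rp' : Rat K (C (-(σ + h))) := Rat.C (K.neg_mem (K.add_mem hσ hh))
  have hF := coeff_rowFst_F (σ := σ) (h := h) (b₂ := b₂) hm hb₁ hc
  have hC : ∀ a, Conv r (C a) := fun a => Conv.C a
  have hne : fstF σ h i θ ≠ 0 := by
    unfold fstF
    split_ifs
    · exact mul_ne_zero hn nθ
    · exact neg_ne_zero.2 (mul_ne_zero hp nθ)
  cases i
  · exact ⟨((hC _).mul cc).sub ((hC _).mul ((hC _).sub cm)), Conv.zero,
      (rn.mul rc).sub (rp.mul (r2.sub rm)), Rat.zero, by rwa [hF]⟩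
  · exact ⟨((hC _).mul (cm.add (hC _))).sub ((hC _).mul cb₁), (hC _).mul cb₂,
      (rn.mul (rm.add r2)).sub (rp.mul rb₁), rp'.mul rb₂, by rwa [hF]⟩

theorem rowSnd_good (cm : Conv r m) (cb₁ : Conv r b₁) (cb₂ : Conv r b₂) (cc : Conv r c)
    (rm : Rat K m) (rb₁ : Rat K b₁) (rb₂ : Rat K b₂) (rc : Rat K c)
    (hθ : θ ∈ K) (hm : m.coeff 0 = sgn i * θ / 2)
    (hb₁ : b₁.coeff 0 = 0) (hc : c.coeff 0 = 0) (nθ : θ ≠ 0) :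
    (rowSnd i θ m b₁ b₂ c).Good K r := by
  have two : (2 : ℂ) ∈ K := ofNat_mem K 2
  have r2 : Rat K (C (θ / 2)) := Rat.C (K.div_mem hθ two)
  have rt : Rat K (C 2) := Rat.C two
  have hF := coeff_rowSnd_F (b₂ := b₂) hm hb₁ hc
  have hC : ∀ a, Conv r (C a) := fun a => Conv.C a
  have hne : 2 * θ ≠ 0 := mul_ne_zero two_ne_zero nθ
  cases i
  · exact ⟨(hC _).mul (cc.add ((hC _).sub cm)), Conv.zero,
      rt.mul (rc.add (r2.sub rm)), Rat.zero, by rwa [hF]⟩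
  · exact ⟨(hC _).mul ((cm.add (hC _)).add cb₁), (hC _).mul cb₂,
      rt.mul ((rm.add r2).add rb₁), rt.mul rb₂, by rwa [hF]⟩

/-- The determinant condition says `A ^ 2 = (θ/2) ^ 2`, so every row of `A + θ/2` is a left
eigenvector for `θ/2`. Both rows occur because only the first has a nonzero limit at `u = 0` when
`m` starts at `θ/2`, and only the second when it starts at `-θ/2`. -/
theorem isLeftEigen_rows (hσ : σ ≠ 0) {ρ t : ℂ} (ht : t ∈ OmegaFull σ r ρ)
    (cm : Conv r m) (cb₁ : Conv r b₁) (cb₂ : Conv r b₂) (cc : Conv r c)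
    (hdet : evC σ ρ m t ^ 2 + (evC σ ρ b₁ t + ρ * cpowCov σ t * evC σ ρ b₂ t) * evC σ ρ c t
      = (θ / 2) ^ 2) :
    IsLeftEigen θ
      (frameA σ h (evC σ ρ m t) (evC σ ρ b₁ t + ρ * cpowCov σ t * evC σ ρ b₂ t) (evC σ ρ c t))
      (frameB σ (evC σ ρ m t) (evC σ ρ b₁ t + ρ * cpowCov σ t * evC σ ρ b₂ t) (evC σ ρ c t))
      (frameC σ h (evC σ ρ m t) (evC σ ρ b₁ t + ρ * cpowCov σ t * evC σ ρ b₂ t) (evC σ ρ c t))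
      ((rowFst σ h i θ m b₁ b₂ c).eval σ ρ t) ((rowSnd i θ m b₁ b₂ c).eval σ ρ t) := by
  have hC : ∀ a, Conv r (C a) := fun a => Conv.C a
  cases i
  · have h1 : IsLeftEigen θ (evC σ ρ m t)
        (evC σ ρ b₁ t + ρ * cpowCov σ t * evC σ ρ b₂ t) (evC σ ρ c t)
        (evC σ ρ c t) (θ / 2 - evC σ ρ m t) :=
      ⟨by linear_combination hdet, by ring⟩
    have h2 := h1.frame hσ (h := h)
    have e1 : (rowFst σ h false θ m b₁ b₂ c).eval σ ρ t
        = (σ - h) * evC σ ρ c t - (σ + h) * (θ / 2 - evC σ ρ m t) := by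
      simp only [rowFst, LinSeries.eval, Bool.false_eq_true, if_false]
      rw [evC_sub ((hC _).mul cc) ((hC _).mul ((hC _).sub cm)) ht, evC_mul (hC _) cc ht,
        evC_mul (hC _) ((hC _).sub cm) ht, evC_sub (hC _) cm ht, evC_zero]
      simp only [evC_C]
      ring
    have e2 : (rowSnd false θ m b₁ b₂ c).eval σ ρ t
        = 2 * (evC σ ρ c t + (θ / 2 - evC σ ρ m t)) := by
      simp only [rowSnd, LinSeries.eval, Bool.false_eq_true, if_false]
      rw [evC_mul (hC _) (cc.add ((hC _).sub cm)) ht, evC_add cc ((hC _).sub cm) ht,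
        evC_sub (hC _) cm ht, evC_zero]
      simp only [evC_C]
      ring
    rw [e1, e2]
    exact h2
  · have h1 : IsLeftEigen θ (evC σ ρ m t)
        (evC σ ρ b₁ t + ρ * cpowCov σ t * evC σ ρ b₂ t) (evC σ ρ c t)
        (evC σ ρ m t + θ / 2) (evC σ ρ b₁ t + ρ * cpowCov σ t * evC σ ρ b₂ t) :=
      ⟨by ring, by linear_combination hdet⟩
    have h2 := h1.frame hσ (h := h)
    have e1 : (rowFst σ h true θ m b₁ b₂ c).eval σ ρ t
        = (σ - h) * (evC σ ρ m t + θ / 2)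
          - (σ + h) * (evC σ ρ b₁ t + ρ * cpowCov σ t * evC σ ρ b₂ t) := by
      simp only [rowFst, LinSeries.eval, if_true]
      rw [evC_sub ((hC _).mul (cm.add (hC _))) ((hC _).mul cb₁) ht,
        evC_mul (hC _) (cm.add (hC _)) ht, evC_mul (hC _) cb₁ ht, evC_add cm (hC _) ht,
        evC_mul (hC _) cb₂ ht]
      simp only [evC_C]
      ring
    have e2 : (rowSnd true θ m b₁ b₂ c).eval σ ρ t
        = 2 * (evC σ ρ m t + θ / 2
          + (evC σ ρ b₁ t + ρ * cpowCov σ t * evC σ ρ b₂ t)) := by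
      simp only [rowSnd, LinSeries.eval, if_true]
      rw [evC_mul (hC _) ((cm.add (hC _)).add cb₁) ht, evC_add (cm.add (hC _)) cb₁ ht,
        evC_add cm (hC _) ht, evC_mul (hC _) cb₂ ht]
      simp only [evC_C]
      ring
    rw [e1, e2]
    exact h2

end

section
variable {σ h m₀ β : ℂ} {al pi m q c b₁ b₂ : PS} {r : ℝ≥0} {ρ t : ℂ}

/-- A formal solution defines a solution of the Schlesinger system. -/
theorem IsSeriesSol.schlesingerAt (hσ : σ ∈ SigmaPlus)
    (H : IsSeriesSol σ (-(h / (2 * σ))) (-((σ - h) / (2 * σ))) (-((σ + h) / (2 * σ))) m₀ β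
      al pi m q c b₁ b₂)
    (cal : Conv r al) (cpi : Conv r pi) (cm : Conv r m) (cq : Conv r q) (cc : Conv r c)
    (cb₁ : Conv r b₁) (cb₂ : Conv r b₂) (ht : t ∈ OmegaFull σ r ρ) :
    SchlesingerAt h
      (fun t => frameA σ h (evC σ ρ m t) (evC σ ρ b₁ t + ρ * cpowCov σ t * evC σ ρ b₂ t)
        (evC σ ρ (X 0 * c) t))
      (fun t => frameB σ (evC σ ρ m t) (evC σ ρ b₁ t + ρ * cpowCov σ t * evC σ ρ b₂ t)
        (evC σ ρ (X 0 * c) t))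
      (fun t => frameC σ h (evC σ ρ m t) (evC σ ρ b₁ t + ρ * cpowCov σ t * evC σ ρ b₂ t)
        (evC σ ρ (X 0 * c) t))
      (fun t => frameA σ h (evC σ ρ (C (σ / 2) + al - m) t)
        (evC σ ρ (pi - b₁) t + ρ * cpowCov σ t * evC σ ρ (-b₂) t) (evC σ ρ (X 0 * (q - c)) t))
      (fun t => frameB σ (evC σ ρ (C (σ / 2) + al - m) t)
        (evC σ ρ (pi - b₁) t + ρ * cpowCov σ t * evC σ ρ (-b₂) t) (evC σ ρ (X 0 * (q - c)) t))
      (fun t => frameC σ h (evC σ ρ (C (σ / 2) + al - m) t)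
        (evC σ ρ (pi - b₁) t + ρ * cpowCov σ t * evC σ ρ (-b₂) t) (evC σ ρ (X 0 * (q - c)) t))
      t := by
  have hσ0 := SigmaPlus.ne_zero hσ
  have hC : ∀ a, Conv r (C a) := fun a => Conv.C a
  have hX : ∀ i, Conv r (X i : PS) := fun a => Conv.X a
  have hu : HasDerivAt (fun t => ρ * cpowCov σ t) (ρ * (σ * cpowCov σ t)) t :=
    (hasDerivAt_cpowCov σ t).const_mul ρ
  have eXc : evC σ ρ (X 0 * c) t = Complex.exp t * evC σ ρ c t := by
    rw [evC_mul (hX 0) cc ht, evC_X_zero]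
  have eXq : evC σ ρ (X 0 * (q - c)) t = Complex.exp t * (evC σ ρ q t - evC σ ρ c t) := by
    rw [evC_mul (hX 0) (cq.sub cc) ht, evC_X_zero, evC_sub cq cc ht]
  have emx : evC σ ρ (C (σ / 2) + al - m) t = σ / 2 + evC σ ρ al t - evC σ ρ m t := by
    rw [evC_sub ((hC _).add cal) cm ht, evC_add (hC _) cal ht, evC_C]
  have ebx : evC σ ρ (pi - b₁) t = evC σ ρ pi t - evC σ ρ b₁ t := evC_sub cpi cb₁ ht
  have dm := cm.hasDerivAt_evC ht
  have dal := cal.hasDerivAt_evC ht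
  have dpi := cpi.hasDerivAt_evC ht
  have dq := cq.hasDerivAt_evC ht
  have dc := cc.hasDerivAt_evC ht
  have db₁ := cb₁.hasDerivAt_evC ht
  have db₂ := cb₂.hasDerivAt_evC ht
  rw [H.m_eq, evC_sub ((hX 0).mul ((cpi.mul cc).sub (cq.mul cb₁))) ((hX 1).mul (cq.mul cb₂)) ht,
    evC_mul (hX 0) ((cpi.mul cc).sub (cq.mul cb₁)) ht, evC_sub (cpi.mul cc) (cq.mul cb₁) ht,
    evC_mul cpi cc ht, evC_mul cq cb₁ ht, evC_mul (hX 1) (cq.mul cb₂) ht, evC_mul cq cb₂ ht,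
    evC_X_zero, evC_X_one] at dm
  rw [H.al_eq, evC_add ((hX 0).mul (((hC _).mul ((hX 0).mul (cq.sub cc))).sub
      ((hC _).mul (cpi.sub cb₁)))) ((hC _).mul ((hX 1).mul cb₂)) ht,
    evC_mul (hX 0) (((hC _).mul ((hX 0).mul (cq.sub cc))).sub ((hC _).mul (cpi.sub cb₁))) ht,
    evC_sub ((hC _).mul ((hX 0).mul (cq.sub cc))) ((hC _).mul (cpi.sub cb₁)) ht,
    evC_mul (hC _) ((hX 0).mul (cq.sub cc)) ht, evC_mul (hC _) (cpi.sub cb₁) ht, eXq, ebx,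
    evC_mul (hC _) ((hX 1).mul cb₂) ht, evC_mul (hX 1) cb₂ ht, evC_X_zero, evC_X_one] at dal
  rw [H.pi_eq, evC_sub ((hX 0).mul (((hC _).mul (cpi.sub cb₁)).sub
      ((hC _).mul (((hC _).add cal).sub cm)))) ((hC _).mul ((hX 1).mul cb₂)) ht,
    evC_mul (hX 0) (((hC _).mul (cpi.sub cb₁)).sub ((hC _).mul (((hC _).add cal).sub cm))) ht,
    evC_sub ((hC _).mul (cpi.sub cb₁)) ((hC _).mul (((hC _).add cal).sub cm)) ht,
    evC_mul (hC _) (cpi.sub cb₁) ht, evC_mul (hC _) (((hC _).add cal).sub cm) ht, emx, ebx,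
    evC_mul (hC _) ((hX 1).mul cb₂) ht, evC_mul (hX 1) cb₂ ht, evC_X_zero, evC_X_one] at dpi
  rw [H.q_eq, evC_add (((hC _).mul (((hC _).add cal).sub cm)).sub
      ((hC _).mul ((hX 0).mul (cq.sub cc)))) ((hC _).mul cq) ht,
    evC_sub ((hC _).mul (((hC _).add cal).sub cm)) ((hC _).mul ((hX 0).mul (cq.sub cc))) ht,
    evC_mul (hC _) (((hC _).add cal).sub cm) ht, evC_mul (hC _) ((hX 0).mul (cq.sub cc)) ht,
    evC_mul (hC _) cq ht, eXq, emx] at dq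
  rw [H.c_eq, evC_add ((hC _).mul ((cq.mul cm).sub (cal.mul cc))) ((hC _).mul cc) ht,
    evC_mul (hC _) ((cq.mul cm).sub (cal.mul cc)) ht, evC_sub (cq.mul cm) (cal.mul cc) ht,
    evC_mul cq cm ht, evC_mul cal cc ht, evC_mul (hC _) cc ht] at dc
  rw [H.b₁_eq, evC_add ((hC _).mul ((cal.mul cb₁).sub (cpi.mul cm))) ((hC _).mul cb₁) ht,
    evC_mul (hC _) ((cal.mul cb₁).sub (cpi.mul cm)) ht, evC_sub (cal.mul cb₁) (cpi.mul cm) ht,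
    evC_mul cal cb₁ ht, evC_mul cpi cm ht, evC_mul (hC _) cb₁ ht] at db₁
  rw [H.b₂_eq, evC_mul (hC _) (cal.mul cb₂) ht, evC_mul cal cb₂ ht] at db₂
  simp only [evC_C] at dm dal dpi dq dc db₁ db₂
  have hE := Complex.hasDerivAt_exp t
  have hnhds := isOpen_omegaFull.mem_nhds ht
  have tr := congrArg (fun f => evC σ ρ f t) (H.trace hσ)
  rw [evC_add (((hC _).mul cal).add ((hC _).mul ((hX 0).mul cq))) ((hC _).mul cpi) ht,
    evC_add ((hC _).mul cal) ((hC _).mul ((hX 0).mul cq)) ht, evC_mul (hC _) cal ht,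
    evC_mul (hC _) ((hX 0).mul cq) ht, evC_mul (hX 0) cq ht, evC_mul (hC _) cpi ht, evC_X_zero,
    evC_zero] at tr
  simp only [evC_C] at tr
  have gb : HasDerivAt (fun t => evC σ ρ b₁ t + ρ * cpowCov σ t * evC σ ρ b₂ t) _ t :=
    db₁.add (hu.mul db₂)
  have gc : HasDerivAt (evC σ ρ (X 0 * c)) _ t := (hE.mul dc).congr_of_eventuallyEq (by
    filter_upwards [hnhds] with s hs
    rw [evC_mul (hX 0) cc hs, evC_X_zero]; rfl)
  have gmx : HasDerivAt (evC σ ρ (C (σ / 2) + al - m)) _ t :=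
    ((dal.const_add (σ / 2)).sub dm).congr_of_eventuallyEq (by
      filter_upwards [hnhds] with s hs
      rw [evC_sub ((hC _).add cal) cm hs, evC_add (hC _) cal hs, evC_C]; rfl)
  have gbx : HasDerivAt (fun t => evC σ ρ (pi - b₁) t + ρ * cpowCov σ t * evC σ ρ (-b₂) t) _ t :=
    ((dpi.sub db₁).sub (hu.mul db₂)).congr_of_eventuallyEq (by
      filter_upwards [hnhds] with s hs
      rw [evC_sub cpi cb₁ hs, evC_neg]
      simp only [Pi.sub_apply, Pi.mul_apply]
      ring)
  have gcx : HasDerivAt (evC σ ρ (X 0 * (q - c))) _ t :=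
    (hE.mul (dq.sub dc)).congr_of_eventuallyEq (by
      filter_upwards [hnhds] with s hs
      rw [evC_mul (hX 0) (cq.sub cc) hs, evC_X_zero, evC_sub cq cc hs]; rfl)
  refine SchlesingerAt.of_frame hσ0 (dm.congr_deriv ?_) (gb.congr_deriv ?_) (gc.congr_deriv ?_)
    (gmx.congr_deriv ?_) (gbx.congr_deriv ?_) (gcx.congr_deriv ?_) ?_
  · rw [eXc, eXq, ebx, evC_neg]; ring
  · rw [emx, ebx, evC_neg]; ring
  · rw [eXc, eXq, emx]; ring
  · rw [eXc, eXq, ebx, evC_neg]; field_simp; ring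
  · rw [emx, ebx, evC_neg]; field_simp; ring
  · rw [eXc, eXq, emx]; simp only [Pi.sub_apply]; field_simp; ring
  · rw [eXc, eXq, emx, ebx, evC_neg]
    field_simp at tr
    linear_combination (-1 : ℂ) * tr

end

end

/-! ### Geometry of the domains and construction of the family. -/

section

open MvPowerSeries (C X)

section
variable {σ ρ : ℂ} {ε : ℝ}

/-- In the coordinate `t` both norms are constant multiples of `exp (Re (μ t))`, so the domain is an
intersection of convex sublevel sets. -/
theorem isPreconnected_omegaFull : IsPreconnected (OmegaFull σ ε ρ) := by
  have key : ∀ μ : ℂ, ConvexOn ℝ Set.univ fun t : ℂ => Real.exp (μ * t).re := by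
    intro μ
    have := convexOn_exp.comp_linearMap (Complex.reLm ∘ₗ LinearMap.mulLeft ℝ μ)
    simpa using! this
  have h1 : ConvexOn ℝ Set.univ fun t : ℂ => ‖Complex.exp t‖ := by
    simpa [Complex.norm_exp] using key 1
  have h2 : ConvexOn ℝ Set.univ fun t : ℂ => ‖Complex.exp t * (ρ * cpowCov σ t)‖ := by
    have h3 := (key (1 + σ)).smul (norm_nonneg ρ)
    refine h3.congr fun t _ => ?_
    rw [cpowCov, mul_left_comm, ← Complex.exp_add, norm_mul, Complex.norm_exp, ← one_add_mul]
    rfl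
  have h4 := (h1.convex_lt ε).inter (h2.convex_lt ε)
  have h5 : OmegaFull σ ε ρ = {x ∈ Set.univ | ‖Complex.exp x‖ < ε} ∩
      {x ∈ Set.univ | ‖Complex.exp x * (ρ * cpowCov σ x)‖ < ε} := by
    ext t; simp [OmegaFull]
  rw [h5]
  exact h4.isPreconnected

theorem omegaZero_subset (h1 : ε ≤ 1) : OmegaZero σ ε ρ ⊆ OmegaFull σ ε ρ := by
  rintro t ⟨hx, hu⟩
  refine ⟨hx, ?_⟩
  rw [norm_mul]
  have := norm_nonneg (Complex.exp t)
  have := norm_nonneg (ρ * cpowCov σ t)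
  nlinarith

theorem cpowCov_ne_zero (σ t : ℂ) : cpowCov σ t ≠ 0 := Complex.exp_ne_zero _

theorem omegaMinus_subset (h1 : ε ≤ 1) (hρ : ρ ≠ 0) : OmegaMinus σ ε ρ ⊆ OmegaFull σ ε ρ := by
  rintro t ⟨hx, hu⟩
  refine ⟨?_, hx⟩
  have h2 : Complex.exp t = Complex.exp t * (ρ * cpowCov σ t) * (ρ * cpowCov σ t)⁻¹ :=
    (mul_inv_cancel_right₀ (mul_ne_zero hρ (cpowCov_ne_zero σ t)) _).symm
  rw [h2, norm_mul]
  have := norm_nonneg (Complex.exp t * (ρ * cpowCov σ t))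
  have := norm_nonneg (ρ * cpowCov σ t)⁻¹
  nlinarith

theorem omegaFull_mono {ε' : ℝ} (h : ε ≤ ε') : OmegaFull σ ε ρ ⊆ OmegaFull σ ε' ρ :=
  fun _ ht => ⟨ht.1.trans_le h, ht.2.trans_le h⟩

theorem omegaZero_mono {ε' : ℝ} (h : ε ≤ ε') : OmegaZero σ ε ρ ⊆ OmegaZero σ ε' ρ :=
  fun _ ht => ⟨ht.1.trans_le h, ht.2.trans_le h⟩

theorem omegaMinus_mono {ε' : ℝ} (h : ε ≤ ε') : OmegaMinus σ ε ρ ⊆ OmegaMinus σ ε' ρ :=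
  fun _ ht => ⟨ht.1.trans_le h, ht.2.trans_le h⟩

theorem isOpen_omegaZeroTotal : IsOpen (OmegaZeroTotal σ ε) := by
  have h := continuous_cpowCov σ
  have h1 : Continuous fun p : ℂ × ℂ => ‖Complex.exp p.2‖ := by fun_prop
  have h2 : Continuous fun p : ℂ × ℂ => ‖p.1 * cpowCov σ p.2‖ := by fun_prop
  exact (isOpen_lt h1 continuous_const).inter (isOpen_lt h2 continuous_const)

theorem isOpen_omegaMinusTotal : IsOpen (OmegaMinusTotal σ ε) := by
  have h := continuous_cpowCov σ
  have h0 : IsOpen {p : ℂ × ℂ | p.1 ≠ 0} := isOpen_ne_fun continuous_fst continuous_const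
  have h1 : Continuous fun p : ℂ × ℂ => ‖Complex.exp p.2 * (p.1 * cpowCov σ p.2)‖ := by fun_prop
  have h2 : ContinuousOn (fun p : ℂ × ℂ => ‖(p.1 * cpowCov σ p.2)⁻¹‖) {p : ℂ × ℂ | p.1 ≠ 0} := by
    have h3 : Continuous fun p : ℂ × ℂ => p.1 * cpowCov σ p.2 := by fun_prop
    exact (h3.continuousOn.inv₀ fun p hp => mul_ne_zero hp (cpowCov_ne_zero σ p.2)).norm
  have h4 := (isOpen_lt h1 (continuous_const (y := ε))).inter
    (h2.isOpen_inter_preimage h0 (isOpen_Iio (a := ε)))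
  convert h4 using 1
  ext p
  simp only [OmegaMinusTotal, OmegaMinus, Set.mem_inter_iff, Set.mem_ofPred_eq, Set.mem_preimage,
    Set.mem_Iio]
  tauto

theorem eventually_exp_lt {μ : ℝ} (hμ : μ < 0) (c : ℝ) (hε : 0 < ε) :
    ∀ᶠ s : ℝ in atTop, c * Real.exp (s * μ) < ε := by
  have h1 : Tendsto (fun s : ℝ => s * μ) atTop atBot := tendsto_id.atTop_mul_const_of_neg hμ
  have h2 := (Real.tendsto_exp_atBot.comp h1).const_mul c
  rw [mul_zero] at h2
  exact h2.eventually_lt_const hε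

/-- This provides a point where the expansions exclude zeros of the eigenvector components. If `σ`
is not negative real, there is a direction along which both `x` and `x^σ` tend to `0`. If `-1 < σ <
0` and `ρ ≠ 0`, then real `t → -∞` gives `u⁻¹ → 0` and `x u → 0`. -/
theorem exists_mem_omega (hσ : σ ∈ SigmaPlus) (hε : 0 < ε) :
    (OmegaZero σ ε ρ).Nonempty ∨ (ρ ≠ 0 ∧ (OmegaMinus σ ε ρ).Nonempty) := by
  have hσ0 : 0 < ‖σ‖ := norm_pos_iff.2 (SigmaPlus.ne_zero hσ)
  by_cases h : 0 < ‖σ‖ + σ.re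
  · left
    -- This direction makes `Re τ = -(‖σ‖ + Re σ)` and `Re (σ τ) = -‖σ‖ (‖σ‖ + Re σ)`, both
    -- negative.
    set τ : ℂ := -(‖σ‖ + (starRingEnd ℂ) σ) with hτ
    have e1 : τ.re < 0 := by
      simp [hτ]; linarith
    have e2 : (σ * τ).re < 0 := by
      have : (σ * τ).re = -(‖σ‖ * (‖σ‖ + σ.re)) := by
        have h3 := Complex.sq_norm σ
        rw [Complex.normSq_apply] at h3
        simp [hτ]
        linear_combination h3
      rw [this]
      have := mul_pos hσ0 h
      linarith
    obtain ⟨s, h1, h2⟩ :=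
      ((eventually_exp_lt e1 1 hε).and (eventually_exp_lt e2 ‖ρ‖ hε)).exists
    refine ⟨s * τ, ?_, ?_⟩
    · rw [Complex.norm_exp, Complex.re_ofReal_mul]; linarith
    · rw [norm_mul, cpowCov, Complex.norm_exp, mul_left_comm, Complex.re_ofReal_mul]; exact h2
  · have h1 : σ.re ≤ -‖σ‖ := by linarith
    have h2 : σ.im = 0 := by
      have h3 := Complex.sq_norm σ
      rw [Complex.normSq_apply] at h3
      have : σ.im * σ.im ≤ 0 := by nlinarith
      nlinarith
    have h3 : σ.re < 0 := by linarith
    have h4 : -(1 + σ.re) < 0 := by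
      have : ¬ σ.re ≤ -1 := fun h5 => hσ.1 ⟨h2, h5⟩
      linarith
    by_cases hρ : ρ = 0
    · left
      obtain ⟨s, h5⟩ := (eventually_exp_lt (show (-1 : ℝ) < 0 by norm_num) 1 hε).exists
      refine ⟨s * (-1), ?_, by simpa [hρ] using hε⟩
      rw [Complex.norm_exp, Complex.re_ofReal_mul]
      simpa using h5
    · right
      refine ⟨hρ, ?_⟩
      obtain ⟨s, h5, h6⟩ :=
        ((eventually_exp_lt h4 ‖ρ‖ hε).and (eventually_exp_lt h3 ‖ρ‖⁻¹ hε)).exists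
      refine ⟨-s, ?_, ?_⟩
      · rw [cpowCov, mul_left_comm, ← Complex.exp_add, norm_mul, Complex.norm_exp]
        convert h5 using 3
        simp
        ring
      · rw [norm_inv, cpowCov, norm_mul, Complex.norm_exp, mul_inv, ← Real.exp_neg]
        convert h6 using 3
        simp
        ring

end

/-- A holomorphic function on a preconnected open set which is nonzero somewhere has isolated
zeros. -/
theorem eventually_ne_zero_of_differentiableOn {f : ℂ → ℂ} {U : Set ℂ} (hU : IsOpen U)
    (hc : IsPreconnected U) (hf : DifferentiableOn ℂ f U) {t₀ : ℂ} (h₀ : t₀ ∈ U)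
    (hne : ¬ f =ᶠ[𝓝 t₀] 0) {t : ℂ} (ht : t ∈ U) : ∀ᶠ s in 𝓝[≠] t, f s ≠ 0 := by
  have ha := hf.analyticOnNhd hU
  refine (ha t ht).eventually_eq_zero_or_eventually_ne_zero.resolve_left fun h => hne ?_
  have h1 := ha.eqOn_zero_of_preconnected_of_eventuallyEq_zero hc ht h
  filter_upwards [hU.mem_nhds h₀] with s hs using h1 hs

/-- A quotient of slopes of left eigenvectors of a Schlesinger pair is a meromorphic solution of
the fifth Painlevé equation. -/
theorem SchlesingerAt.isSolutionV {θ₀ θₓ θinf : ℂ} (h₀ : θ₀ ≠ 0) (hₓ : θₓ ≠ 0)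
    {a b c d e f r₁ r₂ s₁ s₂ : ℂ → ℂ} {U : Set ℂ} (hU : IsOpen U) (hc : IsPreconnected U)
    (H : ∀ t ∈ U, SchlesingerAt θinf a b c d e f t)
    (hr : ∀ t ∈ U, IsLeftEigen θ₀ (a t) (b t) (c t) (r₁ t) (r₂ t))
    (hs : ∀ t ∈ U, IsLeftEigen θₓ (d t) (e t) (f t) (s₁ t) (s₂ t))
    (hr₁ : DifferentiableOn ℂ r₁ U) (hr₂ : DifferentiableOn ℂ r₂ U)
    (hs₁ : DifferentiableOn ℂ s₁ U) (hs₂ : DifferentiableOn ℂ s₂ U) {t₀ : ℂ} (ht₀ : t₀ ∈ U)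
    (nr₁ : r₁ t₀ ≠ 0) (nr₂ : r₂ t₀ ≠ 0) (ns₁ : s₁ t₀ ≠ 0) (ns₂ : s₂ t₀ ≠ 0) :
    IsSolutionV θ₀ θₓ θinf (fun t => s₂ t * r₁ t / (s₁ t * r₂ t)) U := by
  refine ⟨fun t ht => ?_, fun t ht => ?_, fun t ht _ h0 h1 =>
    SchlesingerAt.eqV h₀ hₓ hU H hr hs hr₁ hr₂ hs₁ hs₂ ht h0 h1⟩
  · have m1 := (hr₁.analyticOnNhd hU t ht).meromorphicAt
    have m2 := (hr₂.analyticOnNhd hU t ht).meromorphicAt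
    have m3 := (hs₁.analyticOnNhd hU t ht).meromorphicAt
    have m4 := (hs₂.analyticOnNhd hU t ht).meromorphicAt
    exact (m4.mul m1).div (m3.mul m2)
  · have key : ∀ {f : ℂ → ℂ}, DifferentiableOn ℂ f U → f t₀ ≠ 0 → ∀ᶠ s in 𝓝[≠] t, f s ≠ 0 :=
      fun hf h => eventually_ne_zero_of_differentiableOn hU hc hf ht₀
        (fun h1 => h h1.self_of_nhds) ht
    have hn := hU.mem_nhds ht₀
    have hD := (hs₂.mul hr₁).sub (hs₁.mul hr₂)
    have hd : ¬ (s₂ * r₁ - s₁ * r₂) =ᶠ[𝓝 t₀] 0 := by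
      intro h
      have h3 : ∀ᶠ s in 𝓝 t₀, s₂ s * r₁ s / (s₁ s * r₂ s) = 1 := by
        filter_upwards [h, (hs₁.differentiableAt hn).continuousAt.eventually_ne ns₁,
          (hr₂.differentiableAt hn).continuousAt.eventually_ne nr₂] with s h4 h5 h6
        rw [div_eq_one_iff_eq (mul_ne_zero h5 h6)]
        exact sub_eq_zero.1 h4
      have h4 := ((H t₀ ht₀).hasDerivAt_quotient h₀ hₓ (Filter.mem_of_superset hn hr)
        (Filter.mem_of_superset hn hs) (hr₁.differentiableAt hn) (hr₂.differentiableAt hn)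
        (hs₁.differentiableAt hn) (hs₂.differentiableAt hn) nr₁ nr₂ ns₁ ns₂).1
      have h5 : HasDerivAt (fun t => s₂ t * r₁ t / (s₁ t * r₂ t)) 0 t₀ :=
        (hasDerivAt_const t₀ (1 : ℂ)).congr_of_eventuallyEq h3
      have h6 := h4.unique h5
      -- At `y = 1` the vector field `fieldY` reduces to `x`, because `a` and the parameters cancel;
      -- so `y` cannot be locally constant equal to `1`.
      rw [h3.self_of_nhds, fieldY] at h6
      refine Complex.exp_ne_zero t₀ ?_
      linear_combination h6
    filter_upwards [key hr₁ nr₁, key hr₂ nr₂, key hs₁ ns₁, key hs₂ ns₂,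
      eventually_ne_zero_of_differentiableOn hU hc hD ht₀ hd ht] with s n1 n2 n3 n4 n5
    refine ⟨div_ne_zero (mul_ne_zero n4 n1) (mul_ne_zero n3 n2), fun h => n5 ?_⟩
    rw [div_eq_one_iff_eq (mul_ne_zero n3 n2)] at h
    exact sub_eq_zero.2 h

/-- Selection of the leading coefficient at `u = ∞`. -/
def ldC (i : Bool) (F G : ℂ) : ℂ := if i then G else F

/-- Selection of the subleading coefficient at `u = ∞`. -/
def sbC (i : Bool) (F : ℂ) : ℂ := if i then F else 0

theorem sgn_mul_self (i : Bool) : sgn i * sgn i = 1 := by cases i <;> simp [sgn]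

/-- One-parameter families of solutions with convergent expansions. -/
theorem exists_family {θ₀ θₓ h σ : ℂ} (h₀ : θ₀ ≠ 0) (hₓ : θₓ ≠ 0) (hσ : σ ∈ SigmaPlus)
    (hh : σ ^ 2 - h ^ 2 ≠ 0) {K : Subfield ℂ} (k₀ : θ₀ ∈ K) (kₓ : θₓ ∈ K) (kh : h ∈ K)
    (kσ : σ ∈ K) {β : ℂ} (kβ : β ∈ K) (hβ : β ≠ 0) (i j : Bool)
    (hs : σ = sgn i * θ₀ + sgn j * θₓ) :
    ∃ (r : ℝ≥0) (y : ℂ → ℂ → ℂ) (Gz Gm : PS), 0 < r ∧ r ≤ 1 ∧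
      Conv r Gz ∧ Conv r Gm ∧ Rat K Gz ∧ Rat K Gm ∧
      (∀ ε : ℝ, 0 < ε → ε ≤ r → ∀ ρ, IsSolutionV θ₀ θₓ h (y ρ) (OmegaFull σ ε ρ)) ∧
      (∀ ρ, ∀ t ∈ OmegaZero σ r ρ, y ρ t = ev Gz (Complex.exp t) (ρ * cpowCov σ t)) ∧
      (∀ ρ, ρ ≠ 0 → ∀ t ∈ OmegaMinus σ r ρ,
        y ρ t = ev Gm (Complex.exp t * (ρ * cpowCov σ t)) (ρ * cpowCov σ t)⁻¹) ∧
      Gz.coeff 0 = 2 * θₓ * fstF σ h i θ₀ / (fstF σ h j θₓ * (2 * θ₀)) ∧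
      Gz.coeff e₁ = Gz.coeff 0 * (sndG j (-β) / (2 * θₓ) + fstG σ h i β / fstF σ h i θ₀
        - fstG σ h j (-β) / fstF σ h j θₓ - sndG i β / (2 * θ₀)) ∧
      Gm.coeff 0 = ldC j (2 * θₓ) (sndG j (-β)) * ldC i (fstF σ h i θ₀) (fstG σ h i β) /
        (ldC j (fstF σ h j θₓ) (fstG σ h j (-β)) * ldC i (2 * θ₀) (sndG i β)) ∧
      Gm.coeff e₁ = Gm.coeff 0 * (sbC j (2 * θₓ) / ldC j (2 * θₓ) (sndG j (-β))
        + sbC i (fstF σ h i θ₀) / ldC i (fstF σ h i θ₀) (fstG σ h i β)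
        - sbC j (fstF σ h j θₓ) / ldC j (fstF σ h j θₓ) (fstG σ h j (-β))
        - sbC i (2 * θ₀) / ldC i (2 * θ₀) (sndG i β)) := by
  have hσ0 := SigmaPlus.ne_zero hσ
  have hpn : (σ + h) * (σ - h) ≠ 0 := by rwa [show (σ + h) * (σ - h) = σ ^ 2 - h ^ 2 by ring]
  have hp : σ + h ≠ 0 := left_ne_zero_of_mul hpn
  have hn : σ - h ≠ 0 := right_ne_zero_of_mul hpn
  have two : (2 : ℂ) ∈ K := ofNat_mem K 2
  have ksg : sgn i ∈ K := by cases i <;> simp [sgn]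
  have k2σ : 2 * σ ∈ K := K.mul_mem two kσ
  -- The three constants are the entries of `P (J/2) P⁻¹`. With this `m₀` the leading diagonal entry
  -- of `Aₓ` is `σ/2 - m₀ = sgn j * θₓ / 2`, as triangular leading parts require.
  obtain ⟨r, v, hr, hv, hK, H⟩ := exists_isSeriesSol hσ (K := K) (m₀ := sgn i * θ₀ / 2) (β := β) kσ
    (K.neg_mem (K.div_mem kh k2σ)) (K.neg_mem (K.div_mem (K.sub_mem kσ kh) k2σ))
    (K.neg_mem (K.div_mem (K.add_mem kσ kh) k2σ)) (K.div_mem (K.mul_mem ksg k₀) two) kβ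
  have hr0 : min r 1 ≤ r := min_le_left _ _
  have cv : ∀ i, Conv (min r 1) (v i) := fun i => (hv i).mono hr0
  have hrpos : 0 < min r 1 := lt_min hr one_pos
  have hr1 : min r 1 ≤ 1 := min_le_right _ _
  generalize min r 1 = R at cv hrpos hr1
  clear hv hr0 hr
  have cal := cv 0
  have cpi := cv 1
  have cm := cv 2
  have cq := cv 3
  have cc := cv 4
  have cb₁ := cv 5
  have cb₂ := cv 6
  have ral := hK 0
  have rpi := hK 1
  have rm := hK 2
  have rq := hK 3
  have rc := hK 4
  have rb₁ := hK 5
  have rb₂ := hK 6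
  clear cv hK
  generalize v 0 = al at *
  generalize v 1 = pi at *
  generalize v 2 = m at *
  generalize v 3 = q at *
  generalize v 4 = c at *
  generalize v 5 = b₁ at *
  generalize v 6 = b₂ at *
  have hC : ∀ a, Conv R (C a) := fun a => Conv.C a
  have hX : ∀ i, Conv R (X i : PS) := fun a => Conv.X a
  have cXc : Conv R (X 0 * c) := (hX 0).mul cc
  have cXq : Conv R (X 0 * (q - c)) := (hX 0).mul (cq.sub cc)
  have cmx : Conv R (C (σ / 2) + al - m) := ((hC _).add cal).sub cm
  have rXc : Rat K (X 0 * c) := (Rat.X 0).mul rc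
  have rXq : Rat K (X 0 * (q - c)) := (Rat.X 0).mul (rq.sub rc)
  have rmx : Rat K (C (σ / 2) + al - m) := ((Rat.C (K.div_mem kσ two)).add ral).sub rm
  have z1 : (X 0 * c : PS).coeff 0 = 0 := MvPowerSeries.coeff_zero_X_mul _ _
  have z2 : (X 0 * (q - c) : PS).coeff 0 = 0 := MvPowerSeries.coeff_zero_X_mul _ _
  have z3 : (C (σ / 2) + al - m : PS).coeff 0 = sgn j * θₓ / 2 := by
    rw [map_sub, map_add, H.al_zero, H.m_zero, MvPowerSeries.coeff_zero_C]
    linear_combination hs / 2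
  have z4 : (pi - b₁ : PS).coeff 0 = 0 := by rw [map_sub, H.pi_zero, H.b₁_zero, sub_self]
  have z5 : (-b₂ : PS).coeff 0 = -β := by rw [map_neg, H.b₂_zero]
  have nb : b₂.coeff 0 ≠ 0 := by rwa [H.b₂_zero]
  have nb' : (-b₂ : PS).coeff 0 ≠ 0 := by rw [z5]; exact neg_ne_zero.2 hβ
  set r₁ := rowFst σ h i θ₀ m b₁ b₂ (X 0 * c) with hr₁
  set r₂ := rowSnd i θ₀ m b₁ b₂ (X 0 * c) with hr₂
  set s₁ := rowFst σ h j θₓ (C (σ / 2) + al - m) (pi - b₁) (-b₂) (X 0 * (q - c)) with hs₁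
  set s₂ := rowSnd j θₓ (C (σ / 2) + al - m) (pi - b₁) (-b₂) (X 0 * (q - c)) with hs₂
  have gr₁ : r₁.Good K R := rowFst_good cm cb₁ cb₂ cXc rm rb₁ rb₂ rXc kσ kh k₀ H.m_zero H.b₁_zero
    z1 h₀ hp hn
  have gr₂ : r₂.Good K R := rowSnd_good cm cb₁ cb₂ cXc rm rb₁ rb₂ rXc k₀ H.m_zero H.b₁_zero z1 h₀
  have gs₁ : s₁.Good K R := rowFst_good cmx (cpi.sub cb₁) cb₂.neg cXq rmx (rpi.sub rb₁) rb₂.neg rXq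
    kσ kh kₓ z3 z4 z2 hₓ hp hn
  have gs₂ : s₂.Good K R := rowSnd_good cmx (cpi.sub cb₁) cb₂.neg cXq rmx (rpi.sub rb₁) rb₂.neg rXq
    kₓ z3 z4 z2 hₓ
  have ar₁ : r₁.Adm i := rowFst_adm nb hp
  have ar₂ : r₂.Adm i := rowSnd_adm nb
  have as₁ : s₁.Adm j := rowFst_adm nb' hp
  have as₂ : s₂.Adm j := rowSnd_adm nb'
  have fr₁ : r₁.F.coeff 0 = fstF σ h i θ₀ := coeff_rowFst_F H.m_zero H.b₁_zero z1
  have fr₂ : r₂.F.coeff 0 = 2 * θ₀ := coeff_rowSnd_F H.m_zero H.b₁_zero z1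
  have fs₁ : s₁.F.coeff 0 = fstF σ h j θₓ := coeff_rowFst_F z3 z4 z2
  have fs₂ : s₂.F.coeff 0 = 2 * θₓ := coeff_rowSnd_F z3 z4 z2
  have tr₁ : r₁.G.coeff 0 = fstG σ h i β := coeff_rowFst_G H.b₂_zero
  have tr₂ : r₂.G.coeff 0 = sndG i β := coeff_rowSnd_G H.b₂_zero
  have ts₁ : s₁.G.coeff 0 = fstG σ h j (-β) := coeff_rowFst_G z5
  have ts₂ : s₂.G.coeff 0 = sndG j (-β) := coeff_rowSnd_G z5
  obtain ⟨Rz, Gz, pz, lz, cGz, rGz, vz, Gz0, Gz1⟩ := exists_quotient_series hrpos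
    (gs₂.conv_atZero hr1) (gr₁.conv_atZero hr1) (gs₁.conv_atZero hr1) (gr₂.conv_atZero hr1)
    gs₂.rat_atZero gr₁.rat_atZero gs₁.rat_atZero gr₂.rat_atZero
    (by rw [LinSeries.coeff_zero_atZero]; exact gs₂.nF)
    (by rw [LinSeries.coeff_zero_atZero]; exact gr₁.nF)
    (by rw [LinSeries.coeff_zero_atZero]; exact gs₁.nF)
    (by rw [LinSeries.coeff_zero_atZero]; exact gr₂.nF)
  obtain ⟨Rm, Gm, pm, lm, cGm, rGm, vm, Gm0, Gm1⟩ := exists_quotient_series hrpos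
    (gs₂.conv_minus (e := j) hr1) (gr₁.conv_minus (e := i) hr1) (gs₁.conv_minus (e := j) hr1)
    (gr₂.conv_minus (e := i) hr1) gs₂.rat_minus gr₁.rat_minus gs₁.rat_minus gr₂.rat_minus
    (by rw [LinSeries.coeff_zero_minus]; exact LinSeries.lead_ne_zero gs₂ as₂)
    (by rw [LinSeries.coeff_zero_minus]; exact LinSeries.lead_ne_zero gr₁ ar₁)
    (by rw [LinSeries.coeff_zero_minus]; exact LinSeries.lead_ne_zero gs₁ as₁)
    (by rw [LinSeries.coeff_zero_minus]; exact LinSeries.lead_ne_zero gr₂ ar₂)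
  simp only [LinSeries.coeff_zero_atZero, LinSeries.coeff_e₁_atZero, fr₁, fr₂, fs₁, fs₂, tr₁, tr₂,
    ts₁, ts₂] at Gz0 Gz1
  simp only [LinSeries.coeff_zero_minus, LinSeries.coeff_e₁_minus, LinSeries.lead, LinSeries.sub,
    fr₁, fr₂, fs₁, fs₂, tr₁, tr₂, ts₁, ts₂] at Gm0 Gm1
  have hzero : ∀ ρ, ∀ t ∈ OmegaZero σ (min Rz Rm : ℝ≥0) ρ,
      r₁.eval σ ρ t ≠ 0 ∧ r₂.eval σ ρ t ≠ 0 ∧ s₁.eval σ ρ t ≠ 0 ∧ s₂.eval σ ρ t ≠ 0 ∧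
      s₂.eval σ ρ t * r₁.eval σ ρ t / (s₁.eval σ ρ t * r₂.eval σ ρ t)
        = ev Gz (Complex.exp t) (ρ * cpowCov σ t) := by
    intro ρ t ht
    have l1 : ((min Rz Rm : ℝ≥0) : ℝ) ≤ Rz := by exact_mod_cast min_le_left _ _
    have l2 : (Rz : ℝ) ≤ R := by exact_mod_cast lz
    have hx := ht.1.le.trans l1
    have hu := ht.2.le.trans l1
    have hx' := hx.trans l2
    have hu' := hu.trans l2
    obtain ⟨n1, n2, n3, n4, e⟩ := vz _ _ hx hu
    rw [gs₂.ev_atZero hr1 hx' hu'] at n1 e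
    rw [gr₁.ev_atZero hr1 hx' hu'] at n2 e
    rw [gs₁.ev_atZero hr1 hx' hu'] at n3 e
    rw [gr₂.ev_atZero hr1 hx' hu'] at n4 e
    exact ⟨n2, n4, n3, n1, e.symm⟩
  have hminus : ∀ ρ, ρ ≠ 0 → ∀ t ∈ OmegaMinus σ (min Rz Rm : ℝ≥0) ρ,
      r₁.eval σ ρ t ≠ 0 ∧ r₂.eval σ ρ t ≠ 0 ∧ s₁.eval σ ρ t ≠ 0 ∧ s₂.eval σ ρ t ≠ 0 ∧
      s₂.eval σ ρ t * r₁.eval σ ρ t / (s₁.eval σ ρ t * r₂.eval σ ρ t)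
        = ev Gm (Complex.exp t * (ρ * cpowCov σ t)) (ρ * cpowCov σ t)⁻¹ := by
    intro ρ hρ t ht
    have l1 : ((min Rz Rm : ℝ≥0) : ℝ) ≤ Rm := by exact_mod_cast min_le_right _ _
    have l2 : (Rm : ℝ) ≤ R := by exact_mod_cast lm
    have hu0 := mul_ne_zero hρ (cpowCov_ne_zero σ t)
    have hw := ht.1.le.trans l1
    have hs := ht.2.le.trans l1
    have hw' := hw.trans l2
    have hs' := hs.trans l2
    have hμ : ∀ e : Bool, (if e then (ρ * cpowCov σ t)⁻¹ else 1) ≠ 0 := by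
      intro e; split_ifs
      exacts [inv_ne_zero hu0, one_ne_zero]
    obtain ⟨n1, n2, n3, n4, e⟩ := vm _ _ hw hs
    rw [gs₂.ev_minus as₂ hr1 hu0 hw' hs'] at n1 e
    rw [gr₁.ev_minus ar₁ hr1 hu0 hw' hs'] at n2 e
    rw [gs₁.ev_minus as₁ hr1 hu0 hw' hs'] at n3 e
    rw [gr₂.ev_minus ar₂ hr1 hu0 hw' hs'] at n4 e
    refine ⟨right_ne_zero_of_mul n2, right_ne_zero_of_mul n4, right_ne_zero_of_mul n3,
      right_ne_zero_of_mul n1, ?_⟩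
    rw [e]
    have hi := hμ i
    have hj := hμ j
    generalize (if i then (ρ * cpowCov σ t)⁻¹ else 1) = μ at *
    generalize (if j then (ρ * cpowCov σ t)⁻¹ else 1) = ν at *
    rw [show ν * s₂.eval σ ρ t * (μ * r₁.eval σ ρ t) = (ν * μ) * (s₂.eval σ ρ t * r₁.eval σ ρ t) by
      ring, show ν * s₁.eval σ ρ t * (μ * r₂.eval σ ρ t)
        = (ν * μ) * (s₁.eval σ ρ t * r₂.eval σ ρ t) by ring, mul_div_mul_left _ _ (mul_ne_zero hj hi)]
  have hRR : ((min Rz Rm : ℝ≥0) : ℝ) ≤ R := by exact_mod_cast (min_le_left _ _).trans lz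
  refine ⟨min Rz Rm, fun ρ t => s₂.eval σ ρ t * r₁.eval σ ρ t / (s₁.eval σ ρ t * r₂.eval σ ρ t),
    Gz, Gm, lt_min pz pm, (min_le_left _ _).trans (lz.trans hr1), cGz.mono (min_le_left _ _),
    cGm.mono (min_le_right _ _), rGz, rGm, ?_, fun ρ t ht => (hzero ρ t ht).2.2.2.2,
    fun ρ hρ t ht => (hminus ρ hρ t ht).2.2.2.2, Gz0, Gz1, Gm0, Gm1⟩
  intro ε hε hεr ρ
  have hε1 : ε ≤ 1 := (hεr.trans hRR).trans (by exact_mod_cast hr1)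
  have hsub : OmegaFull σ ε ρ ⊆ OmegaFull σ R ρ := omegaFull_mono (hεr.trans hRR)
  -- One good point suffices: `OmegaFull` is connected, so none of the four components vanishes
  -- identically near any of its points.
  obtain ⟨t₀, ht₀, n1, n2, n3, n4⟩ : ∃ t₀ ∈ OmegaFull σ ε ρ, r₁.eval σ ρ t₀ ≠ 0 ∧
      r₂.eval σ ρ t₀ ≠ 0 ∧ s₁.eval σ ρ t₀ ≠ 0 ∧ s₂.eval σ ρ t₀ ≠ 0 := by
    rcases exists_mem_omega (ρ := ρ) hσ hε with ⟨t, ht⟩ | ⟨hρ, t, ht⟩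
    · have := hzero ρ t (omegaZero_mono hεr ht)
      exact ⟨t, omegaZero_subset hε1 ht, this.1, this.2.1, this.2.2.1, this.2.2.2.1⟩
    · have := hminus ρ hρ t (omegaMinus_mono hεr ht)
      exact ⟨t, omegaMinus_subset hε1 hρ ht, this.1, this.2.1, this.2.2.1, this.2.2.2.1⟩
  refine SchlesingerAt.isSolutionV h₀ hₓ isOpen_omegaFull isPreconnected_omegaFull
    (fun t ht => H.schlesingerAt hσ cal cpi cm cq cc cb₁ cb₂ (hsub ht))
    (fun t ht => isLeftEigen_rows hσ0 (hsub ht) cm cb₁ cb₂ cXc ?_)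
    (fun t ht => isLeftEigen_rows hσ0 (hsub ht) cmx (cpi.sub cb₁) cb₂.neg cXq ?_)
    (gr₁.differentiableOn_eval.mono hsub) (gr₂.differentiableOn_eval.mono hsub)
    (gs₁.differentiableOn_eval.mono hsub) (gs₂.differentiableOn_eval.mono hsub) ht₀ n1 n2 n3 n4
  · have ht' := hsub ht
    have hd := congrArg (fun f => evC σ ρ f t) (H.det_zero hσ)
    rw [evC_add (cm.mul cm) ((((hX 0).mul cb₁).add ((hX 1).mul cb₂)).mul cc) ht',
      evC_mul cm cm ht', evC_mul (((hX 0).mul cb₁).add ((hX 1).mul cb₂)) cc ht',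
      evC_add ((hX 0).mul cb₁) ((hX 1).mul cb₂) ht', evC_mul (hX 0) cb₁ ht',
      evC_mul (hX 1) cb₂ ht', evC_X_zero, evC_X_one, evC_C] at hd
    rw [evC_mul (hX 0) cc ht', evC_X_zero]
    linear_combination hd + θ₀ ^ 2 / 4 * sgn_mul_self i
  · have ht' := hsub ht
    have hd := congrArg (fun f => evC σ ρ f t) (H.det_x hσ)
    have cB := ((hX 0).mul cb₁).add ((hX 1).mul cb₂)
    rw [evC_add (cmx.mul cmx) ((((hX 0).mul cpi).sub cB).mul (cq.sub cc)) ht',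
      evC_mul cmx cmx ht', evC_mul (((hX 0).mul cpi).sub cB) (cq.sub cc) ht',
      evC_sub ((hX 0).mul cpi) cB ht', evC_mul (hX 0) cpi ht',
      evC_add ((hX 0).mul cb₁) ((hX 1).mul cb₂) ht', evC_mul (hX 0) cb₁ ht',
      evC_mul (hX 1) cb₂ ht', evC_X_zero, evC_X_one, evC_C] at hd
    rw [evC_mul (hX 0) (cq.sub cc) ht', evC_X_zero, evC_sub cpi cb₁ ht', evC_neg]
    have e : σ / 2 - sgn i * θ₀ / 2 = sgn j * θₓ / 2 := by linear_combination hs / 2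
    rw [e] at hd
    linear_combination hd + θₓ ^ 2 / 4 * sgn_mul_self j

end

/-! ### Coefficient rings, normalization and the three choices of signs. -/

section

/-- Quotients of constant polynomials suffice, since an element of the generated field is already a
quotient of elements of `R`. -/
theorem mem_ratValues_of_mem_closure {s : Set ℂ} {R : Subalgebra ℚ ℂ} (hs : s ⊆ R) {z σ : ℂ}
    (hz : z ∈ Subfield.closure s) : z ∈ ratValues R σ := by
  obtain ⟨a, ha, b, hb, rfl⟩ := Subfield.mem_closure_iff.1 hz
  have hle : Subring.closure s ≤ R.toSubring := Subring.closure_le.2 hs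
  by_cases h : b = 0
  -- A fraction with zero denominator has value `0`.
  · exact ⟨0, 1, by simp, by simp [h]⟩
  · refine ⟨Polynomial.C ⟨a, hle ha⟩, Polynomial.C ⟨b, hle hb⟩, ?_, ?_⟩
    · rw [Polynomial.aeval_C]; exact h
    · rw [Polynomial.aeval_C, Polynomial.aeval_C]; rfl

/-- Exponents as pairs of natural numbers. -/
noncomputable def ixEquiv : ℕ × ℕ ≃ Ix where
  toFun p := Finsupp.single 0 p.1 + Finsupp.single 1 p.2
  invFun n := (n 0, n 1)
  left_inv p := by ext <;> simp
  right_inv n := (ix_eq n).symm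

theorem ixEquiv_zero : ixEquiv (0, 0) = 0 := by simp [ixEquiv]

theorem ixEquiv_e₁ : ixEquiv (0, 1) = e₁ := by simp [ixEquiv, e₁]

theorem monom_ixEquiv (z w : ℂ) (p : ℕ × ℕ) : monom z w (ixEquiv p) = z ^ p.1 * w ^ p.2 := by
  simp [monom, ixEquiv]

theorem Conv.hasSum_prod {r : ℝ≥0} {f : PS} {z w : ℂ} (hf : Conv r f) (hz : ‖z‖ ≤ r)
    (hw : ‖w‖ ≤ r) :
    HasSum (fun p : ℕ × ℕ => f.coeff (ixEquiv p) * (z ^ p.1 * w ^ p.2)) (ev f z w) := by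
  have := ixEquiv.hasSum_iff.2 (hf.hasSum hz hw)
  simpa only [Function.comp_def, monom_ixEquiv] using this

/-- Families given by convergent series in `Ω⁰` and `Ω⁻` are holomorphic there. -/
theorem differentiableOn_total {σ : ℂ} {r : ℝ≥0} {y : ℂ → ℂ → ℂ} {Gz Gm : PS} (cz : Conv r Gz)
    (cm : Conv r Gm)
    (hz : ∀ ρ, ∀ t ∈ OmegaZero σ r ρ, y ρ t = ev Gz (Complex.exp t) (ρ * cpowCov σ t))
    (hm : ∀ ρ, ρ ≠ 0 → ∀ t ∈ OmegaMinus σ r ρ,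
      y ρ t = ev Gm (Complex.exp t * (ρ * cpowCov σ t)) (ρ * cpowCov σ t)⁻¹) :
    DifferentiableOn ℂ (fun p : ℂ × ℂ => y p.1 p.2) (OmegaZeroTotal σ r ∪ OmegaMinusTotal σ r) := by
  have hexp : Differentiable ℂ fun p : ℂ × ℂ => Complex.exp p.2 := differentiable_snd.cexp
  have hu : Differentiable ℂ fun p : ℂ × ℂ => p.1 * cpowCov σ p.2 :=
    differentiable_fst.mul (differentiable_snd.const_mul σ).cexp
  rintro p (hp | hp) <;> refine DifferentiableAt.differentiableWithinAt ?_
  · have h1 := cz.differentiableAt (p := (Complex.exp p.2, p.1 * cpowCov σ p.2)) hp.1 hp.2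
    refine (h1.comp p ((hexp p).prodMk (hu p))).congr_of_eventuallyEq ?_
    filter_upwards [isOpen_omegaZeroTotal.mem_nhds hp] with q hq using hz q.1 q.2 hq
  · have h1 := cm.differentiableAt
      (p := (Complex.exp p.2 * (p.1 * cpowCov σ p.2), (p.1 * cpowCov σ p.2)⁻¹)) hp.2.1 hp.2.2
    refine (h1.comp p (((hexp p).mul (hu p)).prodMk
      ((hu p).inv (mul_ne_zero hp.1 (cpowCov_ne_zero _ _))))).congr_of_eventuallyEq ?_
    filter_upwards [isOpen_omegaMinusTotal.mem_nhds hp] with q hq using hm q.1 hq.1 q.2 hq.2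

/-- A one-parameter family of solutions on the domains of size `ε` with leading coefficients
`A`, `κ`, `μ`. -/
structure IsFamily (θ₀ θₓ h σ A κ μ : ℂ) (ε : ℝ) (y : ℂ → ℂ → ℂ) (c d : ℕ → ℕ → ℂ) : Prop where
  isSolution : ∀ ρ : ℂ, IsSolutionV θ₀ θₓ h (y ρ) (OmegaFull σ ε ρ)
  differentiableOn : DifferentiableOn ℂ (fun p : ℂ × ℂ => y p.1 p.2)
    (OmegaZeroTotal σ ε ∪ OmegaMinusTotal σ ε)
  hasSum_zero : ∀ ρ : ℂ, ∀ t ∈ OmegaZero σ ε ρ,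
    HasSum (fun p : ℕ × ℕ =>
      A * (c p.1 p.2 * Complex.exp t ^ p.1 * (ρ * cpowCov σ t) ^ p.2)) (y ρ t)
  hasSum_minus : ∀ ρ : ℂ, ρ ≠ 0 → ∀ t ∈ OmegaMinus σ ε ρ,
    HasSum (fun p : ℕ × ℕ =>
      d p.1 p.2 * Complex.exp t ^ p.1 * (ρ * cpowCov σ t) ^ ((p.1 : ℤ) - (p.2 : ℤ))) (y ρ t)
  c_mem : ∀ n j, c n j ∈ ratValues (QThetaInv θ₀ θₓ h) σ
  d_mem : ∀ n j, d n j ∈ ratValues (QTheta θ₀ θₓ h) σ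
  c_zero : c 0 0 = 1
  d_zero : d 0 0 = 1
  c_one : c 0 1 = κ
  d_one : d 0 1 = μ
  hasSum_taylor : ∀ t : ℂ, ‖Complex.exp t‖ < ε →
    HasSum (fun n : ℕ => A * c n 0 * Complex.exp t ^ n) (y 0 t)

/-- Rescaling `β` rescales `ρ`; `β = (σ - h) / 2` is the normalization giving the prescribed `κ`.
The field `K` contains `σ`, a signed sum of `θ₀` and `θₓ`, so all coefficients stay in the field
generated by the parameters. -/
theorem exists_isFamily {θ₀ θₓ h σ : ℂ} (h₀ : θ₀ ≠ 0) (hₓ : θₓ ≠ 0) (hσ : σ ∈ SigmaPlus)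
    (hh : σ ^ 2 - h ^ 2 ≠ 0) (i j : Bool) (hs : σ = sgn i * θ₀ + sgn j * θₓ) {A κ μ : ℂ}
    (hA : A = 2 * θₓ * fstF σ h i θ₀ / (fstF σ h j θₓ * (2 * θ₀)))
    (hκ : κ = sndG j (-((σ - h) / 2)) / (2 * θₓ) + fstG σ h i ((σ - h) / 2) / fstF σ h i θ₀
        - fstG σ h j (-((σ - h) / 2)) / fstF σ h j θₓ - sndG i ((σ - h) / 2) / (2 * θ₀))
    (h1 : ldC j (2 * θₓ) (sndG j (-((σ - h) / 2))) *
        ldC i (fstF σ h i θ₀) (fstG σ h i ((σ - h) / 2)) /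
        (ldC j (fstF σ h j θₓ) (fstG σ h j (-((σ - h) / 2))) *
          ldC i (2 * θ₀) (sndG i ((σ - h) / 2))) = 1)
    (hμ : μ = sbC j (2 * θₓ) / ldC j (2 * θₓ) (sndG j (-((σ - h) / 2)))
        + sbC i (fstF σ h i θ₀) / ldC i (fstF σ h i θ₀) (fstG σ h i ((σ - h) / 2))
        - sbC j (fstF σ h j θₓ) / ldC j (fstF σ h j θₓ) (fstG σ h j (-((σ - h) / 2)))
        - sbC i (2 * θ₀) / ldC i (2 * θ₀) (sndG i ((σ - h) / 2))) :
    ∃ r : ℝ, 0 < r ∧ ∀ ε : ℝ, 0 < ε → ε ≤ r →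
      ∃ y c d, IsFamily θ₀ θₓ h σ A κ μ ε y c d := by
  have hpn : (σ + h) * (σ - h) ≠ 0 := by rwa [show (σ + h) * (σ - h) = σ ^ 2 - h ^ 2 by ring]
  have hp : σ + h ≠ 0 := left_ne_zero_of_mul hpn
  have hn : σ - h ≠ 0 := right_ne_zero_of_mul hpn
  set K : Subfield ℂ := Subfield.closure {θ₀, θₓ, h} with hK
  have k₀ : θ₀ ∈ K := Subfield.subset_closure (by simp)
  have kₓ : θₓ ∈ K := Subfield.subset_closure (by simp)
  have kh : h ∈ K := Subfield.subset_closure (by simp)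
  have ksg : ∀ i, sgn i ∈ K := by intro i; cases i <;> simp [sgn]
  have kσ : σ ∈ K := hs ▸ K.add_mem (K.mul_mem (ksg i) k₀) (K.mul_mem (ksg j) kₓ)
  obtain ⟨r, y, Gz, Gm, hr, hr1, cz, cm, rz, rm, hsol, vz, vm, z0, z1, m0, m1⟩ :=
    exists_family h₀ hₓ hσ hh k₀ kₓ kh kσ (K.div_mem (K.sub_mem kσ kh) (ofNat_mem K 2))
      (div_ne_zero hn two_ne_zero) i j hs
  rw [← hA] at z0
  rw [h1] at m0
  rw [← hκ, z0] at z1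
  rw [← hμ, m0, one_mul] at m1
  have hf : ∀ k θ, θ ≠ 0 → fstF σ h k θ ≠ 0 := by
    intro k θ hθ
    cases k
    · simpa [fstF] using ⟨hp, hθ⟩
    · simpa [fstF] using ⟨hn, hθ⟩
  have hA0 : A ≠ 0 := by
    rw [hA]
    exact div_ne_zero (mul_ne_zero (mul_ne_zero two_ne_zero hₓ) (hf _ _ h₀))
      (mul_ne_zero (hf _ _ hₓ) (mul_ne_zero two_ne_zero h₀))
  have hsub : ({θ₀, θₓ, h} : Set ℂ) ⊆ QTheta θ₀ θₓ h := Algebra.subset_adjoin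
  have hsub' : ({θ₀, θₓ, h} : Set ℂ) ⊆ QThetaInv θ₀ θₓ h := by
    refine subset_trans ?_ Algebra.subset_adjoin
    intro z hz
    simp only [Set.mem_insert_iff, Set.mem_singleton_iff] at hz ⊢
    tauto
  have hz : ∀ ρ, ∀ t ∈ OmegaZero σ r ρ, HasSum (fun p : ℕ × ℕ =>
      A * (A⁻¹ * Gz.coeff (ixEquiv p) * Complex.exp t ^ p.1 * (ρ * cpowCov σ t) ^ p.2))
      (y ρ t) := by
    intro ρ t ht
    rw [vz ρ t ht]
    convert cz.hasSum_prod ht.1.le ht.2.le using 2 with p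
    field_simp
  refine ⟨r, hr, fun ε hε hεr => ⟨y, fun n j => A⁻¹ * Gz.coeff (ixEquiv (n, j)),
    fun n j => Gm.coeff (ixEquiv (n, j)), ⟨hsol ε hε hεr, ?_, ?_, ?_, ?_, ?_, ?_, ?_, ?_, ?_, ?_⟩⟩⟩
  · refine (differentiableOn_total cz cm vz vm).mono (Set.union_subset_union ?_ ?_)
    · exact fun p hp => omegaZero_mono hεr hp
    · exact fun p hp => ⟨hp.1, omegaMinus_mono hεr hp.2⟩
  · exact fun ρ t ht => hz ρ t (omegaZero_mono hεr ht)
  · intro ρ hρ t ht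
    have ht' := omegaMinus_mono hεr ht
    have hu := mul_ne_zero hρ (cpowCov_ne_zero σ t)
    rw [vm ρ hρ t ht']
    convert cm.hasSum_prod ht'.1.le ht'.2.le using 2 with p
    rw [mul_pow, inv_pow, zpow_sub₀ hu, zpow_natCast, zpow_natCast]
    ring
  · exact fun n j => mem_ratValues_of_mem_closure hsub'
      (K.mul_mem (K.inv_mem (z0 ▸ rz 0)) (rz _))
  · exact fun n j => mem_ratValues_of_mem_closure hsub (rm _)
  · simp only [ixEquiv_zero, z0, inv_mul_cancel₀ hA0]
  · simp only [ixEquiv_zero, m0]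
  · simp only [ixEquiv_e₁, z1, inv_mul_cancel_left₀ hA0]
  · simp only [ixEquiv_e₁, m1]
  · intro t ht
    have h2 := hz 0 t ⟨ht.trans_le hεr, by simpa using hr⟩
    -- For `ρ = 0` only the terms with `j = 0` survive, where `0 ^ 0 = 1`.
    have h3 := (Function.Injective.hasSum_iff (g := fun n : ℕ => (n, 0))
      (fun a b hab => (Prod.mk.inj hab).1) ?_).2 h2
    · convert h3 using 2 with n
      simp [mul_assoc]
    · rintro ⟨n, k⟩ hk
      have : k ≠ 0 := fun h => hk ⟨n, by rw [h]⟩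
      simp [this]

section
variable {θ₀ θₓ h σ : ℂ}

theorem exists_isFamily_add (h₀ : θ₀ ≠ 0) (hₓ : θₓ ≠ 0) (hs : σ = θ₀ + θₓ) (hσ : σ ∈ SigmaPlus)
    (hh : σ ^ 2 - h ^ 2 ≠ 0) : ∃ r : ℝ, 0 < r ∧ ∀ ε : ℝ, 0 < ε → ε ≤ r → ∃ y c d,
      IsFamily θ₀ θₓ h σ 1 (-(σ ^ 2 / (θ₀ * θₓ))) (-(4 * σ ^ 2 / (σ ^ 2 - h ^ 2))) ε y c d := by
  have e : σ ^ 2 - h ^ 2 = (σ + h) * (σ - h) := by ring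
  have hp : σ + h ≠ 0 := left_ne_zero_of_mul (e ▸ hh)
  have hn : σ - h ≠ 0 := right_ne_zero_of_mul (e ▸ hh)
  refine exists_isFamily h₀ hₓ hσ hh true true (by simpa [sgn] using hs) ?_ ?_ ?_ ?_
  · simp [fstF]; field_simp
  · simp [fstF, fstG, sndG]; field_simp; rw [hs]; ring
  · simp [fstG, sndG, ldC, -neg_add_rev]; field_simp
  · rw [e]; simp [fstF, fstG, sndG, ldC, sbC, -neg_add_rev]; field_simp; rw [hs]; ring

theorem exists_isFamily_sub (h₀ : θ₀ ≠ 0) (hₓ : θₓ ≠ 0) (hs : σ = θ₀ - θₓ) (hσ : σ ∈ SigmaPlus)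
    (hh : σ ^ 2 - h ^ 2 ≠ 0) : ∃ r : ℝ, 0 < r ∧ ∀ ε : ℝ, 0 < ε → ε ≤ r → ∃ y c d,
      IsFamily θ₀ θₓ h σ (-((σ - h) / (σ + h))) (-(σ / θ₀))
        (-(4 * θ₀ * σ / (σ ^ 2 - h ^ 2))) ε y c d := by
  have e : σ ^ 2 - h ^ 2 = (σ + h) * (σ - h) := by ring
  have hp : σ + h ≠ 0 := left_ne_zero_of_mul (e ▸ hh)
  have hn : σ - h ≠ 0 := right_ne_zero_of_mul (e ▸ hh)
  refine exists_isFamily h₀ hₓ hσ hh true false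
    (by simpa [sgn, sub_eq_add_neg] using hs) ?_ ?_ ?_ ?_
  · simp [fstF]; field_simp
  · simp [fstF, fstG, sndG]; field_simp; ring
  · simp [fstF, fstG, sndG, ldC, -neg_add_rev]; field_simp
  · rw [e]; simp [fstF, fstG, sndG, ldC, sbC, -neg_add_rev]; field_simp; ring

theorem exists_isFamily_sub_rev (h₀ : θ₀ ≠ 0) (hₓ : θₓ ≠ 0) (hs : σ = θₓ - θ₀)
    (hσ : σ ∈ SigmaPlus) (hh : σ ^ 2 - h ^ 2 ≠ 0) :
    ∃ r : ℝ, 0 < r ∧ ∀ ε : ℝ, 0 < ε → ε ≤ r → ∃ y c d,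
      IsFamily θ₀ θₓ h σ (-((σ + h) / (σ - h))) (-(σ / θₓ))
        (-(4 * θₓ * σ / (σ ^ 2 - h ^ 2))) ε y c d := by
  have e : σ ^ 2 - h ^ 2 = (σ + h) * (σ - h) := by ring
  have hp : σ + h ≠ 0 := left_ne_zero_of_mul (e ▸ hh)
  have hn : σ - h ≠ 0 := right_ne_zero_of_mul (e ▸ hh)
  refine exists_isFamily h₀ hₓ hσ hh false true (by rw [hs]; simp [sgn]; ring) ?_ ?_ ?_ ?_
  · simp [fstF]; field_simp
  · simp [fstF, fstG, sndG]; field_simp; ring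
  · simp [fstF, fstG, sndG, ldC, -neg_add_rev]; field_simp
  · rw [e]; simp [fstF, fstG, sndG, ldC, sbC, -neg_add_rev]; field_simp; ring

end

end

end PainleveV

/-! ### Assembly of the three cases. -/

open PainleveV
theorem mainTheorem5 (θ₀ θₓ θinf : ℂ) (hθ : θ₀ * θₓ ≠ 0) :
    ∃ ε₀ : ℝ, 0 < ε₀ ∧ ε₀ < 1 ∧
      ∀ σ₀ : ℂ, (σ₀ = θ₀ + θₓ ∨ σ₀ = θ₀ - θₓ ∨ σ₀ = θₓ - θ₀) →
        σ₀ ∈ SigmaPlus → σ₀ ^ 2 - θinf ^ 2 ≠ 0 →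
        -- `A` is the constant factor of the expansion in `Ω⁰`; `c n j` is the coefficient of
        -- `x^n (ρ x^σ₀)^j` in `Ω⁰`, and `d n j` that of `x^n (ρ x^σ₀)^(n-j)` in `Ω⁻`
        ∃ (y : ℂ → ℂ → ℂ) (A : ℂ) (c d : ℕ → ℕ → ℂ),
          -- each member of the family is a solution, on a domain containing `Ω⁰_ρ` and `Ω⁻_ρ`
          (∀ ρ : ℂ, IsSolutionV θ₀ θₓ θinf (y ρ) (OmegaFull σ₀ ε₀ ρ)) ∧
          -- holomorphy in `(ρ, x)`
          DifferentiableOn ℂ (fun p : ℂ × ℂ => y p.1 p.2)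
            (OmegaZeroTotal σ₀ ε₀ ∪ OmegaMinusTotal σ₀ ε₀) ∧
          -- the convergent expansions
          (∀ ρ : ℂ, ∀ t ∈ OmegaZero σ₀ ε₀ ρ,
            HasSum (fun p : ℕ × ℕ =>
              A * (c p.1 p.2 * Complex.exp t ^ p.1 * (ρ * cpowCov σ₀ t) ^ p.2)) (y ρ t)) ∧
          (∀ ρ : ℂ, ρ ≠ 0 → ∀ t ∈ OmegaMinus σ₀ ε₀ ρ,
            HasSum (fun p : ℕ × ℕ =>
              d p.1 p.2 * Complex.exp t ^ p.1
                * (ρ * cpowCov σ₀ t) ^ ((p.1 : ℤ) - (p.2 : ℤ))) (y ρ t)) ∧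
          -- the coefficients
          (∀ n j, c n j ∈ ratValues (QThetaInv θ₀ θₓ θinf) σ₀) ∧
          (∀ n j, d n j ∈ ratValues (QTheta θ₀ θₓ θinf) σ₀) ∧
          c 0 0 = 1 ∧ d 0 0 = 1 ∧
          (σ₀ = θ₀ + θₓ →
            A = 1 ∧ c 0 1 = -(σ₀ ^ 2 / (θ₀ * θₓ)) ∧
            d 0 1 = -(4 * σ₀ ^ 2 / (σ₀ ^ 2 - θinf ^ 2))) ∧
          (σ₀ = θ₀ - θₓ →
            A = -((σ₀ - θinf) / (σ₀ + θinf)) ∧ c 0 1 = -(σ₀ / θ₀) ∧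
            d 0 1 = -(4 * θ₀ * σ₀ / (σ₀ ^ 2 - θinf ^ 2))) ∧
          (σ₀ = θₓ - θ₀ →
            A = -((σ₀ + θinf) / (σ₀ - θinf)) ∧ c 0 1 = -(σ₀ / θₓ) ∧
            d 0 1 = -(4 * θₓ * σ₀ / (σ₀ ^ 2 - θinf ^ 2))) ∧
          -- for `ρ = 0` the solution is a convergent Taylor series in `x`
          (∀ t : ℂ, ‖Complex.exp t‖ < ε₀ →
            HasSum (fun n : ℕ => A * c n 0 * Complex.exp t ^ n) (y 0 t)) := by
  have h₀ : θ₀ ≠ 0 := left_ne_zero_of_mul hθ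
  have hₓ : θₓ ≠ 0 := right_ne_zero_of_mul hθ
  -- The radius must be fixed before the conditions on `σ₀` are known. An inadmissible exponent
  -- receives radius `1`, where the claim is vacuous, so a minimum over the three exponents can be
  -- taken.
  have radius : ∀ {σ : ℂ} {P : ℝ → Prop}, (σ ∈ SigmaPlus → σ ^ 2 - θinf ^ 2 ≠ 0 →
      ∃ r : ℝ, 0 < r ∧ ∀ ε : ℝ, 0 < ε → ε ≤ r → P ε) →
      ∃ r : ℝ, 0 < r ∧ ∀ ε : ℝ, 0 < ε → ε ≤ r → σ ∈ SigmaPlus → σ ^ 2 - θinf ^ 2 ≠ 0 → P ε := by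
    intro σ P H
    by_cases h : σ ∈ SigmaPlus ∧ σ ^ 2 - θinf ^ 2 ≠ 0
    · obtain ⟨r, hr, F⟩ := H h.1 h.2
      exact ⟨r, hr, fun ε h1 h2 _ _ => F ε h1 h2⟩
    · exact ⟨1, one_pos, fun ε _ _ h1 h2 => (h ⟨h1, h2⟩).elim⟩
  obtain ⟨r₁, p₁, F₁⟩ := radius fun h1 h2 => exists_isFamily_add h₀ hₓ rfl h1 h2
  obtain ⟨r₂, p₂, F₂⟩ := radius fun h1 h2 => exists_isFamily_sub h₀ hₓ rfl h1 h2
  obtain ⟨r₃, p₃, F₃⟩ := radius fun h1 h2 => exists_isFamily_sub_rev h₀ hₓ rfl h1 h2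
  obtain ⟨ε, hε, l⟩ : ∃ ε : ℝ, 0 < ε ∧ ε < min (min r₁ r₂) (min r₃ 1) :=
    exists_between (lt_min (lt_min p₁ p₂) (lt_min p₃ one_pos))
  simp only [lt_min_iff] at l
  obtain ⟨⟨l₁, l₂⟩, l₃, l₄⟩ := l
  refine ⟨ε, hε, l₄, ?_⟩
  rintro σ (rfl | rfl | rfl) hσ hh
  · obtain ⟨y, c, d, F⟩ := F₁ ε hε l₁.le hσ hh
    exact ⟨y, 1, c, d, F.isSolution, F.differentiableOn, F.hasSum_zero, F.hasSum_minus, F.c_mem,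
      F.d_mem, F.c_zero, F.d_zero, fun _ => ⟨rfl, F.c_one, F.d_one⟩,
      -- The cases never overlap: a coincidence of two exponents would force `θ₀ = 0`, `θₓ = 0` or,
      -- between the two differences, `σ₀ = 0`.
      fun h => (hₓ (by linear_combination h / 2)).elim,
      fun h => (h₀ (by linear_combination h / 2)).elim, F.hasSum_taylor⟩
  · obtain ⟨y, c, d, F⟩ := F₂ ε hε l₂.le hσ hh
    exact ⟨y, _, c, d, F.isSolution, F.differentiableOn, F.hasSum_zero, F.hasSum_minus, F.c_mem,
      F.d_mem, F.c_zero, F.d_zero, fun h => (hₓ (by linear_combination -h / 2)).elim,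
      fun _ => ⟨rfl, F.c_one, F.d_one⟩,
      fun h => (SigmaPlus.ne_zero hσ (by linear_combination h / 2)).elim, F.hasSum_taylor⟩
  · obtain ⟨y, c, d, F⟩ := F₃ ε hε l₃.le hσ hh
    exact ⟨y, _, c, d, F.isSolution, F.differentiableOn, F.hasSum_zero, F.hasSum_minus, F.c_mem,
      F.d_mem, F.c_zero, F.d_zero, fun h => (h₀ (by linear_combination -h / 2)).elim,
      fun h => (SigmaPlus.ne_zero hσ (by linear_combination h / 2)).elim,
      fun _ => ⟨rfl, F.c_one, F.d_one⟩, F.hasSum_taylor⟩
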